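/- Setting. Let $M$ be a Riemannian surface with a closed $2$-form $\beta$. On $T^*M$, with canonical $1$-form $\theta$ and projection $\pi$, put $\omega^\beta=-d\theta-\pi^*\beta$ and $E(x,p)=\tfrac12|p|^2$, and let $\Phi_\sigma$ be the Hamiltonian flow of $E$, with $\omega^\beta(X_E,\cdot)=dE$. For real $\sigma$ let $P_z(\sigma)=(\Phi_\sigma)_*(V_{\Phi_{-\sigma}(z)})\subset T_z^{\mathbb C}T^*M$, where $V$ is the complexified vertical tangent space. The magnetic complex structure exists on all of $T^*M$ if for some $R>1$ and every $z\in T^*M$ the map $\sigma\mapsto P_z(\sigma)$ continues analytically to the disk $|\sigma|<R$, as a holomorphic map into the Grassmannian of complex Lagrangian subspaces of $T_z^{\mathbb C}T^*M$, and if $z\mapsto P_z(i)$ is the $(1,0)$-distribution of a complex structure on $T^*M$; this is then the magnetic complex structure. Theorem. (1) Let $M=\mathbb R^2$ with the metric $\kappa(dx_1^2+dx_2^2)$, $\kappa>0$, and let $\beta=B\,dx_1\wedge dx_2$ with $B\in\mathbb R$ constant. Then the flow $\Phi_\sigma$ exists for all times and is smooth, the magnetic complex structure exists on all of $T^*\mathbb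 R^2$, and $T^*\mathbb R^2$ with it is biholomorphic to $\mathbb C^2$. (2) Let $M=S^2=\{x\in\mathbb R^3: x\cdot x=r^2\}$, $r>0$, with the metric induced from $\mathbb R^3$, let $B\in\mathbb R$ be constant and let $\beta=\frac Br(x_1\,dx_2\wedge dx_3+x_2\,dx_3\wedge dx_1+x_3\,dx_1\wedge dx_2)$, which is $B$ times the area form. Identify $T^*S^2$ with $TS^2=\{(x,p)\in\mathbb R^3\times\mathbb R^3: x\cdot x=r^2,\ x\cdot p=0\}$ by means of the metric. Then: (a) The flow $\Phi_\sigma$ exists for all times and is smooth. For each $(x,p)\in TS^2$ the map $\sigma\mapsto \mathbf a_\sigma(x,p)=\pi(\Phi_\sigma(x,p))$ extends to a holomorphic map from $\mathbb C$ to $\mathbb C^3$, and $\mathbf a:=\mathbf a_i$ is given by $$\mathbf a(x,p)=(\cosh L)\,x+i\,\frac{\sinh L}{L}\,p+\frac{\cosh L-1}{L^2}\,B\,\frac{\mathbf J(x,p)}{r},\qquad L=\frac{\sqrt{|p|^2+r^2B^2}}{r},$$ where $\mathbf J(x,p)=x\times p-rB\,x$ is an equivariant moment map for the action of $\mathrm{SO}(3)$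 on $(TS^2,\omega^\beta)$: for every $\xi\in\mathbb R^3$ the vector field $(\xi\times x,\xi\times p)$ is the Hamiltonian vector field of $\xi\cdot\mathbf J$. (b) The magnetic complex structure exists on all of $T^*S^2$, and with $\omega^\beta$ it is a Kähler structure on all of $T^*S^2$. (c) $\mathbf a$ is a diffeomorphism of $TS^2$ onto the complex sphere $S^2_{\mathbb C}=\{a\in\mathbb C^3: a\cdot a=a_1^2+a_2^2+a_3^2=r^2\}$, and the pullback by $\mathbf a$ of the complex structure of $S^2_{\mathbb C}$ is the magnetic complex structure; in particular $T^*S^2$ with the magnetic complex structure is biholomorphic to $S^2_{\mathbb C}$. -/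

import Mathlib

open scoped Matrix ContDiff

noncomputable section

namespace Magnetic

/-- Ambient space for pairs `(x, p)` of a position and a momentum in `ℝⁿ`. -/
abbrev W (n : ℕ) : Type := (Fin n → ℝ) × (Fin n → ℝ)

/-- The complexification of `W n`. -/
abbrev WC (n : ℕ) : Type := (Fin n → ℂ) × (Fin n → ℂ)

/-- Real part, for the real structure with real points `W n`. -/
def reW {n : ℕ} (w : WC n) : W n := (fun j => (w.1 j).re, fun j => (w.2 j).re)

/-- Imaginary part. -/
def imW {n : ℕ} (w : WC n) : W n := (fun j => (w.1 j).im, fun j => (w.2 j).im)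

/-- The complex vector `a + i b`. -/
def cplx {n : ℕ} (a b : W n) : WC n :=
  (fun j => (a.1 j : ℂ) + Complex.I * (b.1 j : ℂ), fun j => (a.2 j : ℂ) + Complex.I * (b.2 j : ℂ))

/-- The complexification of a real subspace, as a complex subspace: all `a + i b` with `a`, `b` in
the subspace. -/
def complexify {n : ℕ} (V : Submodule ℝ (W n)) : Submodule ℂ (WC n) where
  carrier := {w | reW w ∈ V ∧ imW w ∈ V}
  zero_mem' := by
    have h1 : reW (0 : WC n) = 0 := by ext j <;> simp [reW]
    have h2 : imW (0 : WC n) = 0 := by ext j <;> simp [imW]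
    exact ⟨h1 ▸ V.zero_mem, h2 ▸ V.zero_mem⟩
  add_mem' := by
    intro a b ha hb
    have h1 : reW (a + b) = reW a + reW b := by ext j <;> simp [reW]
    have h2 : imW (a + b) = imW a + imW b := by ext j <;> simp [imW]
    exact ⟨h1 ▸ V.add_mem ha.1 hb.1, h2 ▸ V.add_mem ha.2 hb.2⟩
  smul_mem' := by
    intro c a ha
    have h1 : reW (c • a) = c.re • reW a - c.im • imW a := by ext j <;> simp [reW, imW]
    have h2 : imW (c • a) = c.re • imW a + c.im • reW a := by ext j <;> simp [reW, imW]
    exact ⟨h1 ▸ V.sub_mem (V.smul_mem _ ha.1) (V.smul_mem _ ha.2),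
      h2 ▸ V.add_mem (V.smul_mem _ ha.2) (V.smul_mem _ ha.1)⟩

/-- Data of the (co)tangent bundle of a surface, realised as a submanifold `carrier` of `W n` whose
projection to the surface is `(x, p) ↦ x`: its tangent spaces, a two-form on it (given by an
extension to the ambient space) and an energy function (likewise). Only the two instances `plane`
and `sphere` below are ever used. -/
structure PhaseSpace (n : ℕ) where
  carrier : Set (W n)
  tangent : W n → Submodule ℝ (W n)
  form : W n → W n → W n → ℝ
  energy : W n → ℝ

/-- `T*ℝ²`, with the coordinates `(x₁, x₂, p₁, p₂)`, for the metric `κ (dx₁² + dx₂²)` on `ℝ²` and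
the magnetic field `β = B dx₁ ∧ dx₂`. The form is
`ω - π*β = dx₁ ∧ dp₁ + dx₂ ∧ dp₂ - B dx₁ ∧ dx₂` and the energy is half the squared length of the
covector `p`. -/
def plane (κ B : ℝ) : PhaseSpace 2 where
  carrier := Set.univ
  tangent := fun _ => ⊤
  form := fun _ v w => (v.1 ⬝ᵥ w.2 - w.1 ⬝ᵥ v.2) - B * (v.1 0 * w.1 1 - v.1 1 * w.1 0)
  energy := fun z => (z.2 ⬝ᵥ z.2) / (2 * κ)

/-- `TS² = {(x, p) : x · x = r², x · p = 0}` for the sphere of radius `r` with the metric inherited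
from `ℝ³`, identified with `T*S²` by means of this metric. The canonical one-form is then the
restriction of `p · dx`, so the canonical two-form `ω = -d(p · dx)` is the restriction of
`∑ dx_j ∧ dp_j`. The magnetic field is `β = (B/r)(x₁ dx₂∧dx₃ + x₂ dx₃∧dx₁ + x₃ dx₁∧dx₂)`, that is
`β(u, u') = (B/r) x · (u × u')`: it is `B` times the area form. -/
def sphere (r B : ℝ) : PhaseSpace 3 where
  carrier := {z | z.1 ⬝ᵥ z.1 = r ^ 2 ∧ z.1 ⬝ᵥ z.2 = 0}
  tangent := fun z =>
    { carrier := {v | z.1 ⬝ᵥ v.1 = 0 ∧ v.1 ⬝ᵥ z.2 + z.1 ⬝ᵥ v.2 = 0}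
      zero_mem' := by simp
      add_mem' := by
        rintro a b ⟨ha, ha'⟩ ⟨hb, hb'⟩
        constructor
        · simp only [Prod.fst_add, dotProduct_add]
          linarith
        · simp only [Prod.fst_add, Prod.snd_add, dotProduct_add, add_dotProduct]
          linarith
      smul_mem' := by
        rintro c a ⟨ha, ha'⟩
        constructor
        · simp only [Prod.smul_fst, dotProduct_smul, smul_eq_mul, ha, mul_zero]
        · simp only [Prod.smul_fst, Prod.smul_snd, dotProduct_smul, smul_dotProduct, smul_eq_mul]
          rw [← mul_add, ha', mul_zero] }
  form := fun z v w =>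
    (v.1 ⬝ᵥ w.2 - w.1 ⬝ᵥ v.2) - B / r * (z.1 ⬝ᵥ (crossProduct v.1 w.1))
  energy := fun z => (z.2 ⬝ᵥ z.2) / 2

/-- `f` restricts to a diffeomorphism of `A` onto `B`, for embedded submanifolds `A` and `B` of
normed spaces. -/
def IsDiffeoOn {E F : Type*} [NormedAddCommGroup E] [NormedSpace ℝ E]
    [NormedAddCommGroup F] [NormedSpace ℝ F] (f : E → F) (A : Set E) (B : Set F) : Prop :=
  ContDiffOn ℝ ∞ f A ∧ Set.MapsTo f A B ∧
    ∃ g : F → E, ContDiffOn ℝ ∞ g B ∧ Set.MapsTo g B A ∧ Set.InvOn g f A B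

namespace PhaseSpace

variable {n : ℕ}

/-- `v` is the value at `z` of the Hamiltonian vector field of the energy: `ω(v, ·) = dE`. -/
def IsHamiltonianVector (S : PhaseSpace n) (z v : W n) : Prop :=
  v ∈ S.tangent z ∧ ∀ y ∈ S.tangent z, S.form z v y = fderiv ℝ S.energy z y

/-- `Φ` is the (complete) Hamiltonian flow of the energy. The values of `Φ` outside the phase space
play no role. -/
def IsMagneticFlow (S : PhaseSpace n) (Φ : ℝ → W n → W n) : Prop :=
  ∀ z ∈ S.carrier, Φ 0 z = z ∧ ∀ σ : ℝ, Φ σ z ∈ S.carrier ∧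
    ∃ v, S.IsHamiltonianVector (Φ σ z) v ∧ HasDerivAt (fun s => Φ s z) v σ

/-- `Φ` is smooth on `ℝ ×` phase space. -/
def IsSmoothFlow (S : PhaseSpace n) (Φ : ℝ → W n → W n) : Prop :=
  ContDiffOn ℝ ∞ (fun q : ℝ × W n => Φ q.1 q.2) (Set.univ ×ˢ S.carrier)

/-- The vertical tangent space at `z`: the kernel of the differential of `(x, p) ↦ x`. -/
def vertical (S : PhaseSpace n) (z : W n) : Submodule ℝ (W n) :=
  S.tangent z ⊓ LinearMap.ker (LinearMap.fst ℝ (Fin n → ℝ) (Fin n → ℝ))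

/-- `P_z(σ)` for real `σ`: the push-forward by `Φ σ` of the complexified vertical space at
`Φ (-σ) z`. (The derivative within the phase space of a map that is smooth on it is determined on
tangent vectors, and only these occur here.) -/
def pushVertical (S : PhaseSpace n) (Φ : ℝ → W n → W n) (z : W n) (σ : ℝ) : Submodule ℂ (WC n) :=
  complexify ((S.vertical (Φ (-σ) z)).map
    (fderivWithin ℝ (Φ σ) S.carrier (Φ (-σ) z) : W n →ₗ[ℝ] W n))

/-- The complexified tangent space. -/
def tangentC (S : PhaseSpace n) (z : W n) : Submodule ℂ (WC n) := complexify (S.tangent z)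

/-- The complex bilinear extension of the two-form. -/
def formC (S : PhaseSpace n) (z : W n) (v w : WC n) : ℂ :=
  ((S.form z (reW v) (reW w) - S.form z (imW v) (imW w) : ℝ) : ℂ) +
    Complex.I * ((S.form z (reW v) (imW w) + S.form z (imW v) (reW w) : ℝ) : ℂ)

/-- Complex Lagrangian subspaces of the complexified tangent space: those which equal their own
orthogonal complement for the two-form. -/
def IsLagrangian (S : PhaseSpace n) (z : W n) (P : Submodule ℂ (WC n)) : Prop :=
  P ≤ S.tangentC z ∧ ∀ w ∈ S.tangentC z, (w ∈ P ↔ ∀ v ∈ P, S.formC z w v = 0)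

end PhaseSpace

/-- `P` is holomorphic on the open set `D` as a map to the Grassmannian of two-dimensional complex
subspaces: locally it has a holomorphic frame. -/
def HolomorphicPlanes {n : ℕ} (P : ℂ → Submodule ℂ (WC n)) (D : Set ℂ) : Prop :=
  ∀ σ₀ ∈ D, ∃ U : Set ℂ, IsOpen U ∧ σ₀ ∈ U ∧ ∃ e : Fin 2 → ℂ → WC n,
    (∀ j, DifferentiableOn ℂ (e j) U) ∧
    ∀ σ ∈ U, LinearIndependent ℂ (fun j => e j σ) ∧
      Submodule.span ℂ (Set.range (fun j => e j σ)) = P σ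

namespace PhaseSpace

variable {n : ℕ}

/-- `P` is an analytic continuation of `σ ↦ P_z(σ)` to the disk of radius `R` about the origin, as
a holomorphic map to the Grassmannian of complex Lagrangian subspaces of the complexified tangent
space at `z`. -/
def IsContinuation (S : PhaseSpace n) (Φ : ℝ → W n → W n) (z : W n) (R : ℝ)
    (P : ℂ → Submodule ℂ (WC n)) : Prop :=
  (∀ σ : ℝ, |σ| < R → P (σ : ℂ) = S.pushVertical Φ z σ) ∧
    (∀ σ ∈ Metric.ball (0 : ℂ) R, S.IsLagrangian z (P σ)) ∧
    HolomorphicPlanes P (Metric.ball (0 : ℂ) R)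

/-- `F` is holomorphic along `A`, a relatively open subset of the phase space, for the almost
complex structure `J`: its differential intertwines `J` with multiplication by `i`. -/
def IsHolomorphicOn (S : PhaseSpace n) (J : W n → W n →ₗ[ℝ] W n) {m : ℕ}
    (F : W n → Fin m → ℂ) (A : Set (W n)) : Prop :=
  ∀ z ∈ A, ∀ v ∈ S.tangent z,
    fderivWithin ℝ F A z (J z v) = Complex.I • fderivWithin ℝ F A z v

/-- `J` is (the almost complex structure of) a complex structure on the phase space, a manifold of
complex dimension two: around every point there is a holomorphic chart. -/
def IsComplexStructure (S : PhaseSpace n) (J : W n → W n →ₗ[ℝ] W n) : Prop :=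
  (∀ z ∈ S.carrier, ∀ v ∈ S.tangent z, J z v ∈ S.tangent z ∧ J z (J z v) = -v) ∧
    ∀ z ∈ S.carrier, ∃ U : Set (W n), IsOpen U ∧ z ∈ U ∧
      ∃ (φ : W n → Fin 2 → ℂ) (O : Set (Fin 2 → ℂ)), IsOpen O ∧
        IsDiffeoOn φ (S.carrier ∩ U) O ∧ S.IsHolomorphicOn J φ (S.carrier ∩ U)

/-- The subspace of vectors of type `(1,0)`: the `i`-eigenspace of the complex linear extension of
`J` in the complexified tangent space. -/
def type10 (S : PhaseSpace n) (J : W n → W n →ₗ[ℝ] W n) (z : W n) : Set (WC n) :=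
  {w | w ∈ S.tangentC z ∧ cplx (J z (reW w)) (J z (imW w)) = Complex.I • w}

/-- `J` is the magnetic complex structure on the whole phase space: `σ ↦ P_z(σ)` continues
analytically to a disk of radius greater than one, and `J` is a complex structure whose
`(1,0)`-distribution is `P_z(i)`. -/
def IsMagneticComplexStructure (S : PhaseSpace n) (Φ : ℝ → W n → W n)
    (J : W n → W n →ₗ[ℝ] W n) : Prop :=
  S.IsComplexStructure J ∧
    ∃ R : ℝ, 1 < R ∧ ∀ z ∈ S.carrier, ∃ P : ℂ → Submodule ℂ (WC n),
      S.IsContinuation Φ z R P ∧ (P Complex.I : Set (WC n)) = S.type10 J z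

/-- The complex structure `J` and the two-form make the phase space a Kähler manifold: the form is
closed, `J`-invariant, and `form(v, J v) > 0` for nonzero `v`. -/
def IsKahler (S : PhaseSpace n) (J : W n → W n →ₗ[ℝ] W n) : Prop :=
  S.IsComplexStructure J ∧
  (∀ z ∈ S.carrier, ∀ u ∈ S.tangent z, ∀ v ∈ S.tangent z, ∀ w ∈ S.tangent z,
    fderiv ℝ (fun y => S.form y v w) z u + fderiv ℝ (fun y => S.form y w u) z v +
      fderiv ℝ (fun y => S.form y u v) z w = 0) ∧
  (∀ z ∈ S.carrier, ∀ v ∈ S.tangent z, ∀ w ∈ S.tangent z,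
    S.form z (J z v) (J z w) = S.form z v w) ∧
  ∀ z ∈ S.carrier, ∀ v ∈ S.tangent z, v ≠ 0 → 0 < S.form z v (J z v)

/-- `F` is a biholomorphism of the phase space with the complex structure `J` onto the complex
submanifold `N` of `ℂᵐ`: a diffeomorphism that pulls back the complex structure of `N` to `J`. -/
def IsBiholomorphism (S : PhaseSpace n) (J : W n → W n →ₗ[ℝ] W n) {m : ℕ}
    (F : W n → Fin m → ℂ) (N : Set (Fin m → ℂ)) : Prop :=
  IsDiffeoOn F S.carrier N ∧ S.IsHolomorphicOn J F S.carrier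

end PhaseSpace

/-- `{a ∈ ℂ³ : a₁² + a₂² + a₃² = r²}`. -/
def complexSphere (r : ℝ) : Set (Fin 3 → ℂ) := {a | a ⬝ᵥ a = (r : ℂ) ^ 2}

/-- `J(x, p) = x × p - r B x`. -/
def moment (r B : ℝ) (z : W 3) : Fin 3 → ℝ := crossProduct z.1 z.2 - (r * B) • z.1

/-- `μ` is an equivariant moment map for the action `(x, p) ↦ (A x, A p)` of `SO(3)`, where `so(3)`
is identified with `ℝ³` in such a way that `ξ` acts by the vector field `(ξ × x, ξ × p)`. -/
def IsMomentMap (S : PhaseSpace 3) (μ : W 3 → Fin 3 → ℝ) : Prop :=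
  (∀ ξ : Fin 3 → ℝ, ∀ z ∈ S.carrier,
    (crossProduct ξ z.1, crossProduct ξ z.2) ∈ S.tangent z ∧
    ∀ v ∈ S.tangent z, S.form z (crossProduct ξ z.1, crossProduct ξ z.2) v =
      fderiv ℝ (fun y => ξ ⬝ᵥ μ y) z v) ∧
  ∀ A ∈ Matrix.specialOrthogonalGroup (Fin 3) ℝ, ∀ z ∈ S.carrier,
    (A *ᵥ z.1, A *ᵥ z.2) ∈ S.carrier ∧ μ (A *ᵥ z.1, A *ᵥ z.2) = A *ᵥ μ z

/-- `L = √(p² + r² B²) / r`. -/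
def ell (r B : ℝ) (z : W 3) : ℝ := Real.sqrt (z.2 ⬝ᵥ z.2 + r ^ 2 * B ^ 2) / r

/-- `a(x, p) = (cosh L) x + i (sinh L / L) p + ((cosh L - 1) / L²) B J(x, p) / r`. When `L = 0` one
has `p = 0` and `B = 0`, so the values given to the two quotients are then irrelevant. -/
def sphereMap (r B : ℝ) (z : W 3) : Fin 3 → ℂ := fun j =>
  ((Real.cosh (ell r B z) * z.1 j : ℝ) : ℂ) +
    Complex.I * ((Real.sinh (ell r B z) / ell r B z * z.2 j : ℝ) : ℂ) +
    (((Real.cosh (ell r B z) - 1) / ell r B z ^ 2 * B * (moment r B z j / r) : ℝ) : ℂ)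

end Magnetic

end

/-! On the sphere put j = J/r² (`angVel`). Then j × x = p, and the Hamiltonian field of the energy
is (j × x, j × p). Rotation about j fixes j, so j is conserved along trajectories and the flow is
Φ_σ = exp(σ j×), where the axis j depends on the trajectory. By Rodrigues' formula exp(σ j×) = 1 + s
j× + c (j×)² with s = sin(√u σ)/√u, c = (1 - cos(√u σ))/u and u = j · j. These coefficients are
entire in σ and u, so the flow continues to all complex times; at σ = i they become hyperbolic
functions and give the formula for a.

Tangent vectors are written (ξ × x, b × x + ξ × p) with b ⊥ x. Along such a vector j varies by ξ × j
+ b (`angVelDeriv_tangent`), and the two-form is r²((ξ × ξ') · j + ξ · b' - ξ' · b) (`form_param`).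
Varying j in exp(σ j×) brings in its integral N(σ) = s + c j× + d j jᵀ (`rot_variation`), and the
differential of π ∘ Φ_σ sends the vector to (ξ + N(σ) b) × exp(σ j×) x (`flow_deriv_tangent`). The
pushed vertical space P(σ) is the kernel of the differential of π ∘ Φ_{-σ}; it consists of the
vectors with ξ = M b, where M = -N(-σ). It is thus the image of the fixed plane x^⊥ under a linear
map entire in σ (`frame`). The vector identities are proved over an arbitrary field from the
relation s² + u c² = 2c and its companions, so one computation serves real time (`pushVertical_eq`)
and complex time (`isLagrangian_contP`).

At σ = i, P(i) is the kernel of the complexified differential of the conjugate of a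
(`mem_contP_I_iff`), which is the (1,0)-space of the structure pulled back by a. The hermitian form
on P(i) is definite (`hermitian_pos`). This gives Kähler positivity, and also the injectivity of da:
a real vector killed by da lies in P(i) and is null for that form. Counting dimensions, da maps onto
the tangent space of the complex sphere. Globally, Im a is a positive multiple of p and |Im a|² is a
strictly increasing function of u on [B², ∞); hence u, then p, then x are recovered smoothly from a
(`exists_inverse_aMap`).

The plane is the linear case: p rotates with constant frequency B/κ, and the base point at time i is
a real linear isomorphism onto ℂ². In both cases every flow satisfying the definition equals the
explicit one, by uniqueness for a linear equation. -/

noncomputable section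

namespace Magnetic

/-! ### Entire functions of the square: sin √t / √t and its companions -/

/-- An even entire function is an entire function of the square of its argument. -/
theorem exists_entire_sq {f : ℂ → ℂ} (hf : Differentiable ℂ f) (heven : ∀ z, f (-z) = f z) :
    ∃ g : ℂ → ℂ, Differentiable ℂ g ∧ ∀ z, g (z ^ 2) = f z := by
  have hsq : ∀ t : ℂ, (t ^ (2⁻¹ : ℂ)) ^ 2 = t := fun t => by
    simp
  have hpm : ∀ z w : ℂ, z ^ 2 = w ^ 2 → f z = f w := by
    intro z w h
    rcases sq_eq_sq_iff_eq_or_eq_neg.1 h with h | h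
    · rw [h]
    · rw [h, heven]
  have hne : ∀ t₀ : ℂ, t₀ ≠ 0 → DifferentiableAt ℂ (fun t : ℂ => f (t ^ (2⁻¹ : ℂ))) t₀ := by
    intro t₀ ht₀
    -- The principal root may jump at `t₀`. The product below is a root of `t` that is holomorphic
    -- near `t₀`; it differs from the principal one at most by a sign, which the even function `f`
    -- does not see.
    have h1 : (fun t : ℂ => f (t ^ (2⁻¹ : ℂ))) =
        fun t => f (t₀ ^ (2⁻¹ : ℂ) * (t / t₀) ^ (2⁻¹ : ℂ)) := by
      funext t
      apply hpm
      rw [mul_pow, hsq, hsq, hsq]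
      field_simp
    rw [h1]
    apply (hf _).comp
    apply DifferentiableAt.const_mul
    apply DifferentiableAt.cpow_const
    · fun_prop
    · simp [ht₀]
  refine ⟨fun t => f (t ^ (2⁻¹ : ℂ)), fun t => ?_, fun z => hpm _ _ (hsq _)⟩
  by_cases ht : t = 0
  · subst ht
    refine (Complex.analyticAt_of_differentiable_on_punctured_nhds_of_continuousAt
      (eventually_nhdsWithin_of_forall fun t ht => hne t ht) ?_).differentiableAt
    have : ContinuousAt (fun t : ℂ => t ^ (2⁻¹ : ℂ)) 0 := by
      have h := Complex.continuousAt_cpow_zero_of_re_pos (z := (2⁻¹ : ℂ)) (by norm_num)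
      exact ContinuousAt.comp (f := fun t : ℂ => (t, (2⁻¹ : ℂ))) h (by fun_prop)
    exact ContinuousAt.comp (hf _).continuousAt this
  · exact hne t ht

theorem differentiable_dslope {f : ℂ → ℂ} (hf : Differentiable ℂ f) (a : ℂ) :
    Differentiable ℂ (dslope f a) := by
  rw [← differentiableOn_univ, Complex.differentiableOn_dslope Filter.univ_mem]
  exact hf.differentiableOn

/-- Every complex number is a square and the nonzero ones are dense. Identities in t may therefore
be checked at t = z² with z ≠ 0, where powers of z can be cancelled and trigonometric identities
apply. -/
theorem eq_of_eq_off_zero {f g : ℂ → ℂ} (hf : Continuous f) (hg : Continuous g)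
    (h : ∀ z, z ≠ 0 → f (z ^ 2) = g (z ^ 2)) (t : ℂ) : f t = g t := by
  have : f = g := by
    refine Continuous.ext_on (dense_compl_singleton (0 : ℂ)) hf hg fun t ht => ?_
    obtain ⟨z, rfl⟩ : ∃ z : ℂ, z ^ 2 = t :=
      ⟨t ^ (2⁻¹ : ℂ), by simp⟩
    exact h z (by rintro rfl; simp at ht)
  rw [this]

/-- The entire functions `sin √t / √t`, `(1 - cos √t) / t` and `(√t - sin √t) / √t ^ 3`, with their
algebraic and differential relations. -/
theorem exists_sinc_functions : ∃ S C D : ℂ → ℂ,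
    Differentiable ℂ S ∧ Differentiable ℂ C ∧ Differentiable ℂ D ∧
    (∀ z, z * S (z ^ 2) = Complex.sin z) ∧ (∀ z, z ^ 2 * C (z ^ 2) = 1 - Complex.cos z) ∧
    S 0 = 1 ∧
    (∀ t, t * D t = 1 - S t) ∧ (∀ t, S t ^ 2 + t * C t ^ 2 = 2 * C t) ∧
    (∀ t, HasDerivAt S ((D t - C t) / 2) t) ∧
    (∀ t, HasDerivAt C ((D t * S t - C t ^ 2) / 2) t) := by
  obtain ⟨c₀, hc₀, hcos⟩ := exists_entire_sq Complex.differentiable_cos Complex.cos_neg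
  have hsl : ∀ z : ℂ, z * dslope Complex.sin 0 z = Complex.sin z := fun z => by
    simpa using sub_smul_dslope Complex.sin 0 z
  obtain ⟨S, hS, hsin⟩ := exists_entire_sq (differentiable_dslope Complex.differentiable_sin 0)
    (by
      intro z
      by_cases hz : z = 0
      · simp [hz]
      · apply mul_left_cancel₀ (neg_ne_zero.2 hz)
        rw [hsl, neg_mul, hsl, Complex.sin_neg])
  have hS1 : S 0 = 1 := by
    have := hsin 0
    simpa [dslope_same] using this
  have hc1 : c₀ 0 = 1 := by simpa using hcos 0
  have hzS : ∀ z, z * S (z ^ 2) = Complex.sin z := fun z => by rw [hsin, hsl]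
  set C : ℂ → ℂ := fun t => -dslope c₀ 0 t with hCdef
  set D : ℂ → ℂ := fun t => -dslope S 0 t with hDdef
  have hC : Differentiable ℂ C := (differentiable_dslope hc₀ 0).neg
  have hD : Differentiable ℂ D := (differentiable_dslope hS 0).neg
  have htC : ∀ t, t * C t = 1 - c₀ t := fun t => by
    have := sub_smul_dslope c₀ 0 t
    simp only [sub_zero, smul_eq_mul, hc1] at this
    rw [hCdef]; linear_combination -this
  have htD : ∀ t, t * D t = 1 - S t := fun t => by
    have := sub_smul_dslope S 0 t
    simp only [sub_zero, smul_eq_mul, hS1] at this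
    rw [hDdef]; linear_combination -this
  have hzC : ∀ z, z ^ 2 * C (z ^ 2) = 1 - Complex.cos z := fun z => by rw [htC, hcos]
  clear_value C D
  have hR4 : ∀ t, S t ^ 2 + t * C t ^ 2 = 2 * C t := by
    refine eq_of_eq_off_zero (by have := hS.continuous; have := hC.continuous; fun_prop)
      (by have := hC.continuous; fun_prop) fun z hz => ?_
    apply mul_left_cancel₀ (pow_ne_zero 2 hz)
    have h1 := hzS z
    have h2 := hzC z
    have h3 := Complex.sin_sq_add_cos_sq z
    rw [← h1] at h3
    have h4 : Complex.cos z = 1 - z ^ 2 * C (z ^ 2) := by rw [h2]; ring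
    rw [h4] at h3
    linear_combination h3
  have hdS : Continuous (deriv S) := (hS.contDiff (n := 1)).continuous_deriv le_rfl
  have hdC : Continuous (deriv C) := (hC.contDiff (n := 1)).continuous_deriv le_rfl
  have hcS := hS.continuous
  have hcC := hC.continuous
  have hcD := hD.continuous
  have hR2 : ∀ t, deriv S t = (D t - C t) / 2 := by
    refine eq_of_eq_off_zero hdS (by fun_prop) fun z hz => ?_
    have h1 : HasDerivAt (fun z => z * S (z ^ 2))
        (1 * S (z ^ 2) + z * (deriv S (z ^ 2) * (2 * z))) z := by
      have h := (hasDerivAt_id z).mul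
        ((hS (z ^ 2)).hasDerivAt.comp z (by simpa using hasDerivAt_pow 2 z))
      exact h
    rw [funext hzS] at h1
    have h2 := h1.unique (Complex.hasDerivAt_sin z)
    have h3 := hzC z
    have h4 := htD (z ^ 2)
    apply mul_left_cancel₀ (pow_ne_zero 2 hz)
    linear_combination h2 / 2 - h4 / 2 + h3 / 2
  have hR3 : ∀ t, deriv C t = (D t * S t - C t ^ 2) / 2 := by
    refine eq_of_eq_off_zero hdC (by fun_prop) fun z hz => ?_
    have h1 : HasDerivAt (fun z => z ^ 2 * C (z ^ 2))
        ((2 * z) * C (z ^ 2) + z ^ 2 * (deriv C (z ^ 2) * (2 * z))) z := by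
      have h0 : HasDerivAt (fun z : ℂ => z ^ 2) (2 * z) z := by simpa using hasDerivAt_pow 2 z
      exact h0.mul ((hC (z ^ 2)).hasDerivAt.comp z h0)
    rw [funext hzC] at h1
    have h2 := h1.unique ((Complex.hasDerivAt_cos z).const_sub 1)
    have h3 := hzS z
    have h4 := htD (z ^ 2)
    have h5 := hR4 (z ^ 2)
    apply mul_left_cancel₀ (pow_ne_zero 3 hz)
    linear_combination h2 / 2 - h3 / 2 - z * S (z ^ 2) * h4 / 2 + z * h5 / 2
  exact ⟨S, C, D, hS, hC, hD, hzS, hzC, hS1, htD, hR4,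
    fun t => hR2 t ▸ (hS t).hasDerivAt, fun t => hR3 t ▸ (hC t).hasDerivAt⟩

/-- The entire function with `sincS (z ^ 2) = sin z / z`. -/
def sincS : ℂ → ℂ := exists_sinc_functions.choose

/-- The entire function with `sincC (z ^ 2) = (1 - cos z) / z ^ 2`. -/
def sincC : ℂ → ℂ := exists_sinc_functions.choose_spec.choose

/-- The entire function with `sincD (z ^ 2) = (z - sin z) / z ^ 3`. -/
def sincD : ℂ → ℂ := exists_sinc_functions.choose_spec.choose_spec.choose

theorem sinc_spec : Differentiable ℂ sincS ∧ Differentiable ℂ sincC ∧ Differentiable ℂ sincD ∧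
    (∀ z, z * sincS (z ^ 2) = Complex.sin z) ∧
    (∀ z, z ^ 2 * sincC (z ^ 2) = 1 - Complex.cos z) ∧ sincS 0 = 1 ∧
    (∀ t, t * sincD t = 1 - sincS t) ∧ (∀ t, sincS t ^ 2 + t * sincC t ^ 2 = 2 * sincC t) ∧
    (∀ t, HasDerivAt sincS ((sincD t - sincC t) / 2) t) ∧
    (∀ t, HasDerivAt sincC ((sincD t * sincS t - sincC t ^ 2) / 2) t) :=
  exists_sinc_functions.choose_spec.choose_spec.choose_spec

@[fun_prop] theorem differentiable_sincS : Differentiable ℂ sincS := sinc_spec.1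
@[fun_prop] theorem differentiable_sincC : Differentiable ℂ sincC := sinc_spec.2.1
@[fun_prop] theorem differentiable_sincD : Differentiable ℂ sincD := sinc_spec.2.2.1
theorem mul_sincS_sq (z : ℂ) : z * sincS (z ^ 2) = Complex.sin z := sinc_spec.2.2.2.1 z
theorem sq_mul_sincC_sq (z : ℂ) : z ^ 2 * sincC (z ^ 2) = 1 - Complex.cos z :=
  sinc_spec.2.2.2.2.1 z
theorem sincS_zero : sincS 0 = 1 := sinc_spec.2.2.2.2.2.1
theorem mul_sincD (t : ℂ) : t * sincD t = 1 - sincS t := sinc_spec.2.2.2.2.2.2.1 t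
theorem sincS_sq_add (t : ℂ) : sincS t ^ 2 + t * sincC t ^ 2 = 2 * sincC t :=
  sinc_spec.2.2.2.2.2.2.2.1 t
theorem hasDerivAt_sincS (t : ℂ) : HasDerivAt sincS ((sincD t - sincC t) / 2) t :=
  sinc_spec.2.2.2.2.2.2.2.2.1 t
theorem hasDerivAt_sincC (t : ℂ) :
    HasDerivAt sincC ((sincD t * sincS t - sincC t ^ 2) / 2) t :=
  sinc_spec.2.2.2.2.2.2.2.2.2 t

/-- Reality of the function: conjugating its defining relation with the sine returns the same
relation. It lets the coefficients at real arguments be treated as real numbers. -/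
theorem conj_sincS (t : ℂ) : star (sincS (star t)) = sincS t := by
  refine eq_of_eq_off_zero (f := fun t => star (sincS (star t)))
    (by have := differentiable_sincS.continuous; fun_prop)
    differentiable_sincS.continuous (fun z hz => ?_) t
  apply mul_left_cancel₀ hz
  have h := congrArg star (mul_sincS_sq (star z))
  simp only [Complex.star_def, map_mul, map_pow, Complex.conj_conj, ← Complex.sin_conj] at h ⊢
  rw [mul_sincS_sq, h]

theorem conj_sincC (t : ℂ) : star (sincC (star t)) = sincC t := by
  refine eq_of_eq_off_zero (f := fun t => star (sincC (star t)))
    (by have := differentiable_sincC.continuous; fun_prop)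
    differentiable_sincC.continuous (fun z hz => ?_) t
  apply mul_left_cancel₀ (pow_ne_zero 2 hz)
  have h := congrArg star (sq_mul_sincC_sq (star z))
  simp only [Complex.star_def, map_mul, map_pow, map_sub, map_one, Complex.conj_conj,
    ← Complex.cos_conj] at h ⊢
  rw [sq_mul_sincC_sq, h]

theorem conj_sincD (t : ℂ) : star (sincD (star t)) = sincD t := by
  refine eq_of_eq_off_zero (f := fun t => star (sincD (star t)))
    (by have := differentiable_sincD.continuous; fun_prop)
    differentiable_sincD.continuous (fun z hz => ?_) t
  apply mul_left_cancel₀ (pow_ne_zero 2 hz)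
  have h := congrArg star (mul_sincD (star (z ^ 2)))
  rw [mul_sincD, ← conj_sincS]
  simpa using h

/-! ### Rodrigues coefficients in complex time -/

/-- The coefficient `sin (√u σ) / √u`. -/
def cs (σ u : ℂ) : ℂ := σ * sincS (σ ^ 2 * u)

/-- The coefficient `(1 - cos (√u σ)) / u`. -/
def cc (σ u : ℂ) : ℂ := σ ^ 2 * sincC (σ ^ 2 * u)

/-- The coefficient `(σ - sin (√u σ) / √u) / u`. -/
def cd (σ u : ℂ) : ℂ := σ ^ 3 * sincD (σ ^ 2 * u)

theorem mul_cd (σ u : ℂ) : u * cd σ u = σ - cs σ u := by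
  unfold cd cs
  linear_combination σ * mul_sincD (σ ^ 2 * u)

/-- This is sin² + cos² = 1 with the square root of u removed; it is what makes `rot` orthogonal. -/
theorem cs_sq_add (σ u : ℂ) : cs σ u ^ 2 + u * cc σ u ^ 2 = 2 * cc σ u := by
  unfold cc cs
  linear_combination σ ^ 2 * sincS_sq_add (σ ^ 2 * u)

@[simp] theorem cs_neg (σ u : ℂ) : cs (-σ) u = -cs σ u := by simp [cs]
@[simp] theorem cc_neg (σ u : ℂ) : cc (-σ) u = cc σ u := by simp [cc]
@[simp] theorem cd_neg (σ u : ℂ) : cd (-σ) u = -cd σ u := by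
  simp [cd, Odd.neg_pow (show Odd 3 by decide)]
@[simp] theorem cs_zero (u : ℂ) : cs 0 u = 0 := by simp [cs]
@[simp] theorem cc_zero (u : ℂ) : cc 0 u = 0 := by simp [cc]

theorem conj_cs (σ u : ℂ) : star (cs (star σ) (star u)) = cs σ u := by
  have := conj_sincS (σ ^ 2 * u)
  simp only [cs, star_mul', star_star, star_pow] at this ⊢
  rw [this]

theorem conj_cc (σ u : ℂ) : star (cc (star σ) (star u)) = cc σ u := by
  have := conj_sincC (σ ^ 2 * u)
  simp only [cc, star_mul', star_star, star_pow] at this ⊢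
  rw [this]

theorem conj_cd (σ u : ℂ) : star (cd (star σ) (star u)) = cd σ u := by
  have := conj_sincD (σ ^ 2 * u)
  simp only [cd, star_mul', star_star, star_pow] at this ⊢
  rw [this]

/-- The derivative in u is needed because the angular speed varies over phase space. The denominator
2 cancels against the derivative 2 j · δ of j · j. -/
theorem hasDerivAt_cs_right (σ u : ℂ) :
    HasDerivAt (cs σ) ((cd σ u - σ * cc σ u) / 2) u := by
  have h := ((hasDerivAt_sincS (σ ^ 2 * u)).comp u
    ((hasDerivAt_id u).const_mul (σ ^ 2))).const_mul σ
  refine h.congr_deriv ?_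
  unfold cd cc
  ring

theorem hasDerivAt_cc_right (σ u : ℂ) :
    HasDerivAt (cc σ) ((cd σ u * cs σ u - cc σ u ^ 2) / 2) u := by
  have h := ((hasDerivAt_sincC (σ ^ 2 * u)).comp u
    ((hasDerivAt_id u).const_mul (σ ^ 2))).const_mul (σ ^ 2)
  refine h.congr_deriv ?_
  unfold cd cc cs
  ring

theorem hasDerivAt_cs_left (σ u : ℂ) :
    HasDerivAt (fun σ => cs σ u) (1 - u * cc σ u) σ := by
  have h0 : HasDerivAt (fun σ : ℂ => σ ^ 2 * u) (2 * σ * u) σ := by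
    simpa using (hasDerivAt_pow 2 σ).mul_const u
  have h := (hasDerivAt_id σ).mul ((hasDerivAt_sincS (σ ^ 2 * u)).comp σ h0)
  refine h.congr_deriv ?_
  unfold cc
  simp only [Function.comp_apply, id_eq]
  linear_combination mul_sincD (σ ^ 2 * u)

theorem hasDerivAt_cc_left (σ u : ℂ) :
    HasDerivAt (fun σ => cc σ u) (cs σ u) σ := by
  have h0 : HasDerivAt (fun σ : ℂ => σ ^ 2 * u) (2 * σ * u) σ := by
    simpa using (hasDerivAt_pow 2 σ).mul_const u
  have h := (hasDerivAt_pow 2 σ).mul ((hasDerivAt_sincC (σ ^ 2 * u)).comp σ h0)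
  refine h.congr_deriv ?_
  unfold cs
  simp only [Function.comp_apply, Nat.cast_ofNat, Nat.add_one_sub_one, pow_one]
  linear_combination σ * sincS (σ ^ 2 * u) * mul_sincD (σ ^ 2 * u) - σ * sincS_sq_add (σ ^ 2 * u)

theorem cs_I_sq (L : ℝ) : (L : ℂ) * cs Complex.I ((L ^ 2 : ℝ) : ℂ) = Complex.I * Real.sinh L := by
  have h := mul_sincS_sq (L * Complex.I)
  rw [Complex.sin_mul_I] at h
  have e : (L * Complex.I : ℂ) ^ 2 = Complex.I ^ 2 * ((L ^ 2 : ℝ) : ℂ) := by push_cast; ring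
  rw [e] at h
  unfold cs
  rw [Complex.ofReal_sinh]
  linear_combination h

theorem cc_I_sq (L : ℝ) :
    (L : ℂ) ^ 2 * cc Complex.I ((L ^ 2 : ℝ) : ℂ) = 1 - Real.cosh L := by
  have h := sq_mul_sincC_sq (L * Complex.I)
  rw [Complex.cos_mul_I] at h
  have e : (L * Complex.I : ℂ) ^ 2 = Complex.I ^ 2 * ((L ^ 2 : ℝ) : ℂ) := by push_cast; ring
  unfold cc
  rw [Complex.ofReal_cosh, ← e]
  linear_combination h

/-! ### Values at time i: hyperbolic coefficients and their inequalities -/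

/-- `sinh √u / √u`. -/
def hs (u : ℝ) : ℝ := (sincS (-(u : ℂ))).re

/-- `(cosh √u - 1) / u`. -/
def hc (u : ℝ) : ℝ := (sincC (-(u : ℂ))).re

/-- `(sinh √u / √u - 1) / u`. -/
def hd (u : ℝ) : ℝ := (sincD (-(u : ℂ))).re

theorem ofReal_hs (u : ℝ) : (hs u : ℂ) = sincS (-(u : ℂ)) := by
  have := conj_sincS (-(u : ℂ))
  simp only [Complex.star_def, map_neg, Complex.conj_ofReal] at this
  exact (Complex.conj_eq_iff_re.1 this)

theorem ofReal_hc (u : ℝ) : (hc u : ℂ) = sincC (-(u : ℂ)) := by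
  have := conj_sincC (-(u : ℂ))
  simp only [Complex.star_def, map_neg, Complex.conj_ofReal] at this
  exact (Complex.conj_eq_iff_re.1 this)

theorem ofReal_hd (u : ℝ) : (hd u : ℂ) = sincD (-(u : ℂ)) := by
  have := conj_sincD (-(u : ℂ))
  simp only [Complex.star_def, map_neg, Complex.conj_ofReal] at this
  exact (Complex.conj_eq_iff_re.1 this)

theorem cs_I (u : ℝ) : cs Complex.I u = Complex.I * hs u := by simp [cs, ofReal_hs]
theorem cc_I (u : ℝ) : cc Complex.I u = -hc u := by simp [cc, ofReal_hc]
theorem cd_I (u : ℝ) : cd Complex.I u = -(Complex.I * hd u) := by simp [cd, ofReal_hd]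

theorem mul_hs_sq (L : ℝ) : L * hs (L ^ 2) = Real.sinh L := by
  have h := cs_I_sq L
  rw [cs_I, mul_left_comm] at h
  exact_mod_cast mul_left_cancel₀ Complex.I_ne_zero h

theorem sq_mul_hc_sq (L : ℝ) : L ^ 2 * hc (L ^ 2) = Real.cosh L - 1 := by
  have h := cc_I_sq L
  rw [cc_I] at h
  have h2 : ((L ^ 2 * hc (L ^ 2) : ℝ) : ℂ) = ((Real.cosh L - 1 : ℝ) : ℂ) := by
    rw [Complex.ofReal_mul, Complex.ofReal_pow, Complex.ofReal_sub, Complex.ofReal_one]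
    linear_combination -h
  exact_mod_cast h2

theorem mul_hd (u : ℝ) : u * hd u = hs u - 1 := by
  have h := mul_sincD (-(u : ℂ))
  rw [← ofReal_hd, ← ofReal_hs] at h
  have h2 : ((u * hd u : ℝ) : ℂ) = ((hs u - 1 : ℝ) : ℂ) := by
    push_cast; linear_combination -h
  exact_mod_cast h2

theorem hs_sq (u : ℝ) : hs u ^ 2 = 2 * hc u + u * hc u ^ 2 := by
  have h := sincS_sq_add (-(u : ℂ))
  rw [← ofReal_hc, ← ofReal_hs] at h
  have h2 : ((hs u ^ 2 : ℝ) : ℂ) = ((2 * hc u + u * hc u ^ 2 : ℝ) : ℂ) := by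
    push_cast; linear_combination h
  exact_mod_cast h2

theorem hs_zero : hs 0 = 1 := by simp [hs, sincS_zero]

theorem contDiff_re_comp_neg {f : ℂ → ℂ} (hf : Differentiable ℂ f) :
    ContDiff ℝ ∞ (fun u : ℝ => (f (-(u : ℂ))).re) := by
  have h1 : ContDiff ℝ ∞ f := (hf.contDiff (n := ∞)).restrict_scalars ℝ
  exact Complex.reCLM.contDiff.comp (h1.comp (Complex.ofRealCLM.contDiff.neg))

theorem contDiff_hs : ContDiff ℝ ∞ hs := contDiff_re_comp_neg differentiable_sincS
theorem contDiff_hc : ContDiff ℝ ∞ hc := contDiff_re_comp_neg differentiable_sincC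

theorem hasDerivAt_hs (u : ℝ) : HasDerivAt hs ((hc u - hd u) / 2) u := by
  have h := (((hasDerivAt_sincS (-(u : ℂ))).comp (u : ℂ) (hasDerivAt_neg (u : ℂ)))).real_of_complex
  refine h.congr_deriv ?_
  rw [← ofReal_hc, ← ofReal_hd]
  have : ((hd u - hc u) / 2 * -1 : ℂ) = (((hc u - hd u) / 2 : ℝ) : ℂ) := by push_cast; ring
  rw [this, Complex.ofReal_re]

theorem one_le_hs {u : ℝ} (hu : 0 ≤ u) : 1 ≤ hs u := by
  obtain ⟨L, hL, rfl⟩ : ∃ L : ℝ, 0 ≤ L ∧ L ^ 2 = u := ⟨√u, Real.sqrt_nonneg _, Real.sq_sqrt hu⟩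
  rcases hL.eq_or_lt with rfl | hL
  · simp [hs_zero]
  · have h := mul_hs_sq L
    have h2 := (Real.self_le_sinh_iff (x := L)).2 hL.le
    rw [← h] at h2
    exact le_of_mul_le_mul_left (by linarith) hL

theorem hc_pos {u : ℝ} (hu : 0 ≤ u) : 0 < hc u := by
  obtain ⟨L, hL, rfl⟩ : ∃ L : ℝ, 0 ≤ L ∧ L ^ 2 = u := ⟨√u, Real.sqrt_nonneg _, Real.sq_sqrt hu⟩
  rcases hL.eq_or_lt with rfl | hL
  · have := hs_sq 0
    rw [hs_zero] at this
    norm_num at this ⊢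
    linarith
  · have h := sq_mul_hc_sq L
    have h2 := Real.one_lt_cosh.2 hL.ne'
    have h3 : 0 < L ^ 2 * hc (L ^ 2) := by linarith
    exact pos_of_mul_pos_right h3 (by positivity)

/-- For u = L², the difference times L³ is L cosh L - sinh L, which vanishes at 0 and has derivative
L sinh L ≥ 0. By `hasDerivAt_hs` this says that `hs` is nondecreasing, which makes `imSq` strictly
monotone. -/
theorem hd_le_hc {u : ℝ} (hu : 0 < u) : hd u ≤ hc u := by
  obtain ⟨L, hL, rfl⟩ : ∃ L : ℝ, 0 < L ∧ L ^ 2 = u := ⟨√u, Real.sqrt_pos.2 hu, Real.sq_sqrt hu.le⟩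
  have h1 := mul_hd (L ^ 2)
  have h2 := sq_mul_hc_sq L
  have h3 := mul_hs_sq L
  have hmono : MonotoneOn (fun x : ℝ => x * Real.cosh x - Real.sinh x) (Set.Ici 0) := by
    apply monotoneOn_of_deriv_nonneg (convex_Ici 0) (by fun_prop) (by fun_prop)
    intro x hx
    have hx' : 0 < x := by simpa using hx
    have hder : HasDerivAt (fun x : ℝ => x * Real.cosh x - Real.sinh x)
        (1 * Real.cosh x + x * Real.sinh x - Real.cosh x) x :=
      ((hasDerivAt_id x).mul (Real.hasDerivAt_cosh x)).sub (Real.hasDerivAt_sinh x)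
    rw [hder.deriv]
    have := Real.sinh_pos_iff.2 hx'
    have := mul_pos hx' this
    linarith
  have h4 := hmono (by simp) (Set.mem_Ici.2 hL.le) hL.le
  simp only [zero_mul, Real.sinh_zero, sub_zero] at h4
  have h5 : 0 ≤ L ^ 3 * (hc (L ^ 2) - hd (L ^ 2)) := by
    have : L ^ 3 * (hc (L ^ 2) - hd (L ^ 2)) = L * Real.cosh L - Real.sinh L := by
      linear_combination L * h2 - L * h1 - h3
    linarith
  have := nonneg_of_mul_nonneg_right h5 (by positivity)
  linarith

/-! ### Rotations, their integrals and their variation over a field -/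

section VectorAlgebra

variable {K : Type*} [Field K]

theorem cross_zero (a b : Fin 3 → K) : (a ⨯₃ b) 0 = a 1 * b 2 - a 2 * b 1 := by simp [cross_apply]
theorem cross_one (a b : Fin 3 → K) : (a ⨯₃ b) 1 = a 2 * b 0 - a 0 * b 2 := by simp [cross_apply]
theorem cross_two (a b : Fin 3 → K) : (a ⨯₃ b) 2 = a 0 * b 1 - a 1 * b 0 := by simp [cross_apply]

theorem ext_fin_three {α : Type*} {v w : Fin 3 → α} (h0 : v 0 = w 0) (h1 : v 1 = w 1)
    (h2 : v 2 = w 2) : v = w := by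
  ext i; fin_cases i <;> assumption

/-- `1 + s j× + c (j×)²`: for suitable `s`, `c` the rotation `exp (σ j×)`. -/
def rot (s c : K) (j : Fin 3 → K) : (Fin 3 → K) →ₗ[K] (Fin 3 → K) :=
  LinearMap.id + s • crossProduct j + c • (crossProduct j ∘ₗ crossProduct j)

/-- `s + c j× + d j jᵀ`: for suitable `s`, `c`, `d` the integral of `exp (σ j×)`. -/
def nrot (s c d : K) (j : Fin 3 → K) : (Fin 3 → K) →ₗ[K] (Fin 3 → K) :=
  s • LinearMap.id + c • crossProduct j + d • (dotProductBilin K K j).smulRight j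

theorem rot_apply (s c : K) (j v : Fin 3 → K) :
    rot s c j v = v + s • (j ⨯₃ v) + c • (j ⨯₃ (j ⨯₃ v)) := rfl

theorem nrot_apply (s c d : K) (j v : Fin 3 → K) :
    nrot s c d j v = s • v + c • (j ⨯₃ v) + (d * (j ⬝ᵥ v)) • j := by
  simp [nrot, smul_smul]

theorem dot_rot {s c : K} {j : Fin 3 → K} (h : s ^ 2 + (j ⬝ᵥ j) * c ^ 2 = 2 * c)
    (v w : Fin 3 → K) : rot s c j v ⬝ᵥ rot s c j w = v ⬝ᵥ w := by
  simp only [rot_apply, cross_zero, cross_one, cross_two, Matrix.vec3_dotProduct, Pi.add_apply,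
    Pi.smul_apply, smul_eq_mul] at *
  linear_combination ((j 1 * v 2 - j 2 * v 1) * (j 1 * w 2 - j 2 * w 1) +
    (j 2 * v 0 - j 0 * v 2) * (j 2 * w 0 - j 0 * w 2) +
    (j 0 * v 1 - j 1 * v 0) * (j 0 * w 1 - j 1 * w 0)) * h

theorem dot_rot_right (s c : K) (j v w : Fin 3 → K) :
    v ⬝ᵥ rot s c j w = rot (-s) c j v ⬝ᵥ w := by
  simp only [rot_apply, cross_zero, cross_one, cross_two, Matrix.vec3_dotProduct, Pi.add_apply,
    Pi.smul_apply, smul_eq_mul] at *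
  ring

/-- The two sides differ by a multiple of (j · (v × w)) j, whose coefficient is the Rodrigues
relation. -/
theorem rot_cross {s c : K} {j : Fin 3 → K} (h : s ^ 2 + (j ⬝ᵥ j) * c ^ 2 = 2 * c)
    (v w : Fin 3 → K) : rot s c j (v ⨯₃ w) = rot s c j v ⨯₃ rot s c j w := by
  simp only [Matrix.vec3_dotProduct] at h
  apply ext_fin_three <;>
  simp only [rot_apply, cross_zero, cross_one, cross_two, Pi.add_apply, Pi.smul_apply, smul_eq_mul]
  · linear_combination (-(j 0 * (v 1 * w 2 - v 2 * w 1) + j 1 * (v 2 * w 0 - v 0 * w 2) +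
      j 2 * (v 0 * w 1 - v 1 * w 0)) * j 0) * h
  · linear_combination (-(j 0 * (v 1 * w 2 - v 2 * w 1) + j 1 * (v 2 * w 0 - v 0 * w 2) +
      j 2 * (v 0 * w 1 - v 1 * w 0)) * j 1) * h
  · linear_combination (-(j 0 * (v 1 * w 2 - v 2 * w 1) + j 1 * (v 2 * w 0 - v 0 * w 2) +
      j 2 * (v 0 * w 1 - v 1 * w 0)) * j 2) * h

theorem rot_neg_rot {s c : K} {j : Fin 3 → K} (h : s ^ 2 + (j ⬝ᵥ j) * c ^ 2 = 2 * c)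
    (v : Fin 3 → K) : rot (-s) c j (rot s c j v) = v := by
  simp only [Matrix.vec3_dotProduct] at h
  apply ext_fin_three <;>
  simp only [rot_apply, cross_zero, cross_one, cross_two, Pi.add_apply, Pi.smul_apply, smul_eq_mul]
  · linear_combination (-(j 1 * (j 0 * v 1 - j 1 * v 0) - j 2 * (j 2 * v 0 - j 0 * v 2))) * h
  · linear_combination (-(j 2 * (j 1 * v 2 - j 2 * v 1) - j 0 * (j 0 * v 1 - j 1 * v 0))) * h
  · linear_combination (-(j 0 * (j 2 * v 0 - j 0 * v 2) - j 1 * (j 1 * v 2 - j 2 * v 1))) * h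

theorem rot_rot_neg {s c : K} {j : Fin 3 → K} (h : s ^ 2 + (j ⬝ᵥ j) * c ^ 2 = 2 * c)
    (v : Fin 3 → K) : rot s c j (rot (-s) c j v) = v := by
  have := rot_neg_rot (s := -s) (c := c) (j := j) (by rw [neg_sq, h]) v
  rwa [neg_neg] at this

theorem rot_axis (s c : K) (j : Fin 3 → K) : rot s c j j = j := by
  simp [rot_apply]

/-- In terms of the flow, N(σ) exp(-σ j×) is the integral of exp(τ j×) from -σ to 0, that is -N(-σ);
reversing time turns s, c, d into -s, c, -d. -/
theorem nrot_rot_neg {s c : K} {j : Fin 3 → K} (h : s ^ 2 + (j ⬝ᵥ j) * c ^ 2 = 2 * c) (d : K)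
    (v : Fin 3 → K) : nrot s c d j (rot (-s) c j v) = nrot s (-c) d j v := by
  simp only [Matrix.vec3_dotProduct] at h
  apply ext_fin_three <;>
  simp only [rot_apply, nrot_apply, cross_zero, cross_one, cross_two, Pi.add_apply, Pi.smul_apply,
    smul_eq_mul, Matrix.vec3_dotProduct]
  · linear_combination (-(j 1 * v 2 - j 2 * v 1)) * h
  · linear_combination (-(j 2 * v 0 - j 0 * v 2)) * h
  · linear_combination (-(j 0 * v 1 - j 1 * v 0)) * h

/-- The integrated form of d/dσ exp(σ j×) = j× exp(σ j×). -/
theorem cross_nrot (s c d : K) (j v : Fin 3 → K) :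
    j ⨯₃ nrot s c d j v = rot s c j v - v := by
  simp only [rot_apply, nrot_apply, map_add, map_smul, cross_self, smul_zero, add_zero]
  abel

theorem nrot_cross (s c d : K) (j v : Fin 3 → K) :
    nrot s c d j (j ⨯₃ v) = rot s c j v - v := by
  simp only [rot_apply, nrot_apply, dot_self_cross, mul_zero, zero_smul, add_zero]
  abel

/-- The derivative of `rot s c j` in the direction `(2 (j · δ) ∂ᵤ, δ)`. -/
theorem rot_variation {s c d σ : K} {j : Fin 3 → K} (h : s ^ 2 + (j ⬝ᵥ j) * c ^ 2 = 2 * c)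
    (hd : (j ⬝ᵥ j) * d = σ - s) (δ v : Fin 3 → K) :
    ((d - σ * c) * (j ⬝ᵥ δ)) • (j ⨯₃ v) + s • (δ ⨯₃ v) +
      (((d * s - c ^ 2) * (j ⬝ᵥ δ)) • (j ⨯₃ (j ⨯₃ v)) +
        c • (δ ⨯₃ (j ⨯₃ v) + j ⨯₃ (δ ⨯₃ v))) = nrot s c d j δ ⨯₃ rot s c j v := by
  simp only [Matrix.vec3_dotProduct] at h hd
  apply ext_fin_three <;>
  simp only [rot_apply, nrot_apply, cross_zero, cross_one, cross_two, Pi.add_apply, Pi.smul_apply,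
    smul_eq_mul, Matrix.vec3_dotProduct]
  · linear_combination ((j 0 * δ 0 + j 1 * δ 1 + j 2 * δ 2) * v 0 -
      (δ 0 * v 0 + δ 1 * v 1 + δ 2 * v 2) * j 0) * h +
      c * (j 0 * δ 0 + j 1 * δ 1 + j 2 * δ 2) * (j 1 * v 2 - j 2 * v 1) * hd
  · linear_combination ((j 0 * δ 0 + j 1 * δ 1 + j 2 * δ 2) * v 1 -
      (δ 0 * v 0 + δ 1 * v 1 + δ 2 * v 2) * j 1) * h +
      c * (j 0 * δ 0 + j 1 * δ 1 + j 2 * δ 2) * (j 2 * v 0 - j 0 * v 2) * hd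
  · linear_combination ((j 0 * δ 0 + j 1 * δ 1 + j 2 * δ 2) * v 2 -
      (δ 0 * v 0 + δ 1 * v 1 + δ 2 * v 2) * j 2) * h +
      c * (j 0 * δ 0 + j 1 * δ 1 + j 2 * δ 2) * (j 0 * v 1 - j 1 * v 0) * hd

end VectorAlgebra

/-! ### Angular velocity, tangent vectors and the continued vertical spaces -/

section SphereAlgebra

variable {K : Type*} [Field K]

/-- The moment map divided by `r ^ 2`: the angular velocity of the magnetic flow. -/
def angVel (r B : K) (x p : Fin 3 → K) : Fin 3 → K := (r ^ 2)⁻¹ • (x ⨯₃ p - (r * B) • x)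

/-- The derivative of `angVel` at `(x, p)` in the direction `v`. -/
def angVelDeriv (r B : K) (x p : Fin 3 → K) (v : (Fin 3 → K) × (Fin 3 → K)) : Fin 3 → K :=
  (r ^ 2)⁻¹ • (v.1 ⨯₃ p + x ⨯₃ v.2 - (r * B) • v.1)

variable {r B : K} {x p : Fin 3 → K}

/-- Expanding the double cross product of w with y gives (y · y) w = (w · y) y. Over ℂ the
assumption y · y ≠ 0 is stronger than y ≠ 0, since isotropic vectors exist. -/
theorem eq_smul_of_cross_eq_zero {w y : Fin 3 → K} (hy : y ⬝ᵥ y ≠ 0) (h : w ⨯₃ y = 0) :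
    w = ((w ⬝ᵥ y) / (y ⬝ᵥ y)) • y := by
  have h0 := congrFun h 0
  have h1 := congrFun h 1
  have h2 := congrFun h 2
  simp only [cross_zero, cross_one, cross_two, Pi.zero_apply] at h0 h1 h2
  have key : (y ⬝ᵥ y) • w = (w ⬝ᵥ y) • y := by
    apply ext_fin_three <;>
    simp only [Pi.smul_apply, smul_eq_mul, Matrix.vec3_dotProduct]
    · linear_combination y 2 * -h1 + y 1 * h2
    · linear_combination y 2 * h0 - y 0 * h2
    · linear_combination y 0 * h1 - y 1 * h0
  rw [div_eq_inv_mul, mul_smul, ← key, smul_smul, inv_mul_cancel₀ hy, one_smul]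

theorem eq_zero_of_cross_eq_zero {w y : Fin 3 → K} (hy : y ⬝ᵥ y ≠ 0) (h : w ⨯₃ y = 0)
    (h' : w ⬝ᵥ y = 0) : w = 0 := by
  rw [eq_smul_of_cross_eq_zero hy h, h', zero_div, zero_smul]

/-- (x × p) × x = (x · x) p - (x · p) x, and the magnetic term of j is parallel to x. -/
theorem angVel_cross (hr : r ≠ 0) (hx : x ⬝ᵥ x = r ^ 2) (hxp : x ⬝ᵥ p = 0) :
    angVel r B x p ⨯₃ x = p := by
  simp only [Matrix.vec3_dotProduct] at hx hxp
  have : r ^ 2 • (angVel r B x p ⨯₃ x) = r ^ 2 • p := by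
    unfold angVel
    rw [map_smul, LinearMap.smul_apply, smul_inv_smul₀ (pow_ne_zero 2 hr)]
    apply ext_fin_three <;>
    simp only [Pi.smul_apply, Pi.sub_apply, smul_eq_mul, cross_zero, cross_one, cross_two]
    · linear_combination p 0 * hx - x 0 * hxp
    · linear_combination p 1 * hx - x 1 * hxp
    · linear_combination p 2 * hx - x 2 * hxp
  exact smul_right_injective _ (pow_ne_zero 2 hr) this

theorem angVel_dot (hr : r ≠ 0) (hx : x ⬝ᵥ x = r ^ 2) : angVel r B x p ⬝ᵥ x = -(r * B) := by
  unfold angVel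
  rw [smul_dotProduct, sub_dotProduct, smul_dotProduct, hx, dotProduct_comm, dot_self_cross]
  simp only [smul_eq_mul]
  field_simp
  ring

theorem angVel_dot_self (hr : r ≠ 0) (hx : x ⬝ᵥ x = r ^ 2) (hxp : x ⬝ᵥ p = 0) :
    angVel r B x p ⬝ᵥ angVel r B x p = (p ⬝ᵥ p + r ^ 2 * B ^ 2) / r ^ 2 := by
  unfold angVel
  simp only [Matrix.vec3_dotProduct, Pi.smul_apply, Pi.sub_apply, smul_eq_mul, cross_zero,
    cross_one, cross_two] at *
  field_simp
  linear_combination (p 0 * p 0 + p 1 * p 1 + p 2 * p 2 + r ^ 2 * B ^ 2) * hx -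
    (x 0 * p 0 + x 1 * p 1 + x 2 * p 2) * hxp

/-- This is the equation of motion for p: a magnetic force perpendicular to p and the centripetal
force that keeps x on the sphere. -/
theorem angVel_cross_momentum (hr : r ≠ 0) (hxp : x ⬝ᵥ p = 0) :
    angVel r B x p ⨯₃ p = -(B / r) • (x ⨯₃ p) - ((p ⬝ᵥ p) / r ^ 2) • x := by
  simp only [Matrix.vec3_dotProduct] at hxp
  have : r ^ 2 • (angVel r B x p ⨯₃ p) =
      r ^ 2 • (-(B / r) • (x ⨯₃ p) - ((p ⬝ᵥ p) / r ^ 2) • x) := by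
    unfold angVel
    rw [map_smul, LinearMap.smul_apply, smul_inv_smul₀ (pow_ne_zero 2 hr), smul_sub, smul_smul,
      smul_smul, mul_div_cancel₀ _ (pow_ne_zero 2 hr),
      show r ^ 2 * -(B / r) = -(r * B) by field_simp]
    apply ext_fin_three <;>
    simp only [Pi.smul_apply, Pi.sub_apply, smul_eq_mul, cross_zero, cross_one, cross_two,
      Matrix.vec3_dotProduct]
    · linear_combination p 0 * hxp
    · linear_combination p 1 * hxp
    · linear_combination p 2 * hxp
  exact smul_right_injective _ (pow_ne_zero 2 hr) this

theorem angVel_rot {s c : K} {j : Fin 3 → K} (h : s ^ 2 + (j ⬝ᵥ j) * c ^ 2 = 2 * c) :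
    angVel r B (rot s c j x) (rot s c j p) = rot s c j (angVel r B x p) := by
  simp only [angVel, map_smul, map_sub, rot_cross h]

/-- The infinitesimal rotation ξ moves j by equivariance, while the vertical part b × x changes x ×
p by x × (b × x) = r² b. -/
theorem angVelDeriv_tangent (ξ b : Fin 3 → K) (hr : r ≠ 0) (hx : x ⬝ᵥ x = r ^ 2)
    (hb : b ⬝ᵥ x = 0) :
    angVelDeriv r B x p (ξ ⨯₃ x, b ⨯₃ x + ξ ⨯₃ p) = ξ ⨯₃ angVel r B x p + b := by
  have : r ^ 2 • angVelDeriv r B x p (ξ ⨯₃ x, b ⨯₃ x + ξ ⨯₃ p) =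
      r ^ 2 • (ξ ⨯₃ angVel r B x p + b) := by
    unfold angVelDeriv angVel
    rw [map_smul, smul_add, smul_inv_smul₀ (pow_ne_zero 2 hr),
      smul_inv_smul₀ (pow_ne_zero 2 hr)]
    simp only [Matrix.vec3_dotProduct] at hx hb
    apply ext_fin_three <;>
    simp only [Pi.smul_apply, Pi.sub_apply, Pi.add_apply, smul_eq_mul, cross_zero, cross_one,
      cross_two]
    · linear_combination b 0 * hx - x 0 * hb
    · linear_combination b 1 * hx - x 1 * hb
    · linear_combination b 2 * hx - x 2 * hb
  exact smul_right_injective _ (pow_ne_zero 2 hr) this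

/-- An infinitesimal rotation ξ accounts for the velocity of x; what remains is a fibre vector
orthogonal to x, hence of the form b × x. The pair is not unique: (ξ + l x, b + l p) gives the same
vector. -/
theorem tangent_param (hr : r ≠ 0) (hx : x ⬝ᵥ x = r ^ 2) {v : (Fin 3 → K) × (Fin 3 → K)}
    (h1 : x ⬝ᵥ v.1 = 0) (h2 : v.1 ⬝ᵥ p + x ⬝ᵥ v.2 = 0) :
    ∃ ξ b : Fin 3 → K, b ⬝ᵥ x = 0 ∧ v = (ξ ⨯₃ x, b ⨯₃ x + ξ ⨯₃ p) := by
  have hr2 : r ^ 2 ≠ 0 := pow_ne_zero 2 hr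
  have aux : ∀ w : Fin 3 → K, x ⬝ᵥ w = 0 → ((r ^ 2)⁻¹ • (x ⨯₃ w)) ⨯₃ x = w := by
    intro w hw
    apply smul_right_injective _ hr2
    change r ^ 2 • (((r ^ 2)⁻¹ • (x ⨯₃ w)) ⨯₃ x) = r ^ 2 • w
    rw [map_smul, LinearMap.smul_apply, smul_inv_smul₀ hr2]
    simp only [Matrix.vec3_dotProduct] at hx hw
    apply ext_fin_three <;>
    simp only [Pi.smul_apply, smul_eq_mul, cross_zero, cross_one, cross_two]
    · linear_combination w 0 * hx - x 0 * hw
    · linear_combination w 1 * hx - x 1 * hw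
    · linear_combination w 2 * hx - x 2 * hw
  set ξ := (r ^ 2)⁻¹ • (x ⨯₃ v.1) with hξ
  have e1 : ξ ⨯₃ x = v.1 := aux _ h1
  have h3 : x ⬝ᵥ (v.2 - ξ ⨯₃ p) = 0 := by
    rw [← h2, dotProduct_sub, ← e1]
    simp only [Matrix.vec3_dotProduct, cross_zero, cross_one, cross_two]
    ring
  refine ⟨ξ, (r ^ 2)⁻¹ • (x ⨯₃ (v.2 - ξ ⨯₃ p)), ?_, ?_⟩
  · rw [smul_dotProduct, dotProduct_comm, dot_self_cross, smul_zero]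
  · rw [aux _ h3, e1, sub_add_cancel]

theorem tangent_of_param (ξ b x p : Fin 3 → K) :
    x ⬝ᵥ (ξ ⨯₃ x) = 0 ∧ (ξ ⨯₃ x) ⬝ᵥ p + x ⬝ᵥ (b ⨯₃ x + ξ ⨯₃ p) = 0 := by
  constructor <;>
  simp only [Matrix.vec3_dotProduct, cross_zero, cross_one, cross_two, Pi.add_apply] <;> ring

/-- In these coordinates the magnetic field enters only through j: its contribution on the left is r
B (ξ × ξ') · x, the part of r² (ξ × ξ') · j that contains B. -/
theorem form_param (hr : r ≠ 0) (hx : x ⬝ᵥ x = r ^ 2)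
    {ξ b ξ' b' : Fin 3 → K} (hb : b ⬝ᵥ x = 0) (hb' : b' ⬝ᵥ x = 0) :
    (ξ ⨯₃ x) ⬝ᵥ (b' ⨯₃ x + ξ' ⨯₃ p) - (ξ' ⨯₃ x) ⬝ᵥ (b ⨯₃ x + ξ ⨯₃ p) -
      B / r * (x ⬝ᵥ ((ξ ⨯₃ x) ⨯₃ (ξ' ⨯₃ x))) =
    r ^ 2 * ((ξ ⨯₃ ξ') ⬝ᵥ angVel r B x p + ξ ⬝ᵥ b' - ξ' ⬝ᵥ b) := by
  have e1 : r ^ 2 * ((ξ ⨯₃ ξ') ⬝ᵥ angVel r B x p) =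
      (ξ ⨯₃ ξ') ⬝ᵥ (x ⨯₃ p) - r * B * ((ξ ⨯₃ ξ') ⬝ᵥ x) := by
    unfold angVel
    rw [dotProduct_smul, smul_eq_mul, mul_inv_cancel_left₀ (pow_ne_zero 2 hr), dotProduct_sub,
      dotProduct_smul, smul_eq_mul]
  have e2 : x ⬝ᵥ ((ξ ⨯₃ x) ⨯₃ (ξ' ⨯₃ x)) = r ^ 2 * ((ξ ⨯₃ ξ') ⬝ᵥ x) := by
    rw [← hx]
    simp only [Matrix.vec3_dotProduct, cross_zero, cross_one, cross_two]
    ring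
  have e3 : B / r * (r ^ 2 * ((ξ ⨯₃ ξ') ⬝ᵥ x)) = r * B * ((ξ ⨯₃ ξ') ⬝ᵥ x) := by
    field_simp
  rw [e2, e3, mul_sub, mul_add, e1]
  simp only [Matrix.vec3_dotProduct, cross_zero, cross_one, cross_two, Pi.add_apply] at *
  linear_combination (ξ 0 * b' 0 + ξ 1 * b' 1 + ξ 2 * b' 2 -
    (ξ' 0 * b 0 + ξ' 1 * b 1 + ξ' 2 * b 2)) * hx -
    (ξ 0 * x 0 + ξ 1 * x 1 + ξ 2 * x 2) * hb' + (ξ' 0 * x 0 + ξ' 1 * x 1 + ξ' 2 * x 2) * hb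

/-- The frame map: `b ↦ (M b × x, b × x + M b × p)` with `M = nrot s (-c) d j`, which
parametrises the continued vertical spaces by the orthogonal complement of `x`. -/
def frame (s c d : K) (j x p : Fin 3 → K) : (Fin 3 → K) →ₗ[K] (Fin 3 → K) × (Fin 3 → K) :=
  LinearMap.prod (-(crossProduct x) ∘ₗ nrot s (-c) d j)
    (-(crossProduct x) - crossProduct p ∘ₗ nrot s (-c) d j)

theorem frame_apply (s c d : K) (j x p b : Fin 3 → K) :
    frame s c d j x p b = (nrot s (-c) d j b ⨯₃ x, b ⨯₃ x + nrot s (-c) d j b ⨯₃ p) := by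
  change (-(x ⨯₃ nrot s (-c) d j b), -(x ⨯₃ b) - p ⨯₃ nrot s (-c) d j b) = _
  rw [cross_anticomm, cross_anticomm, sub_eq_add_neg, cross_anticomm]

/-- With `form_param` this says that the image of `frame` is isotropic. The left side is the
Rodrigues relation times j · (b × b'). -/
theorem nrot_isotropic {s c : K} {j : Fin 3 → K} (h : s ^ 2 + (j ⬝ᵥ j) * c ^ 2 = 2 * c) (d : K)
    (b b' : Fin 3 → K) :
    (nrot s (-c) d j b ⨯₃ nrot s (-c) d j b') ⬝ᵥ j + nrot s (-c) d j b ⬝ᵥ b' -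
      nrot s (-c) d j b' ⬝ᵥ b = 0 := by
  simp only [nrot_apply, Matrix.vec3_dotProduct, cross_zero, cross_one, cross_two, Pi.add_apply,
    Pi.smul_apply, smul_eq_mul] at *
  linear_combination (j 0 * (b 1 * b' 2 - b 2 * b' 1) + j 1 * (b 2 * b' 0 - b 0 * b' 2) +
    j 2 * (b 0 * b' 1 - b 1 * b' 0)) * h

theorem nrot_neg_all (s c d : K) (j b : Fin 3 → K) :
    nrot (-s) c (-d) j b = -nrot s (-c) d j b := by
  simp only [nrot_apply, neg_smul, neg_mul]
  abel

theorem rot_neg_eq {j : Fin 3 → K} (s c d : K) (hj : j ⨯₃ x = p) :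
    rot (-s) c j x = x - nrot s (-c) d j p := by
  have := nrot_cross (-s) c (-d) j x
  rw [nrot_neg_all, hj] at this
  rw [sub_eq_add_neg, this]
  abel

/-- A tangent vector `(ξ × x, b × x + ξ × p)` annihilated by the differential of the continued
flow lies in the continued vertical space. -/
theorem mem_frame_of_cross {s c : K} {j : Fin 3 → K} (h : s ^ 2 + (j ⬝ᵥ j) * c ^ 2 = 2 * c)
    (d : K) (hr : r ≠ 0) (hx : x ⬝ᵥ x = r ^ 2) (hxp : x ⬝ᵥ p = 0) (hj : j ⨯₃ x = p)
    {ξ b : Fin 3 → K} (hb : b ⬝ᵥ x = 0)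
    (hz : (ξ - nrot s (-c) d j b) ⨯₃ rot (-s) c j x = 0) :
    ∃ b', b' ⬝ᵥ x = 0 ∧ frame s c d j x p b' = (ξ ⨯₃ x, b ⨯₃ x + ξ ⨯₃ p) := by
  have hG : rot (-s) c j x ⬝ᵥ rot (-s) c j x ≠ 0 := by
    rw [dot_rot (by rw [neg_sq, h]), hx]
    exact pow_ne_zero 2 hr
  have h1 := eq_smul_of_cross_eq_zero hG hz
  set l := (ξ - nrot s (-c) d j b) ⬝ᵥ rot (-s) c j x / (rot (-s) c j x ⬝ᵥ rot (-s) c j x)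
  clear_value l
  rw [rot_neg_eq s c d hj] at h1
  -- By `rot_neg_eq` the axis of proportionality is x - M p, so ξ - M b = l (x - M p). Replacing (ξ,
  -- b) by (ξ - l x, b - l p) leaves the tangent vector unchanged and puts it in the image of
  -- `frame`.
  have hξ : nrot s (-c) d j (b - l • p) = ξ - l • x := by
    rw [map_sub, map_smul]
    rw [eq_add_of_sub_eq h1]
    module
  refine ⟨b - l • p, ?_, ?_⟩
  · rw [sub_dotProduct, hb, smul_dotProduct, dotProduct_comm p, hxp, smul_zero, sub_zero]
  · rw [frame_apply, hξ]
    ext1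
    · simp [map_sub, LinearMap.sub_apply]
    · have := cross_anticomm x p
      simp only [map_sub, LinearMap.sub_apply, map_smul, LinearMap.smul_apply, ← this]
      module

/-- Tangent vectors orthogonal to the continued vertical space lie in it. -/
theorem mem_frame_of_orthogonal {s c : K} {j : Fin 3 → K}
    (h : s ^ 2 + (j ⬝ᵥ j) * c ^ 2 = 2 * c)
    (d : K) (hr : r ≠ 0) (hx : x ⬝ᵥ x = r ^ 2) (hxp : x ⬝ᵥ p = 0) (hj : j ⨯₃ x = p)
    {ξ b : Fin 3 → K} (hb : b ⬝ᵥ x = 0)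
    (hz : ∀ b', b' ⬝ᵥ x = 0 → (ξ ⨯₃ nrot s (-c) d j b') ⬝ᵥ j + ξ ⬝ᵥ b' -
      nrot s (-c) d j b' ⬝ᵥ b = 0) :
    ∃ b', b' ⬝ᵥ x = 0 ∧ frame s c d j x p b' = (ξ ⨯₃ x, b ⨯₃ x + ξ ⨯₃ p) := by
  have hneg : (-s) ^ 2 + (j ⬝ᵥ j) * c ^ 2 = 2 * c := by rw [neg_sq, h]
  apply mem_frame_of_cross h d hr hx hxp hj hb
  set η := ξ - nrot s (-c) d j b with hη
  -- Subtracting the isotropy identity for (b, b') from the hypothesis leaves a condition on η = ξ -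
  -- M b alone: η is orthogonal to the inverse rotation of b', so the rotated η is orthogonal to all
  -- of x^⊥.
  have h1 : ∀ b', b' ⬝ᵥ x = 0 → rot s c j η ⬝ᵥ b' = 0 := by
    intro b' hb'
    have e1 := hz b' hb'
    have e2 := nrot_isotropic h d b b'
    have e3 := cross_nrot (-s) c (-d) j b'
    rw [nrot_neg_all, map_neg] at e3
    have e4 : η ⬝ᵥ (j ⨯₃ nrot s (-c) d j b') = η ⬝ᵥ b' := by
      have t : ∀ a m : Fin 3 → K, a ⬝ᵥ (j ⨯₃ m) = -((a ⨯₃ m) ⬝ᵥ j) := by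
        intro a m
        simp only [Matrix.vec3_dotProduct, cross_zero, cross_one, cross_two]
        ring
      rw [t, hη, map_sub, LinearMap.sub_apply, sub_dotProduct, sub_dotProduct]
      linear_combination -e1 + e2
    have e5 : η ⬝ᵥ rot (-s) c j b' = 0 := by
      have : rot (-s) c j b' = b' - j ⨯₃ nrot s (-c) d j b' := by
        rw [sub_eq_add_neg, e3]; abel
      rw [this, dotProduct_sub, e4, sub_self]
    rwa [dot_rot_right, neg_neg] at e5
  have h2 : rot s c j η ⨯₃ x = 0 := by
    have t : ∀ k : Fin 3 → K, (rot s c j η ⨯₃ x) ⬝ᵥ k = 0 := by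
      intro k
      have := h1 (x ⨯₃ k) (by rw [dotProduct_comm, dot_self_cross])
      rw [← this]
      simp only [Matrix.vec3_dotProduct, cross_zero, cross_one, cross_two]
      ring
    exact dotProduct_eq_zero _ t
  -- Rotating back turns "rotated η parallel to x" into the hypothesis of `mem_frame_of_cross`.
  have h3 := congrArg (rot (-s) c j) h2
  rwa [rot_cross hneg, rot_neg_rot h, map_zero] at h3

/-- The first component gives M b = l x, the second then gives b = l p, so l (x - M p) = 0. But x -
M p is the rotated x, whose square r² is nonzero; hence l = 0 and b = 0. -/
theorem frame_injective {s c : K} {j : Fin 3 → K} (h : s ^ 2 + (j ⬝ᵥ j) * c ^ 2 = 2 * c)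
    (d : K) (hr : r ≠ 0) (hx : x ⬝ᵥ x = r ^ 2) (hxp : x ⬝ᵥ p = 0) (hj : j ⨯₃ x = p)
    {b : Fin 3 → K} (hb : b ⬝ᵥ x = 0) (h0 : frame s c d j x p b = 0) : b = 0 := by
  have hxx : x ⬝ᵥ x ≠ 0 := hx ▸ pow_ne_zero 2 hr
  rw [frame_apply] at h0
  have h1 : nrot s (-c) d j b ⨯₃ x = 0 := congrArg Prod.fst h0
  have h2 : b ⨯₃ x + nrot s (-c) d j b ⨯₃ p = 0 := congrArg Prod.snd h0
  have h3 := eq_smul_of_cross_eq_zero hxx h1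
  set l := nrot s (-c) d j b ⬝ᵥ x / (x ⬝ᵥ x)
  have h4 : b - l • p = 0 := by
    refine eq_zero_of_cross_eq_zero hxx ?_ ?_
    · rw [← h2, h3, map_sub, LinearMap.sub_apply, map_smul, map_smul, LinearMap.smul_apply,
        LinearMap.smul_apply, ← cross_anticomm x p, smul_neg, sub_neg_eq_add]
    · rw [sub_dotProduct, hb, smul_dotProduct, dotProduct_comm p, hxp, smul_zero, sub_zero]
  have h5 : l • rot (-s) c j x = 0 := by
    rw [rot_neg_eq s c d hj, smul_sub, ← map_smul, ← sub_eq_zero.1 h4, ← h3, sub_self]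
  rcases smul_eq_zero.1 h5 with hl | hl
  · rw [hl, zero_smul, sub_zero] at h4
    exact h4
  · have : rot (-s) c j x ⬝ᵥ rot (-s) c j x = r ^ 2 := by
      rw [dot_rot (by rw [neg_sq, h]), hx]
    rw [hl, zero_dotProduct] at this
    exact absurd this.symm (pow_ne_zero 2 hr)

/-- The differential of the first component of the continued flow on tangent vectors. -/
theorem flow_deriv_tangent {s c : K} {j : Fin 3 → K} (h : s ^ 2 + (j ⬝ᵥ j) * c ^ 2 = 2 * c)
    (d : K) (ξ b y : Fin 3 → K) :
    nrot s c d j (ξ ⨯₃ j + b) ⨯₃ rot s c j y + rot s c j (ξ ⨯₃ y) =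
      (ξ + nrot s c d j b) ⨯₃ rot s c j y := by
  -- N(ξ × j) = ξ - exp(σ j×) ξ, and its second term cancels against the rotated ξ × y.
  rw [map_add, ← cross_anticomm j ξ, map_neg, nrot_cross, rot_cross h]
  simp only [map_add, map_neg, map_sub, LinearMap.add_apply, LinearMap.neg_apply,
    LinearMap.sub_apply]
  abel

end SphereAlgebra

/-! ### Derivatives and smoothness of cross products and rotations -/

section VectorCalculus

variable {𝕜 K : Type*} [NontriviallyNormedField 𝕜] [NormedField K] [NormedAlgebra 𝕜 K]

theorem HasDerivAt.cross {f g : 𝕜 → Fin 3 → K} {f' g' : Fin 3 → K} {t : 𝕜}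
    (hf : HasDerivAt f f' t) (hg : HasDerivAt g g' t) :
    HasDerivAt (fun t => f t ⨯₃ g t) (f' ⨯₃ g t + f t ⨯₃ g') t := by
  rw [hasDerivAt_pi] at hf hg ⊢
  intro i
  fin_cases i
  · refine (((hf 1).mul (hg 2)).sub ((hf 2).mul (hg 1))).congr_deriv ?_ |>.congr_of_eventuallyEq
      (.of_forall fun s => cross_zero _ _)
    simp only [Fin.zero_eta, Pi.add_apply, cross_zero]; ring
  · refine (((hf 2).mul (hg 0)).sub ((hf 0).mul (hg 2))).congr_deriv ?_ |>.congr_of_eventuallyEq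
      (.of_forall fun s => cross_one _ _)
    simp only [Fin.mk_one, Pi.add_apply, cross_one]; ring
  · refine (((hf 0).mul (hg 1)).sub ((hf 1).mul (hg 0))).congr_deriv ?_ |>.congr_of_eventuallyEq
      (.of_forall fun s => cross_two _ _)
    simp only [Fin.reduceFinMk, Pi.add_apply, cross_two]; ring

theorem HasDerivAt.dot {f g : 𝕜 → Fin 3 → K} {f' g' : Fin 3 → K} {t : 𝕜}
    (hf : HasDerivAt f f' t) (hg : HasDerivAt g g' t) :
    HasDerivAt (fun t => f t ⬝ᵥ g t) (f' ⬝ᵥ g t + f t ⬝ᵥ g') t := by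
  rw [hasDerivAt_pi] at hf hg
  refine ((((hf 0).mul (hg 0)).add ((hf 1).mul (hg 1))).add
    ((hf 2).mul (hg 2))).congr_deriv ?_ |>.congr_of_eventuallyEq
      (.of_forall fun s => Matrix.vec3_dotProduct _ _)
  simp only [Matrix.vec3_dotProduct]; ring

theorem HasDerivAt.rot {s c : 𝕜 → K} {j y : 𝕜 → Fin 3 → K} {s' c' : K} {δ w : Fin 3 → K} {t : 𝕜}
    (hs : HasDerivAt s s' t) (hc : HasDerivAt c c' t) (hj : HasDerivAt j δ t)
    (hy : HasDerivAt y w t) :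
    HasDerivAt (fun t => rot (s t) (c t) (j t) (y t))
      (s' • (j t ⨯₃ y t) + s t • (δ ⨯₃ y t) + (c' • (j t ⨯₃ (j t ⨯₃ y t)) +
        c t • (δ ⨯₃ (j t ⨯₃ y t) + j t ⨯₃ (δ ⨯₃ y t))) + Magnetic.rot (s t) (c t) (j t) w) t := by
  have h1 := HasDerivAt.cross hj hy
  have h2 := HasDerivAt.cross hj h1
  refine ((hy.add (hs.smul h1)).add (hc.smul h2)).congr_deriv ?_
  simp only [rot_apply, map_add, smul_add]
  abel

theorem HasDerivAt.angVel {r B : K} {x p : 𝕜 → Fin 3 → K} {v : (Fin 3 → K) × (Fin 3 → K)} {t : 𝕜}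
    (hx : HasDerivAt x v.1 t) (hp : HasDerivAt p v.2 t) :
    HasDerivAt (fun t => angVel r B (x t) (p t)) (angVelDeriv r B (x t) (p t) v) t :=
  ((HasDerivAt.cross hx hp).sub (hx.const_smul (r * B))).const_smul (r ^ 2)⁻¹

variable {E : Type*} [NormedAddCommGroup E] [NormedSpace 𝕜 E] {n : WithTop ℕ∞}

theorem ContDiff.cross {f g : E → Fin 3 → K} (hf : ContDiff 𝕜 n f) (hg : ContDiff 𝕜 n g) :
    ContDiff 𝕜 n (fun t => f t ⨯₃ g t) := by
  rw [contDiff_pi] at *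
  intro i
  have h := fun i j => (hf i).mul (hg j)
  fin_cases i
  · change ContDiff 𝕜 n (fun t => (f t ⨯₃ g t) 0)
    simp only [cross_zero]
    exact (h 1 2).sub (h 2 1)
  · change ContDiff 𝕜 n (fun t => (f t ⨯₃ g t) 1)
    simp only [cross_one]
    exact (h 2 0).sub (h 0 2)
  · change ContDiff 𝕜 n (fun t => (f t ⨯₃ g t) 2)
    simp only [cross_two]
    exact (h 0 1).sub (h 1 0)

theorem ContDiff.dot {f g : E → Fin 3 → K} (hf : ContDiff 𝕜 n f) (hg : ContDiff 𝕜 n g) :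
    ContDiff 𝕜 n (fun t => f t ⬝ᵥ g t) := by
  rw [contDiff_pi] at *
  have h := fun i j => (hf i).mul (hg j)
  simp only [Matrix.vec3_dotProduct]
  exact ((h 0 0).add (h 1 1)).add (h 2 2)

theorem ContDiff.rot {s c : E → K} {j y : E → Fin 3 → K} (hs : ContDiff 𝕜 n s)
    (hc : ContDiff 𝕜 n c) (hj : ContDiff 𝕜 n j) (hy : ContDiff 𝕜 n y) :
    ContDiff 𝕜 n (fun t => rot (s t) (c t) (j t) (y t)) :=
  (hy.add (hs.smul (ContDiff.cross hj hy))).add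
    (hc.smul (ContDiff.cross hj (ContDiff.cross hj hy)))

end VectorCalculus

/-! ### Passing from real to complex vectors and coefficients -/

section RealPoints

/-- A real vector as a complex vector. -/
def cv {n : ℕ} (x : Fin n → ℝ) : Fin n → ℂ := fun i => (x i : ℂ)

theorem cv_apply {n : ℕ} (x : Fin n → ℝ) (i : Fin n) : cv x i = (x i : ℂ) := rfl

theorem cv_injective {n : ℕ} : Function.Injective (cv (n := n)) := fun x y h => by
  funext i
  exact Complex.ofReal_injective (congrFun h i)

theorem cv_zero {n : ℕ} : cv (0 : Fin n → ℝ) = 0 := by ext i; simp [cv]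

theorem cv_add {n : ℕ} (x y : Fin n → ℝ) : cv (x + y) = cv x + cv y := by
  ext i; simp [cv]

theorem cv_sub {n : ℕ} (x y : Fin n → ℝ) : cv (x - y) = cv x - cv y := by
  ext i; simp [cv]

theorem cv_smul {n : ℕ} (a : ℝ) (x : Fin n → ℝ) : cv (a • x) = (a : ℂ) • cv x := by
  ext i; simp [cv]

theorem cv_dot {n : ℕ} (x y : Fin n → ℝ) : cv x ⬝ᵥ cv y = ((x ⬝ᵥ y : ℝ) : ℂ) := by
  simp [dotProduct, cv]

theorem cv_cross (x y : Fin 3 → ℝ) : cv (x ⨯₃ y) = cv x ⨯₃ cv y := by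
  apply ext_fin_three <;> simp [cv_apply, cross_zero, cross_one, cross_two]

theorem cv_rot (s c : ℝ) (j v : Fin 3 → ℝ) : cv (rot s c j v) = rot (s : ℂ) c (cv j) (cv v) := by
  simp only [rot_apply, cv_add, cv_smul, cv_cross]

theorem cv_nrot (s c d : ℝ) (j v : Fin 3 → ℝ) :
    cv (nrot s c d j v) = nrot (s : ℂ) c d (cv j) (cv v) := by
  simp only [nrot_apply, cv_add, cv_smul, cv_cross, cv_dot, Complex.ofReal_mul]

theorem cv_angVel (r B : ℝ) (x p : Fin 3 → ℝ) :
    cv (angVel r B x p) = angVel (r : ℂ) B (cv x) (cv p) := by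
  simp only [angVel, cv_sub, cv_smul, cv_cross, Complex.ofReal_mul, Complex.ofReal_pow,
    Complex.ofReal_inv]

theorem cv_angVelDeriv (r B : ℝ) (x p : Fin 3 → ℝ) (v : W 3) :
    cv (angVelDeriv r B x p v) = angVelDeriv (r : ℂ) B (cv x) (cv p) (cv v.1, cv v.2) := by
  simp only [angVelDeriv, cv_sub, cv_add, cv_smul, cv_cross, Complex.ofReal_mul,
    Complex.ofReal_pow, Complex.ofReal_inv]

theorem HasDerivAt.cv {n : ℕ} {f : ℝ → Fin n → ℝ} {f' : Fin n → ℝ} {t : ℝ}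
    (hf : HasDerivAt f f' t) : HasDerivAt (fun t => cv (f t)) (Magnetic.cv f') t := by
  rw [hasDerivAt_pi] at *
  exact fun i => (hf i).ofReal_comp

theorem ContDiff.cv {E : Type*} [NormedAddCommGroup E] [NormedSpace ℝ E] {n : WithTop ℕ∞} {m : ℕ}
    {f : E → Fin m → ℝ} (hf : ContDiff ℝ n f) : ContDiff ℝ n (fun t => Magnetic.cv (f t)) := by
  rw [contDiff_pi] at *
  exact fun i => Complex.ofRealCLM.contDiff.comp (hf i)

/-- The real version of the coefficient `cs`. -/
def csR (σ u : ℝ) : ℝ := (cs σ u).re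

/-- The real version of the coefficient `cc`. -/
def ccR (σ u : ℝ) : ℝ := (cc σ u).re

/-- The real version of the coefficient `cd`. -/
def cdR (σ u : ℝ) : ℝ := (cd σ u).re

theorem ofReal_csR (σ u : ℝ) : (csR σ u : ℂ) = cs σ u := by
  have := conj_cs σ u
  simp only [Complex.star_def, Complex.conj_ofReal] at this
  exact Complex.conj_eq_iff_re.1 this

theorem ofReal_ccR (σ u : ℝ) : (ccR σ u : ℂ) = cc σ u := by
  have := conj_cc σ u
  simp only [Complex.star_def, Complex.conj_ofReal] at this
  exact Complex.conj_eq_iff_re.1 this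

theorem ofReal_cdR (σ u : ℝ) : (cdR σ u : ℂ) = cd σ u := by
  have := conj_cd σ u
  simp only [Complex.star_def, Complex.conj_ofReal] at this
  exact Complex.conj_eq_iff_re.1 this

theorem csR_sq_add (σ u : ℝ) : csR σ u ^ 2 + u * ccR σ u ^ 2 = 2 * ccR σ u := by
  have := cs_sq_add σ u
  rw [← ofReal_csR, ← ofReal_ccR] at this
  exact_mod_cast this

@[simp] theorem csR_neg (σ u : ℝ) : csR (-σ) u = -csR σ u := by simp [csR]
@[simp] theorem ccR_neg (σ u : ℝ) : ccR (-σ) u = ccR σ u := by simp [ccR]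
@[simp] theorem csR_zero (u : ℝ) : csR 0 u = 0 := by simp [csR]
@[simp] theorem ccR_zero (u : ℝ) : ccR 0 u = 0 := by simp [ccR]

theorem hasDerivAt_csR_left (σ u : ℝ) :
    HasDerivAt (fun σ => csR σ u) (1 - u * ccR σ u) σ := by
  refine (hasDerivAt_cs_left σ u).real_of_complex.congr_deriv ?_
  rw [← ofReal_ccR]
  exact_mod_cast Complex.ofReal_re _

theorem hasDerivAt_ccR_left (σ u : ℝ) :
    HasDerivAt (fun σ => ccR σ u) (csR σ u) σ :=
  (hasDerivAt_cc_left σ u).real_of_complex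

theorem contDiff_cs : ContDiff ℝ ∞ (fun q : ℂ × ℂ => cs q.1 q.2) := by
  have h : ContDiff ℝ ∞ sincS := (differentiable_sincS.contDiff (n := ∞)).restrict_scalars ℝ
  unfold cs
  exact contDiff_fst.mul (h.comp ((contDiff_fst.pow 2).mul contDiff_snd))

theorem contDiff_cc : ContDiff ℝ ∞ (fun q : ℂ × ℂ => cc q.1 q.2) := by
  have h : ContDiff ℝ ∞ sincC := (differentiable_sincC.contDiff (n := ∞)).restrict_scalars ℝ
  unfold cc
  exact (contDiff_fst.pow 2).mul (h.comp ((contDiff_fst.pow 2).mul contDiff_snd))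

end RealPoints

/-! ### The flow of the sphere in real and complex time -/

section Flow

/-- Rotation in complex time `σ` with angular velocity `j`. -/
def rotFlow (σ : ℂ) (j : Fin 3 → ℂ) : (Fin 3 → ℂ) →ₗ[ℂ] (Fin 3 → ℂ) :=
  rot (cs σ (j ⬝ᵥ j)) (cc σ (j ⬝ᵥ j)) j

/-- The integral of `rotFlow` from `0` to `σ`. -/
def rotInt (σ : ℂ) (j : Fin 3 → ℂ) : (Fin 3 → ℂ) →ₗ[ℂ] (Fin 3 → ℂ) :=
  nrot (cs σ (j ⬝ᵥ j)) (cc σ (j ⬝ᵥ j)) (cd σ (j ⬝ᵥ j)) j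

theorem coeff_rel (σ : ℂ) (j : Fin 3 → ℂ) :
    cs σ (j ⬝ᵥ j) ^ 2 + (j ⬝ᵥ j) * cc σ (j ⬝ᵥ j) ^ 2 = 2 * cc σ (j ⬝ᵥ j) := cs_sq_add _ _

theorem coeffR_rel (σ : ℝ) (j : Fin 3 → ℝ) :
    csR σ (j ⬝ᵥ j) ^ 2 + (j ⬝ᵥ j) * ccR σ (j ⬝ᵥ j) ^ 2 = 2 * ccR σ (j ⬝ᵥ j) := csR_sq_add _ _

theorem HasDerivAt.rotFlow {σ : ℂ} {j y : ℝ → Fin 3 → ℂ} {δ w : Fin 3 → ℂ} {t : ℝ}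
    (hj : HasDerivAt j δ t) (hy : HasDerivAt y w t) :
    HasDerivAt (fun t => rotFlow σ (j t) (y t))
      (rotInt σ (j t) δ ⨯₃ rotFlow σ (j t) (y t) + Magnetic.rotFlow σ (j t) w) t := by
  have hu := HasDerivAt.dot hj hj
  have hs : HasDerivAt (fun t => cs σ (j t ⬝ᵥ j t)) _ t :=
    HasDerivAt.scomp (g₁ := cs σ) (h := fun t => j t ⬝ᵥ j t) t (hasDerivAt_cs_right σ _) hu
  have hc : HasDerivAt (fun t => cc σ (j t ⬝ᵥ j t)) _ t :=
    HasDerivAt.scomp (g₁ := cc σ) (h := fun t => j t ⬝ᵥ j t) t (hasDerivAt_cc_right σ _) hu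
  refine (HasDerivAt.rot hs hc hj hy).congr_deriv ?_
  simp only [Magnetic.rotFlow, Magnetic.rotInt]
  rw [← rot_variation (σ := σ) (coeff_rel σ _) (mul_cd σ _), dotProduct_comm δ]
  simp only [smul_eq_mul]
  module

theorem ContDiff.coeff_cs {E : Type*} [NormedAddCommGroup E] [NormedSpace ℝ E] {f g : E → ℂ}
    (hf : ContDiff ℝ ∞ f) (hg : ContDiff ℝ ∞ g) : ContDiff ℝ ∞ (fun t => cs (f t) (g t)) := by
  have h := ContDiff.comp (g := fun q : ℂ × ℂ => cs q.1 q.2) contDiff_cs (hf.prodMk hg)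
  exact h

theorem ContDiff.coeff_cc {E : Type*} [NormedAddCommGroup E] [NormedSpace ℝ E] {f g : E → ℂ}
    (hf : ContDiff ℝ ∞ f) (hg : ContDiff ℝ ∞ g) : ContDiff ℝ ∞ (fun t => cc (f t) (g t)) := by
  have h := ContDiff.comp (g := fun q : ℂ × ℂ => cc q.1 q.2) contDiff_cc (hf.prodMk hg)
  exact h

theorem contDiff_rotFlow {E : Type*} [NormedAddCommGroup E] [NormedSpace ℝ E] {σ : E → ℂ}
    {j y : E → Fin 3 → ℂ} (hσ : ContDiff ℝ ∞ σ) (hj : ContDiff ℝ ∞ j) (hy : ContDiff ℝ ∞ y) :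
    ContDiff ℝ ∞ (fun t => rotFlow (σ t) (j t) (y t)) :=
  ContDiff.rot (ContDiff.coeff_cs hσ (ContDiff.dot hj hj))
    (ContDiff.coeff_cc hσ (ContDiff.dot hj hj)) hj hy

/-- The angular velocity as a complex vector. -/
def angVelC (r B : ℝ) (z : W 3) : Fin 3 → ℂ := cv (angVel r B z.1 z.2)

/-- The magnetic flow of the sphere in complex time. -/
def flowC (r B : ℝ) (σ : ℂ) (z : W 3) : WC 3 :=
  (rotFlow σ (angVelC r B z) (cv z.1), rotFlow σ (angVelC r B z) (cv z.2))

/-- The magnetic flow of the sphere: rotation about the moment vector. -/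
def flowR (r B : ℝ) (σ : ℝ) (z : W 3) : W 3 :=
  let j := angVel r B z.1 z.2
  (rot (csR σ (j ⬝ᵥ j)) (ccR σ (j ⬝ᵥ j)) j z.1, rot (csR σ (j ⬝ᵥ j)) (ccR σ (j ⬝ᵥ j)) j z.2)

variable {r B : ℝ}

theorem cv_flowR (r B : ℝ) (σ : ℝ) (z : W 3) :
    (cv (flowR r B σ z).1, cv (flowR r B σ z).2) = flowC r B σ z := by
  simp only [flowR, flowC, rotFlow, angVelC, cv_rot, ofReal_csR, ofReal_ccR, cv_dot]

/-- Smoothness of the real flow, jointly in time and point, is read off from the complex one, whose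
coefficients are entire. -/
theorem flowR_eq_reW (r B : ℝ) (σ : ℝ) (z : W 3) : flowR r B σ z = reW (flowC r B σ z) := by
  rw [← cv_flowR]
  ext i <;> simp [reW, cv]

theorem contDiff_angVel (r B : ℝ) : ContDiff ℝ ∞ (fun z : W 3 => angVel r B z.1 z.2) :=
  ((ContDiff.cross contDiff_fst contDiff_snd).sub (contDiff_fst.const_smul (r * B))).const_smul
    (r ^ 2)⁻¹

theorem contDiff_angVelC (r B : ℝ) : ContDiff ℝ ∞ (angVelC r B) :=
  ContDiff.cv (contDiff_angVel r B)

theorem contDiff_flowC (r B : ℝ) :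
    ContDiff ℝ ∞ (fun q : ℂ × W 3 => flowC r B q.1 q.2) := by
  have hj : ContDiff ℝ ∞ (fun q : ℂ × W 3 => angVelC r B q.2) :=
    (contDiff_angVelC r B).comp contDiff_snd
  have hx : ContDiff ℝ ∞ (fun q : ℂ × W 3 => cv q.2.1) :=
    ContDiff.cv (contDiff_fst.comp contDiff_snd)
  have hp : ContDiff ℝ ∞ (fun q : ℂ × W 3 => cv q.2.2) :=
    ContDiff.cv (contDiff_snd.comp contDiff_snd)
  exact ContDiff.prodMk (contDiff_rotFlow contDiff_fst hj hx) (contDiff_rotFlow contDiff_fst hj hp)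

theorem contDiff_flowC_right (r B : ℝ) (σ : ℂ) : ContDiff ℝ ∞ (flowC r B σ) :=
  ContDiff.comp (g := fun q : ℂ × W 3 => flowC r B q.1 q.2) (f := fun z => (σ, z))
    (contDiff_flowC r B) (contDiff_const.prodMk contDiff_id)

theorem contDiff_reW {n : ℕ} : ContDiff ℝ ∞ (reW (n := n)) := by
  unfold reW
  refine ContDiff.prodMk ?_ ?_ <;> rw [contDiff_pi] <;> intro i
  · exact Complex.reCLM.contDiff.comp ((contDiff_apply ℝ ℂ i).comp contDiff_fst)
  · exact Complex.reCLM.contDiff.comp ((contDiff_apply ℝ ℂ i).comp contDiff_snd)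

theorem contDiff_flowC_real (r B : ℝ) :
    ContDiff ℝ ∞ (fun q : ℝ × W 3 => flowC r B (q.1 : ℂ) q.2) :=
  ContDiff.comp (g := fun q : ℂ × W 3 => flowC r B q.1 q.2)
    (f := fun q : ℝ × W 3 => ((q.1 : ℂ), q.2)) (contDiff_flowC r B)
    ((Complex.ofRealCLM.contDiff.comp contDiff_fst).prodMk contDiff_snd)

theorem contDiff_flowR (r B : ℝ) :
    ContDiff ℝ ∞ (fun q : ℝ × W 3 => flowR r B q.1 q.2) := by
  simp only [flowR_eq_reW]
  exact ContDiff.comp (g := reW) contDiff_reW (contDiff_flowC_real r B)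

theorem contDiff_flowR_right (r B σ : ℝ) : ContDiff ℝ ∞ (flowR r B σ) :=
  ContDiff.comp (g := fun q : ℝ × W 3 => flowR r B q.1 q.2) (f := fun z => (σ, z))
    (contDiff_flowR r B) (contDiff_const.prodMk contDiff_id)

/-- The derivative of the flow in complex time. -/
theorem fderiv_flowC (r B : ℝ) (σ : ℂ) (z v : W 3) :
    fderiv ℝ (flowC r B σ) z v =
      (rotInt σ (angVelC r B z) (cv (angVelDeriv r B z.1 z.2 v)) ⨯₃ (flowC r B σ z).1 +
        rotFlow σ (angVelC r B z) (cv v.1),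
      rotInt σ (angVelC r B z) (cv (angVelDeriv r B z.1 z.2 v)) ⨯₃ (flowC r B σ z).2 +
        rotFlow σ (angVelC r B z) (cv v.2)) := by
  have hd : DifferentiableAt ℝ (flowC r B σ) z :=
    (contDiff_flowC_right r B σ).differentiable (by simp) z
  have hl : HasDerivAt (fun t : ℝ => z + t • v) v 0 := by
    simpa using ((hasDerivAt_id (0 : ℝ)).smul_const v).const_add z
  have hz : z + (0 : ℝ) • v = z := by simp
  have h1 : HasDerivAt (fun t : ℝ => flowC r B σ (z + t • v)) (fderiv ℝ (flowC r B σ) z v) 0 :=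
    HasFDerivAt.comp_hasDerivAt_of_eq 0 hd.hasFDerivAt hl hz.symm
  have hx : HasDerivAt (fun t : ℝ => (z + t • v).1) v.1 0 := hl.fst
  have hp : HasDerivAt (fun t : ℝ => (z + t • v).2) v.2 0 := hl.snd
  have hj : HasDerivAt (fun t : ℝ => angVelC r B (z + t • v))
      (cv (angVelDeriv r B z.1 z.2 v)) 0 := by
    have := HasDerivAt.cv (HasDerivAt.angVel (r := r) (B := B) (v := v) hx hp)
    rwa [hz] at this
  have h2 := (HasDerivAt.rotFlow (σ := σ) hj (HasDerivAt.cv hx)).prodMk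
    (HasDerivAt.rotFlow (σ := σ) hj (HasDerivAt.cv hp))
  rw [h1.unique h2, hz]
  rfl

/-- The derivative of the flow in real time, as a complex vector. -/
theorem cv_fderiv_flowR (r B σ : ℝ) (z v : W 3) :
    (cv (fderiv ℝ (flowR r B σ) z v).1, cv (fderiv ℝ (flowR r B σ) z v).2) =
      fderiv ℝ (flowC r B σ) z v := by
  have hd : DifferentiableAt ℝ (flowR r B σ) z :=
    (contDiff_flowR_right r B σ).differentiable (by simp) z
  have hd' : DifferentiableAt ℝ (flowC r B σ) z :=
    (contDiff_flowC_right r B σ).differentiable (by simp) z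
  have hl : HasDerivAt (fun t : ℝ => z + t • v) v 0 := by
    simpa using ((hasDerivAt_id (0 : ℝ)).smul_const v).const_add z
  have hz : z + (0 : ℝ) • v = z := by simp
  have h1 : HasDerivAt (fun t : ℝ => flowC r B σ (z + t • v)) (fderiv ℝ (flowC r B σ) z v) 0 :=
    HasFDerivAt.comp_hasDerivAt_of_eq 0 hd'.hasFDerivAt hl hz.symm
  have h2 : HasDerivAt (fun t : ℝ => flowR r B σ (z + t • v)) (fderiv ℝ (flowR r B σ) z v) 0 :=
    HasFDerivAt.comp_hasDerivAt_of_eq 0 hd.hasFDerivAt hl hz.symm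
  have h3 := (HasDerivAt.cv h2.fst).prodMk (HasDerivAt.cv h2.snd)
  simp only [cv_flowR] at h3
  exact h3.unique h1

end Flow

/-! ### Derivatives along curves and uniqueness for linear equations -/

section Generalities

variable {E F : Type*} [NormedAddCommGroup E] [NormedSpace ℝ E] [NormedAddCommGroup F]
  [NormedSpace ℝ F]

theorem hasDerivAt_line (z v : E) : HasDerivAt (fun t : ℝ => z + t • v) v 0 := by
  simpa using ((hasDerivAt_id (0 : ℝ)).smul_const v).const_add z

theorem fderiv_apply_eq_of_line {f : E → F} {z v : E} {d : F} (hf : DifferentiableAt ℝ f z)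
    (h : HasDerivAt (fun t : ℝ => f (z + t • v)) d 0) : fderiv ℝ f z v = d :=
  (HasFDerivAt.comp_hasDerivAt_of_eq 0 hf.hasFDerivAt (hasDerivAt_line z v) (by simp)).unique h

/-- A derivative within a submanifold is not determined in normal directions, but it is on
velocities of curves in the set, where the chain rule computes it. -/
theorem fderivWithin_apply_eq_of_curve {f : E → F} {s : Set E} {z v : E}
    (hf : DifferentiableAt ℝ f z) {γ : ℝ → E} (hγ : HasDerivAt γ v 0) (h0 : γ 0 = z)
    (hs : ∀ᶠ t in nhds (0 : ℝ), γ t ∈ s) : fderivWithin ℝ f s z v = fderiv ℝ f z v :=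
  (HasFDerivWithinAt.comp_hasDerivAt_of_eq 0 hf.differentiableWithinAt.hasFDerivWithinAt hγ hs
    h0.symm).unique (HasFDerivAt.comp_hasDerivAt_of_eq 0 hf.hasFDerivAt hγ h0.symm)

theorem eq_of_linear_ode (A : E →L[ℝ] E) {φ ψ : ℝ → E} (hφ : ∀ t, HasDerivAt φ (A (φ t)) t)
    (hψ : ∀ t, HasDerivAt ψ (A (ψ t)) t) (h0 : φ 0 = ψ 0) : φ = ψ :=
  ODE_solution_unique_univ (v := fun _ => A) (s := fun _ => Set.univ) (t₀ := 0)
    (fun _ => A.lipschitz.lipschitzOnWith) (fun t => ⟨hφ t, trivial⟩) (fun t => ⟨hψ t, trivial⟩) h0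

end Generalities

/-! ### The magnetic flow and the moment map of the sphere -/

section SphereFlow

variable {r B : ℝ} {z : W 3}

theorem contDiff_energy (r B : ℝ) : ContDiff ℝ ∞ (sphere r B).energy :=
  (ContDiff.dot contDiff_snd contDiff_snd).div_const 2

theorem fderiv_energy_sphere (r B : ℝ) (z y : W 3) :
    fderiv ℝ (sphere r B).energy z y = z.2 ⬝ᵥ y.2 := by
  apply fderiv_apply_eq_of_line ((contDiff_energy r B).differentiable (by simp) z)
  have h := (hasDerivAt_line z y).snd
  refine ((HasDerivAt.dot h h).div_const 2).congr_deriv ?_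
  simp only [zero_smul, add_zero, dotProduct_comm y.2]
  ring

theorem rotation_mem_tangent (r B : ℝ) (z : W 3) (ξ : Fin 3 → ℝ) :
    (ξ ⨯₃ z.1, ξ ⨯₃ z.2) ∈ (sphere r B).tangent z := by
  have h := tangent_of_param ξ 0 z.1 z.2
  exact ⟨h.1, by simpa using h.2⟩

/-- Existence is the equation of motion for j. Uniqueness is nondegeneracy of the form on tangent
vectors. -/
theorem isHamiltonianVector_sphere (hr : 0 < r) (hz : z ∈ (sphere r B).carrier) {v : W 3} :
    (sphere r B).IsHamiltonianVector z v ↔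
      v = (angVel r B z.1 z.2 ⨯₃ z.1, angVel r B z.1 z.2 ⨯₃ z.2) := by
  obtain ⟨hx, hxp⟩ := hz
  have e1 := angVel_cross (B := B) hr.ne' hx hxp
  have e2 := angVel_cross_momentum (B := B) hr.ne' hxp
  have hX : (sphere r B).IsHamiltonianVector z
      (angVel r B z.1 z.2 ⨯₃ z.1, angVel r B z.1 z.2 ⨯₃ z.2) := by
    refine ⟨rotation_mem_tangent _ _ _ _, fun y hy => ?_⟩
    obtain ⟨hy1, -⟩ : z.1 ⬝ᵥ y.1 = 0 ∧ y.1 ⬝ᵥ z.2 + z.1 ⬝ᵥ y.2 = 0 := hy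
    rw [fderiv_energy_sphere, e1, e2]
    change (z.2 ⬝ᵥ y.2 - y.1 ⬝ᵥ _) - B / r * (z.1 ⬝ᵥ (z.2 ⨯₃ y.1)) = _
    simp only [Matrix.vec3_dotProduct, cross_zero, cross_one, cross_two, Pi.sub_apply,
      Pi.smul_apply, smul_eq_mul] at *
    linear_combination ((z.2 0 * z.2 0 + z.2 1 * z.2 1 + z.2 2 * z.2 2) / r ^ 2) * hy1
  refine ⟨fun hv => ?_, fun h => h ▸ hX⟩
  set X : W 3 := (angVel r B z.1 z.2 ⨯₃ z.1, angVel r B z.1 z.2 ⨯₃ z.2)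
  have hδ : v - X ∈ (sphere r B).tangent z := Submodule.sub_mem _ hv.1 hX.1
  have hform : ∀ y ∈ (sphere r B).tangent z, (sphere r B).form z (v - X) y = 0 := by
    intro y hy
    have h1 := hv.2 y hy
    rw [← hX.2 y hy] at h1
    change (v.1 ⬝ᵥ y.2 - y.1 ⬝ᵥ v.2) - B / r * (z.1 ⬝ᵥ (v.1 ⨯₃ y.1)) =
      (X.1 ⬝ᵥ y.2 - y.1 ⬝ᵥ X.2) - B / r * (z.1 ⬝ᵥ (X.1 ⨯₃ y.1)) at h1
    change ((v.1 - X.1) ⬝ᵥ y.2 - y.1 ⬝ᵥ (v.2 - X.2)) - B / r * (z.1 ⬝ᵥ ((v.1 - X.1) ⨯₃ y.1)) = 0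
    simp only [map_sub, LinearMap.sub_apply, sub_dotProduct, dotProduct_sub]
    linear_combination h1
  suffices hz0 : v - X = 0 from sub_eq_zero.1 hz0
  generalize v - X = δ at *
  obtain ⟨hδ1, hδ2⟩ : z.1 ⬝ᵥ δ.1 = 0 ∧ δ.1 ⬝ᵥ z.2 + z.1 ⬝ᵥ δ.2 = 0 := hδ
  have h1 : δ.1 = 0 := by
    have h := hform (0, δ.1) ⟨by simp, by simpa using hδ1⟩
    change (δ.1 ⬝ᵥ δ.1 - 0 ⬝ᵥ δ.2) - B / r * (z.1 ⬝ᵥ (δ.1 ⨯₃ 0)) = 0 at h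
    simpa using h
  have h2 : δ.2 = 0 := by
    rw [h1] at hδ2
    -- The multiple of x makes the test vector with position part `δ.2` tangent; it does not
    -- contribute, because `δ.1` already vanishes.
    have h := hform (δ.2, -((δ.2 ⬝ᵥ z.2) / r ^ 2) • z.1) ⟨by simpa using hδ2, by
      change δ.2 ⬝ᵥ z.2 + z.1 ⬝ᵥ (-((δ.2 ⬝ᵥ z.2) / r ^ 2) • z.1) = 0
      rw [dotProduct_smul, hx, smul_eq_mul]
      field_simp
      ring⟩
    change (δ.1 ⬝ᵥ _ - δ.2 ⬝ᵥ δ.2) - B / r * (z.1 ⬝ᵥ (δ.1 ⨯₃ δ.2)) = 0 at h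
    simpa [h1] using h
  exact Prod.ext h1 h2

theorem flowR_mem (hz : z ∈ (sphere r B).carrier) (σ : ℝ) :
    flowR r B σ z ∈ (sphere r B).carrier :=
  ⟨(dot_rot (coeffR_rel σ _) _ _).trans hz.1, (dot_rot (coeffR_rel σ _) _ _).trans hz.2⟩

theorem angVel_flowR (r B σ : ℝ) (z : W 3) :
    angVel r B (flowR r B σ z).1 (flowR r B σ z).2 = angVel r B z.1 z.2 :=
  (angVel_rot (coeffR_rel σ _)).trans (rot_axis _ _ _)

theorem flowR_zero (r B : ℝ) (z : W 3) : flowR r B 0 z = z := by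
  ext i <;> simp [flowR, rot_apply]

theorem flowR_flowR_neg (r B σ : ℝ) (z : W 3) : flowR r B σ (flowR r B (-σ) z) = z := by
  have h : flowR r B σ (flowR r B (-σ) z) =
      let j := angVel r B z.1 z.2
      (rot (csR σ (j ⬝ᵥ j)) (ccR σ (j ⬝ᵥ j)) j (flowR r B (-σ) z).1,
        rot (csR σ (j ⬝ᵥ j)) (ccR σ (j ⬝ᵥ j)) j (flowR r B (-σ) z).2) := by
    conv_lhs => rw [flowR, angVel_flowR]
  rw [h]
  simp only [flowR, csR_neg, ccR_neg, rot_rot_neg (coeffR_rel σ _)]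

/-- A curve rotating with constant angular velocity. -/
theorem hasDerivAt_rot_curve (j y : Fin 3 → ℝ) (σ : ℝ) :
    HasDerivAt (fun σ => rot (csR σ (j ⬝ᵥ j)) (ccR σ (j ⬝ᵥ j)) j y)
      (j ⨯₃ rot (csR σ (j ⬝ᵥ j)) (ccR σ (j ⬝ᵥ j)) j y) σ := by
  refine (HasDerivAt.rot (hasDerivAt_csR_left σ _) (hasDerivAt_ccR_left σ _)
    (hasDerivAt_const σ j) (hasDerivAt_const σ y)).congr_deriv ?_
  have e : j ⨯₃ (j ⨯₃ (j ⨯₃ y)) = -(j ⬝ᵥ j) • (j ⨯₃ y) := by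
    apply ext_fin_three <;>
    simp only [cross_zero, cross_one, cross_two, Matrix.vec3_dotProduct, Pi.smul_apply,
      smul_eq_mul] <;> ring
  simp only [rot_apply, map_add, map_smul, map_zero, LinearMap.zero_apply, smul_zero, add_zero, e]
  module

theorem hasDerivAt_flowR (r B σ : ℝ) (z : W 3) :
    HasDerivAt (fun σ => flowR r B σ z)
      (angVel r B z.1 z.2 ⨯₃ (flowR r B σ z).1, angVel r B z.1 z.2 ⨯₃ (flowR r B σ z).2) σ :=
  (hasDerivAt_rot_curve _ _ σ).prodMk (hasDerivAt_rot_curve _ _ σ)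

theorem isMagneticFlow_flowR (hr : 0 < r) : (sphere r B).IsMagneticFlow (flowR r B) := by
  intro z hz
  refine ⟨flowR_zero r B z, fun σ => ⟨flowR_mem hz σ, _, ?_, hasDerivAt_flowR r B σ z⟩⟩
  rw [isHamiltonianVector_sphere hr (flowR_mem hz σ), angVel_flowR]

/-- Rotation velocity fields, as continuous linear maps. -/
def rotField (j : Fin 3 → ℝ) : W 3 →L[ℝ] W 3 :=
  LinearMap.toContinuousLinearMap ((crossProduct j).prodMap (crossProduct j))

/-- The equation is nonlinear only through j. Along any solution the derivative of j is j × j = 0,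
so the solution satisfies a linear equation with constant coefficients. -/
theorem eq_flowR_of_isMagneticFlow (hr : 0 < r) {Φ : ℝ → W 3 → W 3}
    (hΦ : (sphere r B).IsMagneticFlow Φ) (hz : z ∈ (sphere r B).carrier) (σ : ℝ) :
    Φ σ z = flowR r B σ z := by
  obtain ⟨h0, h⟩ := hΦ z hz
  have hder : ∀ σ, HasDerivAt (fun s => Φ s z) (angVel r B (Φ σ z).1 (Φ σ z).2 ⨯₃ (Φ σ z).1,
      angVel r B (Φ σ z).1 (Φ σ z).2 ⨯₃ (Φ σ z).2) σ := by
    intro σ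
    obtain ⟨hm, v, hv, hd⟩ := h σ
    rwa [(isHamiltonianVector_sphere hr hm).1 hv] at hd
  have hconst : ∀ σ, angVel r B (Φ σ z).1 (Φ σ z).2 = angVel r B z.1 z.2 := by
    intro σ
    have hd : ∀ σ, HasDerivAt (fun s => angVel r B (Φ s z).1 (Φ s z).2) 0 σ := by
      intro σ
      refine (HasDerivAt.angVel (hder σ).fst (hder σ).snd).congr_deriv ?_
      have := angVelDeriv_tangent (x := (Φ σ z).1) (p := (Φ σ z).2) (B := B)
        (angVel r B (Φ σ z).1 (Φ σ z).2) 0 hr.ne' (h σ).1.1 (by simp)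
      simpa using this
    have := is_const_of_deriv_eq_zero (fun s => (hd s).differentiableAt) (fun s => (hd s).deriv) σ 0
    simpa [h0] using this
  have := eq_of_linear_ode (rotField (angVel r B z.1 z.2)) (φ := fun s => Φ s z)
    (ψ := fun s => flowR r B s z)
    (fun t => by have := hder t; rw [hconst] at this; exact this)
    (fun t => hasDerivAt_flowR r B t z) (by simp [h0, flowR_zero])
  exact congrFun this σ

theorem isSmoothFlow_sphere (hr : 0 < r) {Φ : ℝ → W 3 → W 3}
    (hΦ : (sphere r B).IsMagneticFlow Φ) : (sphere r B).IsSmoothFlow Φ :=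
  (contDiff_flowR r B).contDiffOn.congr fun q hq =>
    eq_flowR_of_isMagneticFlow hr hΦ hq.2 q.1

theorem mulVec_cross_mulVec {A : Matrix (Fin 3) (Fin 3) ℝ}
    (hA : A ∈ Matrix.specialOrthogonalGroup (Fin 3) ℝ) (v w : Fin 3 → ℝ) :
    (A *ᵥ v) ⨯₃ (A *ᵥ w) = A *ᵥ (v ⨯₃ w) := by
  obtain ⟨h1, h2⟩ := Matrix.mem_specialOrthogonalGroup_iff.1 hA
  have h3 := (Matrix.mem_orthogonalGroup_iff _ _).1 h1
  -- The cofactor identity, valid for every matrix; orthogonality and determinant one are used only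
  -- afterwards.
  have key : Aᵀ *ᵥ ((A *ᵥ v) ⨯₃ (A *ᵥ w)) = A.det • (v ⨯₃ w) := by
    rw [Matrix.det_fin_three]
    apply ext_fin_three <;>
    simp only [Matrix.mulVec, Matrix.vec3_dotProduct, cross_zero, cross_one, cross_two,
      Pi.smul_apply, smul_eq_mul, Matrix.transpose_apply] <;> ring
  have h4 := congrArg (fun u => A *ᵥ u) key
  simp only [Matrix.mulVec_mulVec, h2, one_smul] at h4
  rwa [show A * Aᵀ = 1 from h3, Matrix.one_mulVec] at h4

theorem mulVec_dot_mulVec {A : Matrix (Fin 3) (Fin 3) ℝ}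
    (hA : A ∈ Matrix.specialOrthogonalGroup (Fin 3) ℝ) (v w : Fin 3 → ℝ) :
    (A *ᵥ v) ⬝ᵥ (A *ᵥ w) = v ⬝ᵥ w := by
  obtain ⟨h1, h2⟩ := Matrix.mem_specialOrthogonalGroup_iff.1 hA
  have h3 : Aᵀ * A = 1 := (Matrix.mem_orthogonalGroup_iff' _ _).1 h1
  rw [Matrix.dotProduct_mulVec, Matrix.vecMul_mulVec, h3, Matrix.vecMul_one]

theorem isMomentMap_moment (hr : 0 < r) : IsMomentMap (sphere r B) (moment r B) := by
  refine ⟨fun ξ z hz => ⟨?_, fun v hv => ?_⟩, fun A hA z hz => ⟨⟨?_, ?_⟩, ?_⟩⟩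
  · exact rotation_mem_tangent r B z ξ
  · obtain ⟨hx, hxp⟩ : z.1 ⬝ᵥ z.1 = r ^ 2 ∧ z.1 ⬝ᵥ z.2 = 0 := hz
    obtain ⟨hv1, hv2⟩ : z.1 ⬝ᵥ v.1 = 0 ∧ v.1 ⬝ᵥ z.2 + z.1 ⬝ᵥ v.2 = 0 := hv
    have hm : ContDiff ℝ ∞ (fun y => ξ ⬝ᵥ moment r B y) :=
      ContDiff.dot contDiff_const
        ((ContDiff.cross contDiff_fst contDiff_snd).sub (contDiff_fst.const_smul (r * B)))
    symm
    apply fderiv_apply_eq_of_line (hm.differentiable (by simp) z)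
    have h1 := (hasDerivAt_line z v).fst
    have h2 := (hasDerivAt_line z v).snd
    have h3 := HasDerivAt.const_smul (r * B) h1
    refine (HasDerivAt.dot (hasDerivAt_const 0 ξ)
      ((HasDerivAt.cross h1 h2).sub h3)).congr_deriv ?_
    change _ = ((ξ ⨯₃ z.1) ⬝ᵥ v.2 - v.1 ⬝ᵥ (ξ ⨯₃ z.2)) - B / r * (z.1 ⬝ᵥ ((ξ ⨯₃ z.1) ⨯₃ v.1))
    have e : z.1 ⬝ᵥ ((ξ ⨯₃ z.1) ⨯₃ v.1) = r ^ 2 * (ξ ⬝ᵥ v.1) := by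
      simp only [Matrix.vec3_dotProduct, cross_zero, cross_one, cross_two] at *
      linear_combination (ξ 0 * v.1 0 + ξ 1 * v.1 1 + ξ 2 * v.1 2) * hx -
        (ξ 0 * z.1 0 + ξ 1 * z.1 1 + ξ 2 * z.1 2) * hv1
    have e2 : B / r * (r ^ 2 * (ξ ⬝ᵥ v.1)) = r * B * (ξ ⬝ᵥ v.1) := by field_simp
    rw [e, e2]
    simp only [zero_smul, add_zero, zero_dotProduct, zero_add, Matrix.vec3_dotProduct,
      cross_zero, cross_one, cross_two, Pi.sub_apply, Pi.add_apply, Pi.smul_apply, smul_eq_mul]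
    ring
  · exact (mulVec_dot_mulVec hA _ _).trans hz.1
  · exact (mulVec_dot_mulVec hA _ _).trans hz.2
  · simp only [moment, mulVec_cross_mulVec hA, Matrix.mulVec_sub, Matrix.mulVec_smul]

/-- On tangent vectors, derivatives within (an open subset of) the sphere bundle agree with
ambient derivatives. -/
theorem fderivWithin_sphere {F : Type*} [NormedAddCommGroup F] [NormedSpace ℝ F] {f : W 3 → F}
    (hr : 0 < r) (hz : z ∈ (sphere r B).carrier) (hf : DifferentiableAt ℝ f z)
    {U : Set (W 3)} (hU : U ∈ nhds z) {v : W 3} (hv : v ∈ (sphere r B).tangent z) :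
    fderivWithin ℝ f ((sphere r B).carrier ∩ U) z v = fderiv ℝ f z v := by
  obtain ⟨ξ, b, hb, rfl⟩ := tangent_param hr.ne' hz.1 hv.1 hv.2
  have e : ((ξ ⨯₃ z.1, b ⨯₃ z.1 + ξ ⨯₃ z.2) : W 3) =
      (ξ ⨯₃ z.1, ξ ⨯₃ z.2) + ((0 : Fin 3 → ℝ), b ⨯₃ z.1) := by
    simp [add_comm]
  rw [e, map_add, map_add]
  congr 1
  -- The rotational part of a tangent vector is the velocity of a rotation orbit, which stays in the
  -- bundle; the vertical part below is the velocity of a line in the fibre.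
  · let γ : ℝ → W 3 := fun t => (rot (csR t (ξ ⬝ᵥ ξ)) (ccR t (ξ ⬝ᵥ ξ)) ξ z.1,
      rot (csR t (ξ ⬝ᵥ ξ)) (ccR t (ξ ⬝ᵥ ξ)) ξ z.2)
    have hγ : HasDerivAt γ (ξ ⨯₃ z.1, ξ ⨯₃ z.2) 0 := by
      refine ((hasDerivAt_rot_curve ξ z.1 0).prodMk
        (hasDerivAt_rot_curve ξ z.2 0)).congr_deriv ?_
      simp [rot_apply]
    have h0 : γ 0 = z := by ext i <;> simp [γ, rot_apply]
    refine fderivWithin_apply_eq_of_curve hf hγ h0 ?_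
    filter_upwards [hγ.continuousAt.eventually_mem (h0.symm ▸ hU)] with t ht
    exact ⟨⟨(dot_rot (coeffR_rel t _) _ _).trans hz.1, (dot_rot (coeffR_rel t _) _ _).trans hz.2⟩,
      ht⟩
  · have hγ := hasDerivAt_line z ((0 : Fin 3 → ℝ), b ⨯₃ z.1)
    have h0 : z + (0 : ℝ) • ((0 : Fin 3 → ℝ), b ⨯₃ z.1) = z := by simp
    refine fderivWithin_apply_eq_of_curve hf hγ h0 ?_
    filter_upwards [hγ.continuousAt.eventually_mem (h0.symm ▸ hU)] with t ht
    refine ⟨⟨?_, ?_⟩, ht⟩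
    · simpa using hz.1
    · simpa using hz.2

theorem fderivWithin_sphere_carrier {F : Type*} [NormedAddCommGroup F] [NormedSpace ℝ F]
    {f : W 3 → F} (hr : 0 < r) (hz : z ∈ (sphere r B).carrier) (hf : DifferentiableAt ℝ f z)
    {v : W 3} (hv : v ∈ (sphere r B).tangent z) :
    fderivWithin ℝ f (sphere r B).carrier z v = fderiv ℝ f z v := by
  simpa using fderivWithin_sphere hr hz hf Filter.univ_mem hv

end SphereFlow

/-! ### Complexified vectors and holomorphic families of planes -/

section Complexification

/-- A real phase-space vector as a complex one. -/
def cvW {n : ℕ} (w : W n) : WC n := (cv w.1, cv w.2)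

theorem cvW_injective {n : ℕ} : Function.Injective (cvW (n := n)) := fun _ _ h =>
  Prod.ext (cv_injective (congrArg Prod.fst h)) (cv_injective (congrArg Prod.snd h))

theorem reW_cplx {n : ℕ} (a b : W n) : reW (cvW a + Complex.I • cvW b) = a := by
  ext i <;> simp [reW, cvW, cv]

theorem imW_cplx {n : ℕ} (a b : W n) : imW (cvW a + Complex.I • cvW b) = b := by
  ext i <;> simp [imW, cvW, cv]

theorem cplx_reW_imW {n : ℕ} (w : WC n) : cvW (reW w) + Complex.I • cvW (imW w) = w := by
  ext i
  · simpa [reW, imW, cvW, cv, mul_comm] using Complex.re_add_im (w.1 i)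
  · simpa [reW, imW, cvW, cv, mul_comm] using Complex.re_add_im (w.2 i)

/-- Real part of a complex vector. -/
def reV {n : ℕ} (v : Fin n → ℂ) : Fin n → ℝ := fun i => (v i).re

/-- Imaginary part of a complex vector. -/
def imV {n : ℕ} (v : Fin n → ℂ) : Fin n → ℝ := fun i => (v i).im

theorem cv_reV_imV {n : ℕ} (v : Fin n → ℂ) : cv (reV v) + Complex.I • cv (imV v) = v := by
  ext i
  simpa [reV, imV, cv, mul_comm] using Complex.re_add_im (v i)

theorem reV_dot {n : ℕ} (v : Fin n → ℂ) (x : Fin n → ℝ) : reV v ⬝ᵥ x = (v ⬝ᵥ cv x).re := by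
  simp [dotProduct, reV, cv]

theorem imV_dot {n : ℕ} (v : Fin n → ℂ) (x : Fin n → ℝ) : imV v ⬝ᵥ x = (v ⬝ᵥ cv x).im := by
  simp [dotProduct, imV, cv]

/-- The image of a fixed plane under a holomorphic family of injective linear maps. -/
theorem holomorphicPlanes_map {m n : ℕ} {Q : Submodule ℂ (Fin m → ℂ)}
    (hQ : Module.finrank ℂ Q = 2) (e : ℂ → (Fin m → ℂ) →ₗ[ℂ] WC n)
    (hd : ∀ b, Differentiable ℂ (fun σ => e σ b)) (hinj : ∀ σ, ∀ b ∈ Q, e σ b = 0 → b = 0)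
    (D : Set ℂ) : HolomorphicPlanes (fun σ => Q.map (e σ)) D := by
  intro σ₀ _
  let bs := Module.finBasisOfFinrankEq ℂ Q hQ
  refine ⟨Set.univ, isOpen_univ, trivial, fun i σ => e σ (bs i), fun i => (hd _).differentiableOn,
    fun σ _ => ⟨?_, ?_⟩⟩
  · have h := bs.linearIndependent.map' ((e σ) ∘ₗ Q.subtype) (by
      rw [LinearMap.ker_eq_bot']
      intro b hb
      exact Subtype.ext (hinj σ b b.2 hb))
    exact h
  · have : Set.range (fun i => e σ (bs i)) = (e σ) '' (Q.subtype '' Set.range bs) := by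
      rw [← Set.range_comp, ← Set.range_comp]; rfl
    rw [this, Submodule.span_image, Submodule.span_image, bs.span_eq, Submodule.map_subtype_top]

end Complexification

/-! ### Continuation of the vertical spaces of the sphere -/

section SphereContinuation

variable {r B : ℝ} {z : W 3}

/-- The form has polynomial entries, so its complex bilinear extension is given by the same
expression over ℂ and `form_param` applies to it. -/
theorem formC_sphere (r B : ℝ) (z : W 3) (v w : WC 3) :
    (sphere r B).formC z v w = v.1 ⬝ᵥ w.2 - w.1 ⬝ᵥ v.2 -
      (B : ℂ) / r * (cv z.1 ⬝ᵥ (v.1 ⨯₃ w.1)) := by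
  have e : ((B : ℂ) / r) = ((B / r : ℝ) : ℂ) := by push_cast; rfl
  rw [e]
  generalize hk : B / r = k
  simp only [PhaseSpace.formC, sphere, hk, reW, imW, Matrix.vec3_dotProduct, cross_zero, cross_one,
    cross_two, cv_apply]
  apply Complex.ext <;>
  simp only [Complex.add_re, Complex.add_im, Complex.sub_re, Complex.sub_im, Complex.mul_re,
    Complex.mul_im, Complex.ofReal_re, Complex.ofReal_im, Complex.I_re, Complex.I_im] <;> ring

theorem mem_tangentC_sphere {w : WC 3} : w ∈ (sphere r B).tangentC z ↔
    cv z.1 ⬝ᵥ w.1 = 0 ∧ w.1 ⬝ᵥ cv z.2 + cv z.1 ⬝ᵥ w.2 = 0 := by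
  change ((z.1 ⬝ᵥ (reW w).1 = 0 ∧ (reW w).1 ⬝ᵥ z.2 + z.1 ⬝ᵥ (reW w).2 = 0) ∧
    (z.1 ⬝ᵥ (imW w).1 = 0 ∧ (imW w).1 ⬝ᵥ z.2 + z.1 ⬝ᵥ (imW w).2 = 0)) ↔ _
  simp only [Complex.ext_iff, reW, imW, Matrix.vec3_dotProduct, cv_apply, Complex.add_re,
    Complex.add_im, Complex.mul_re,
    Complex.mul_im, Complex.ofReal_re, Complex.ofReal_im, Complex.zero_re, Complex.zero_im,
    mul_zero, zero_mul, sub_zero, add_zero, zero_add]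
  tauto

/-- The complex orthogonal complement of a real vector. -/
def perpC (x : Fin 3 → ℝ) : Submodule ℂ (Fin 3 → ℂ) :=
  LinearMap.ker ((dotProductBilin ℂ ℂ) (cv x))

theorem mem_perpC {x : Fin 3 → ℝ} {b : Fin 3 → ℂ} : b ∈ perpC x ↔ b ⬝ᵥ cv x = 0 := by
  rw [perpC, LinearMap.mem_ker, dotProduct_comm]
  rfl

theorem finrank_perpC {x : Fin 3 → ℝ} (hx : x ≠ 0) : Module.finrank ℂ (perpC x) = 2 := by
  have h := Module.Dual.finrank_ker_add_one_of_ne_zero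
    (f := ((dotProductBilin ℂ ℂ) (cv x) : Module.Dual ℂ (Fin 3 → ℂ))) (by
      intro h0
      apply hx
      apply cv_injective
      rw [cv_zero]
      apply dotProduct_eq_zero
      intro w
      exact LinearMap.congr_fun h0 w)
  rw [Module.finrank_fin_fun] at h
  exact Nat.succ.inj h

/-- The frame of the continued vertical space at complex time `σ`. -/
def frameC (r B : ℝ) (σ : ℂ) (z : W 3) : (Fin 3 → ℂ) →ₗ[ℂ] WC 3 :=
  let j := angVelC r B z
  frame (cs σ (j ⬝ᵥ j)) (cc σ (j ⬝ᵥ j)) (cd σ (j ⬝ᵥ j)) j (cv z.1) (cv z.2)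

/-- The continuation of the push-forward of the vertical space to complex time. -/
def contP (r B : ℝ) (z : W 3) (σ : ℂ) : Submodule ℂ (WC 3) := (perpC z.1).map (frameC r B σ z)

theorem mem_contP {σ : ℂ} {w : WC 3} :
    w ∈ contP r B z σ ↔ ∃ b, b ⬝ᵥ cv z.1 = 0 ∧ frameC r B σ z b = w := by
  simp only [contP, Submodule.mem_map, mem_perpC]

theorem cv_carrier (hz : z ∈ (sphere r B).carrier) :
    cv z.1 ⬝ᵥ cv z.1 = (r : ℂ) ^ 2 ∧ cv z.1 ⬝ᵥ cv z.2 = 0 := by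
  rw [cv_dot, cv_dot, hz.1, hz.2]
  simp

theorem angVelC_cross (hr : 0 < r) (hz : z ∈ (sphere r B).carrier) :
    angVelC r B z ⨯₃ cv z.1 = cv z.2 := by
  rw [angVelC, ← cv_cross, angVel_cross hr.ne' hz.1 hz.2]

theorem isLagrangian_contP (hr : 0 < r) (hz : z ∈ (sphere r B).carrier) (σ : ℂ) :
    (sphere r B).IsLagrangian z (contP r B z σ) := by
  have hr' : (r : ℂ) ≠ 0 := Complex.ofReal_ne_zero.2 hr.ne'
  obtain ⟨hx, hxp⟩ := cv_carrier hz
  have hrel := coeff_rel σ (angVelC r B z)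
  have hj : angVelC r B z = angVel (r : ℂ) B (cv z.1) (cv z.2) := cv_angVel _ _ _ _
  have hr2 : (r : ℂ) ^ 2 ≠ 0 := pow_ne_zero 2 hr'
  refine ⟨?_, fun w hw => ⟨fun hwP v hv => ?_, fun h => ?_⟩⟩
  · intro w hw
    obtain ⟨b, hb, rfl⟩ := mem_contP.1 hw
    rw [mem_tangentC_sphere, frameC, frame_apply]
    exact tangent_of_param _ _ _ _
  · obtain ⟨b, hb, rfl⟩ := mem_contP.1 hwP
    obtain ⟨b', hb', rfl⟩ := mem_contP.1 hv
    rw [formC_sphere, frameC, frame_apply, frame_apply, form_param hr' hx hb hb', ← hj,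
      nrot_isotropic hrel, mul_zero]
  · obtain ⟨ξ, b, hb, rfl⟩ := tangent_param hr' hx (mem_tangentC_sphere.1 hw).1
      (mem_tangentC_sphere.1 hw).2
    rw [mem_contP]
    refine mem_frame_of_orthogonal hrel _ hr' hx hxp (angVelC_cross hr hz) hb fun b' hb' => ?_
    have h1 := h _ (mem_contP.2 ⟨b', hb', rfl⟩)
    rw [formC_sphere, frameC, frame_apply, form_param hr' hx hb hb', ← hj] at h1
    exact (mul_eq_zero.1 h1).resolve_left hr2

@[fun_prop] theorem differentiable_cs (u : ℂ) : Differentiable ℂ (fun σ => cs σ u) :=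
  fun σ => (hasDerivAt_cs_left σ u).differentiableAt

@[fun_prop] theorem differentiable_cc (u : ℂ) : Differentiable ℂ (fun σ => cc σ u) :=
  fun σ => (hasDerivAt_cc_left σ u).differentiableAt

@[fun_prop] theorem differentiable_cd (u : ℂ) : Differentiable ℂ (fun σ => cd σ u) := by
  unfold cd; fun_prop

/-- The source plane x^⊥ does not depend on time and the frame is entire in time and injective on
it, so there is a holomorphic frame on any set of times. -/
theorem holomorphicPlanes_contP (hr : 0 < r) (hz : z ∈ (sphere r B).carrier) (D : Set ℂ) :
    HolomorphicPlanes (contP r B z) D := by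
  have hr' : (r : ℂ) ≠ 0 := Complex.ofReal_ne_zero.2 hr.ne'
  obtain ⟨hx, hxp⟩ := cv_carrier hz
  refine holomorphicPlanes_map (finrank_perpC ?_) (fun σ => frameC r B σ z) (fun b => ?_)
    (fun σ b hb h0 => ?_) D
  · intro h0
    have := hz.1
    rw [h0, zero_dotProduct] at this
    exact pow_ne_zero 2 hr.ne' this.symm
  · simp only [frameC, frame_apply, nrot_apply, map_add, map_smul, LinearMap.add_apply,
      LinearMap.smul_apply]
    fun_prop
  · exact frame_injective (coeff_rel σ _) _ hr' hx hxp (angVelC_cross hr hz) (mem_perpC.1 hb) h0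

/-- The frame of the push-forward of the vertical space at real time `σ`. -/
def frameR (r B : ℝ) (σ : ℝ) (z : W 3) : (Fin 3 → ℝ) →ₗ[ℝ] W 3 :=
  let j := angVel r B z.1 z.2
  frame (csR σ (j ⬝ᵥ j)) (ccR σ (j ⬝ᵥ j)) (cdR σ (j ⬝ᵥ j)) j z.1 z.2

theorem frameC_cv (r B σ : ℝ) (z : W 3) (b : Fin 3 → ℝ) :
    frameC r B σ z (cv b) = cvW (frameR r B σ z b) := by
  simp only [frameC, frameR, frame_apply, cvW, angVelC, cv_add, cv_cross, cv_nrot, cv_dot,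
    ofReal_csR, ofReal_cdR, Complex.ofReal_neg, ofReal_ccR]

theorem fderiv_flowR (r B σ : ℝ) (z v : W 3) :
    fderiv ℝ (flowR r B σ) z v =
      let j := angVel r B z.1 z.2
      let δ := nrot (csR σ (j ⬝ᵥ j)) (ccR σ (j ⬝ᵥ j)) (cdR σ (j ⬝ᵥ j)) j
        (angVelDeriv r B z.1 z.2 v)
      (δ ⨯₃ (flowR r B σ z).1 + rot (csR σ (j ⬝ᵥ j)) (ccR σ (j ⬝ᵥ j)) j v.1,
        δ ⨯₃ (flowR r B σ z).2 + rot (csR σ (j ⬝ᵥ j)) (ccR σ (j ⬝ᵥ j)) j v.2) := by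
  apply cvW_injective
  refine (cv_fderiv_flowR r B σ z v).trans ?_
  rw [fderiv_flowC, ← cv_flowR]
  simp only [cvW, angVelC, rotInt, rotFlow, cv_add, cv_cross, cv_nrot, cv_rot, cv_dot, ofReal_csR,
    ofReal_cdR, ofReal_ccR]

/-- The flow pushes vertical vectors to the frame. -/
theorem fderiv_flowR_vertical (hr : 0 < r) {y : W 3} (hy : y ∈ (sphere r B).carrier) (σ : ℝ)
    {δ : Fin 3 → ℝ} (hδ : δ ⬝ᵥ y.1 = 0) :
    let j := angVel r B y.1 y.2
    fderiv ℝ (flowR r B σ) y (0, δ ⨯₃ y.1) =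
      frameR r B σ (flowR r B σ y) (rot (csR σ (j ⬝ᵥ j)) (ccR σ (j ⬝ᵥ j)) j δ) := by
  intro j
  have h1 := angVelDeriv_tangent (p := y.2) (B := B) 0 δ hr.ne' hy.1 hδ
  simp only [map_zero, LinearMap.zero_apply, add_zero, zero_add] at h1
  have h2 := nrot_rot_neg (coeffR_rel σ j) (cdR σ (j ⬝ᵥ j))
    (rot (csR σ (j ⬝ᵥ j)) (ccR σ (j ⬝ᵥ j)) j δ)
  rw [rot_neg_rot (coeffR_rel σ j)] at h2
  rw [fderiv_flowR, h1]
  simp only [frameR, angVel_flowR, frame_apply, map_zero, add_zero]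
  rw [rot_cross (coeffR_rel σ _), add_comm]
  change (nrot _ _ _ j δ ⨯₃ _, _ + nrot _ _ _ j δ ⨯₃ _) = _
  rw [h2]
  rfl

/-- A vertical vector (0, δ × y) at y = Φ_{-σ}(z) is pushed to the frame vector with b = exp(σ j×)
δ; this rotation maps y^⊥ onto x^⊥, where x is the base point of z. The real statement is then
complexified through real and imaginary parts of b. -/
theorem pushVertical_eq (hr : 0 < r) {Φ : ℝ → W 3 → W 3} (hΦ : (sphere r B).IsMagneticFlow Φ)
    (hz : z ∈ (sphere r B).carrier) (σ : ℝ) :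
    contP r B z σ = (sphere r B).pushVertical Φ z σ := by
  have hV : ∀ w : W 3, w ∈ ((sphere r B).vertical (Φ (-σ) z)).map
      (fderivWithin ℝ (Φ σ) (sphere r B).carrier (Φ (-σ) z) : W 3 →ₗ[ℝ] W 3) ↔
      ∃ b, b ⬝ᵥ z.1 = 0 ∧ frameR r B σ z b = w := by
    intro w
    have hy := flowR_mem hz (-σ)
    have hyz := flowR_flowR_neg r B σ z
    rw [eq_flowR_of_isMagneticFlow hr hΦ hz,
      fderivWithin_congr (f := flowR r B σ) (fun x hx => eq_flowR_of_isMagneticFlow hr hΦ hx σ)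
        (eq_flowR_of_isMagneticFlow hr hΦ hy σ)]
    set y := flowR r B (-σ) z
    set j := angVel r B y.1 y.2
    have hrel := coeffR_rel σ j
    have hz1 : z.1 = rot (csR σ (j ⬝ᵥ j)) (ccR σ (j ⬝ᵥ j)) j y.1 := by
      conv_lhs => rw [← hyz]
      rfl
    have hdiff : DifferentiableAt ℝ (flowR r B σ) y :=
      (contDiff_flowR_right r B σ).differentiable (by simp) y
    have hvert : ∀ δ : Fin 3 → ℝ, ((0 : Fin 3 → ℝ), δ ⨯₃ y.1) ∈ (sphere r B).tangent y := by
      intro δ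
      exact ⟨by simp, by simp⟩
    have hval : ∀ δ : Fin 3 → ℝ, δ ⬝ᵥ y.1 = 0 →
        fderivWithin ℝ (flowR r B σ) (sphere r B).carrier y (0, δ ⨯₃ y.1) =
        frameR r B σ z (rot (csR σ (j ⬝ᵥ j)) (ccR σ (j ⬝ᵥ j)) j δ) := by
      intro δ hδ
      rw [fderivWithin_sphere_carrier hr hy hdiff (hvert δ), fderiv_flowR_vertical hr hy σ hδ, hyz]
    rw [Submodule.mem_map]
    constructor
    · rintro ⟨v, ⟨hv1, hv2⟩, rfl⟩
      obtain ⟨v1, v2⟩ := v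
      have hv0 : v1 = 0 := hv2
      subst hv0
      obtain ⟨ξ, b, hb, hv⟩ := tangent_param hr.ne' hy.1 hv1.1 hv1.2
      have hξ : ξ ⨯₃ y.1 = 0 := (congrArg Prod.fst hv).symm
      have hyy : y.1 ⬝ᵥ y.1 ≠ 0 := by rw [hy.1]; exact pow_ne_zero 2 hr.ne'
      have hξ' := eq_smul_of_cross_eq_zero hyy hξ
      set l := ξ ⬝ᵥ y.1 / (y.1 ⬝ᵥ y.1)
      -- A vertical vector may come with a rotation ξ = l x; the ambiguity of the parametrisation
      -- moves it into b.
      have hv2' : v2 = (b - l • y.2) ⨯₃ y.1 := by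
        have : v2 = b ⨯₃ y.1 + ξ ⨯₃ y.2 := congrArg Prod.snd hv
        rw [this, hξ', map_smul, LinearMap.smul_apply, ← cross_anticomm y.2 y.1, map_sub, map_smul,
          LinearMap.sub_apply, LinearMap.smul_apply, smul_neg, sub_eq_add_neg]
      have hδ : (b - l • y.2) ⬝ᵥ y.1 = 0 := by
        rw [sub_dotProduct, hb, smul_dotProduct, dotProduct_comm, hy.2, smul_zero, sub_zero]
      refine ⟨_, ?_, (hval _ hδ).symm.trans (by rw [hv2']; rfl)⟩
      rw [hz1, dot_rot hrel, hδ]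
    · rintro ⟨b, hb, rfl⟩
      have hbb := rot_rot_neg hrel b
      set δ := rot (-csR σ (j ⬝ᵥ j)) (ccR σ (j ⬝ᵥ j)) j b
      have hδ : δ ⬝ᵥ y.1 = 0 := by
        rw [← dot_rot hrel, hbb, ← hz1, hb]
      exact ⟨(0, δ ⨯₃ y.1), ⟨hvert δ, rfl⟩, (hval δ hδ).trans (by rw [hbb])⟩
  ext w
  change _ ↔ (reW w ∈ _ ∧ imW w ∈ _)
  rw [hV, hV, mem_contP]
  constructor
  · rintro ⟨b, hb, rfl⟩
    have h : frameC r B σ z b = cvW (frameR r B σ z (reV b)) +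
        Complex.I • cvW (frameR r B σ z (imV b)) := by
      conv_lhs => rw [← cv_reV_imV b, map_add, map_smul, frameC_cv, frameC_cv]
    rw [h, reW_cplx, imW_cplx]
    exact ⟨⟨_, by rw [reV_dot, hb, Complex.zero_re], rfl⟩,
      ⟨_, by rw [imV_dot, hb, Complex.zero_im], rfl⟩⟩
  · rintro ⟨⟨b1, hb1, h1⟩, ⟨b2, hb2, h2⟩⟩
    refine ⟨cv b1 + Complex.I • cv b2, ?_, ?_⟩
    · rw [add_dotProduct, smul_dotProduct, cv_dot, cv_dot, hb1, hb2]
      simp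
    · rw [map_add, map_smul, frameC_cv, frameC_cv, h1, h2, cplx_reW_imW]

theorem isContinuation_contP (hr : 0 < r) {Φ : ℝ → W 3 → W 3}
    (hΦ : (sphere r B).IsMagneticFlow Φ) (hz : z ∈ (sphere r B).carrier) (R : ℝ) :
    (sphere r B).IsContinuation Φ z R (contP r B z) :=
  ⟨fun σ _ => pushVertical_eq hr hΦ hz σ, fun σ _ => isLagrangian_contP hr hz σ,
    holomorphicPlanes_contP hr hz _⟩

end SphereContinuation

/-! ### The map at time i, its conjugate differential and definiteness -/

section SphereComplexStructure

variable {r B : ℝ} {z : W 3}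

/-- The base point of the flow at time `i`, smooth on the whole ambient space. -/
def aMap (r B : ℝ) (z : W 3) : Fin 3 → ℂ := (flowC r B Complex.I z).1

theorem contDiff_aMap (r B : ℝ) : ContDiff ℝ ∞ (aMap r B) :=
  (contDiff_flowC_right r B Complex.I).fst

/-- The double cross product j × (j × x) = (j · x) j - (j · j) x, together with j · x = -r B,
expresses the rotated x through x, p and j alone. -/
theorem rotFlow_formula (hr : 0 < r) (hz : z ∈ (sphere r B).carrier) (σ : ℂ) (u : ℝ)
    (hu : u = angVel r B z.1 z.2 ⬝ᵥ angVel r B z.1 z.2) :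
    (flowC r B σ z).1 = (1 - cc σ u * u) • cv z.1 + cs σ u • cv z.2 -
      (cc σ u * (r * B)) • angVelC r B z := by
  have hj : angVelC r B z ⬝ᵥ angVelC r B z = u := by rw [angVelC, cv_dot, hu]
  have e : angVelC r B z ⨯₃ cv z.2 =
      -((r : ℂ) * B) • angVelC r B z - (u : ℂ) • cv z.1 := by
    have h1 : angVelC r B z ⬝ᵥ cv z.1 = -((r : ℂ) * B) := by
      rw [angVelC, cv_dot, angVel_dot hr.ne' hz.1]
      push_cast
      rfl
    rw [← hj, ← h1, ← angVelC_cross hr hz]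
    apply ext_fin_three <;>
    simp only [cross_zero, cross_one, cross_two, Matrix.vec3_dotProduct, Pi.smul_apply,
      Pi.sub_apply, smul_eq_mul] <;> ring
  change rot (cs σ (angVelC r B z ⬝ᵥ angVelC r B z)) (cc σ (angVelC r B z ⬝ᵥ angVelC r B z)) _ _ = _
  rw [rot_apply, hj, angVelC_cross hr hz, e]
  module

theorem ell_sq (hr : 0 < r) (hz : z ∈ (sphere r B).carrier) :
    ell r B z ^ 2 = angVel r B z.1 z.2 ⬝ᵥ angVel r B z.1 z.2 := by
  rw [angVel_dot_self hr.ne' hz.1 hz.2, ell, div_pow, Real.sq_sqrt]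
  have : 0 ≤ z.2 ⬝ᵥ z.2 := by
    rw [Matrix.vec3_dotProduct]; nlinarith [sq_nonneg (z.2 0), sq_nonneg (z.2 1), sq_nonneg (z.2 2)]
  positivity

theorem dot_self_nonneg_real (v : Fin 3 → ℝ) : 0 ≤ v ⬝ᵥ v := by
  rw [Matrix.vec3_dotProduct]
  nlinarith [sq_nonneg (v 0), sq_nonneg (v 1), sq_nonneg (v 2)]

theorem aMap_formula (hr : 0 < r) (hz : z ∈ (sphere r B).carrier) {u : ℝ}
    (hu : u = angVel r B z.1 z.2 ⬝ᵥ angVel r B z.1 z.2) :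
    aMap r B z = cv ((1 + hc u * u) • z.1 + (hc u * (r * B)) • angVel r B z.1 z.2) +
      Complex.I • cv (hs u • z.2) := by
  rw [aMap, rotFlow_formula hr hz _ u hu, cs_I, cc_I]
  simp only [cv_add, cv_smul, Complex.ofReal_add, Complex.ofReal_mul, Complex.ofReal_one, angVelC]
  module

theorem sphereMap_eq (hr : 0 < r) (hz : z ∈ (sphere r B).carrier) :
    sphereMap r B z = aMap r B z := by
  have hu := ell_sq hr hz
  set L := ell r B z with hL
  -- At L = 0 the quotients in `sphereMap` take the default value 0, whereas `hs` and `hc` are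
  -- nonzero there; the factors p and B that multiply them vanish.
  have hL0 : L = 0 → z.2 = 0 ∧ B = 0 := by
    intro h0
    have h := angVel_dot_self (B := B) hr.ne' hz.1 hz.2
    rw [← hu, h0, eq_comm, zero_pow two_ne_zero, div_eq_zero_iff] at h
    have h1 := h.resolve_right (by positivity)
    have h2 := dot_self_nonneg_real z.2
    have h3 : 0 ≤ r ^ 2 * B ^ 2 := by positivity
    have h4 : r ^ 2 * B ^ 2 = 0 := by linarith
    exact ⟨dotProduct_self_eq_zero.1 (by linarith), by simpa [hr.ne'] using h4⟩
  rw [aMap_formula hr hz hu]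
  have h1 : (1 + hc (L ^ 2) * L ^ 2) = Real.cosh L := by linarith [sq_mul_hc_sq L]
  have h2 : (Real.sinh L / L) • z.2 = hs (L ^ 2) • z.2 := by
    by_cases h : L = 0
    · rw [(hL0 h).1, smul_zero, smul_zero]
    · rw [← mul_hs_sq, mul_div_cancel_left₀ _ h]
  have h3 : (Real.cosh L - 1) / L ^ 2 * B = hc (L ^ 2) * B := by
    by_cases h : L = 0
    · rw [(hL0 h).2, mul_zero, mul_zero]
    · rw [← sq_mul_hc_sq, mul_div_cancel_left₀ _ (pow_ne_zero 2 h)]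
  funext i
  have h4 : angVel r B z.1 z.2 i = (r ^ 2)⁻¹ * moment r B z i := rfl
  have h5 := congrFun h2 i
  simp only [Pi.smul_apply, smul_eq_mul] at h5
  simp only [sphereMap, ← hL, h1, h3, h5, Pi.add_apply, Pi.smul_apply, cv_apply, smul_eq_mul, h4]
  push_cast
  have hr' : (r : ℂ) ≠ 0 := Complex.ofReal_ne_zero.2 hr.ne'
  field_simp
  ring

theorem exists_entire_extension (hr : 0 < r) {Φ : ℝ → W 3 → W 3}
    (hΦ : (sphere r B).IsMagneticFlow Φ) (hz : z ∈ (sphere r B).carrier) :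
    ∃ a : ℂ → Fin 3 → ℂ, Differentiable ℂ a ∧
      (∀ σ : ℝ, a (σ : ℂ) = fun j => (((Φ σ z).1 j : ℝ) : ℂ)) ∧
      a Complex.I = sphereMap r B z := by
  refine ⟨fun σ => (flowC r B σ z).1, ?_, fun σ => ?_, (sphereMap_eq hr hz).symm⟩
  · simp only [flowC, rotFlow, rot_apply]
    fun_prop
  · rw [eq_flowR_of_isMagneticFlow hr hΦ hz]
    change (flowC r B (σ : ℂ) z).1 = _
    rw [← cv_flowR]
    rfl

theorem fderiv_aMap (r B : ℝ) (z v : W 3) :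
    fderiv ℝ (aMap r B) z v =
      rotInt Complex.I (angVelC r B z) (cv (angVelDeriv r B z.1 z.2 v)) ⨯₃ aMap r B z +
        rotFlow Complex.I (angVelC r B z) (cv v.1) := by
  have hd : DifferentiableAt ℝ (flowC r B Complex.I) z :=
    (contDiff_flowC_right r B Complex.I).differentiable (by simp) z
  have h := (hd.hasFDerivAt.fst).fderiv
  have h2 := congrArg Prod.fst (fderiv_flowC r B Complex.I z v)
  change fderiv ℝ (fun z => (flowC r B Complex.I z).1) z v = _
  rw [h]
  exact h2

theorem star_cross (v w : Fin 3 → ℂ) : star (v ⨯₃ w) = star v ⨯₃ star w := by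
  apply ext_fin_three <;> simp [cross_zero, cross_one, cross_two]

theorem star_dot (v w : Fin 3 → ℂ) : star (v ⬝ᵥ w) = star v ⬝ᵥ star w := by
  simp [Matrix.vec3_dotProduct]

theorem star_cv {n : ℕ} (x : Fin n → ℝ) : star (cv x) = cv x := by
  ext i; simp [cv]

theorem star_rot (s c : ℂ) (j v : Fin 3 → ℂ) :
    star (rot s c j v) = rot (star s) (star c) (star j) (star v) := by
  simp only [rot_apply, star_add, star_smul, star_cross]

theorem star_nrot (s c d : ℂ) (j v : Fin 3 → ℂ) :
    star (nrot s c d j v) = nrot (star s) (star c) (star d) (star j) (star v) := by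
  simp only [nrot_apply, star_add, star_smul, star_cross, star_dot, star_mul']

/-- For real j the coefficient s at time i is imaginary and c is real, so conjugation reverses the
time. -/
theorem star_rotFlow_I (j : Fin 3 → ℝ) (v : Fin 3 → ℂ) :
    star (rotFlow Complex.I (cv j) v) = rotFlow (-Complex.I) (cv j) (star v) := by
  rw [rotFlow, star_rot, star_cv, cv_dot, cs_I, cc_I, rotFlow, cv_dot, cs_neg, cc_neg, cs_I, cc_I]
  simp

theorem star_rotInt_I (j : Fin 3 → ℝ) (v : Fin 3 → ℂ) :
    star (rotInt Complex.I (cv j) v) = rotInt (-Complex.I) (cv j) (star v) := by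
  rw [rotInt, star_nrot, star_cv, cv_dot, cs_I, cc_I, cd_I, rotInt, cv_dot, cs_neg, cc_neg, cd_neg,
    cs_I, cc_I, cd_I]
  simp

/-- The complex linear extension of the differential of the conjugate of `aMap`. -/
def conjDeriv (r B : ℝ) (z : W 3) : WC 3 →ₗ[ℂ] (Fin 3 → ℂ) where
  toFun w := rotInt (-Complex.I) (angVelC r B z)
      (angVelDeriv (r : ℂ) B (cv z.1) (cv z.2) w) ⨯₃ star (aMap r B z) +
    rotFlow (-Complex.I) (angVelC r B z) w.1
  map_add' v w := by
    have : angVelDeriv (r : ℂ) B (cv z.1) (cv z.2) (v + w) =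
        angVelDeriv (r : ℂ) B (cv z.1) (cv z.2) v + angVelDeriv (r : ℂ) B (cv z.1) (cv z.2) w := by
      simp only [angVelDeriv, Prod.fst_add, Prod.snd_add, map_add, LinearMap.add_apply]
      module
    rw [this]
    simp only [Prod.fst_add, map_add, LinearMap.add_apply]
    abel
  map_smul' c w := by
    have : angVelDeriv (r : ℂ) B (cv z.1) (cv z.2) (c • w) =
        c • angVelDeriv (r : ℂ) B (cv z.1) (cv z.2) w := by
      simp only [angVelDeriv, Prod.smul_fst, Prod.smul_snd, map_smul, LinearMap.smul_apply]
      module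
    rw [this]
    simp only [Prod.smul_fst, map_smul, LinearMap.smul_apply, RingHom.id_apply, smul_add]

theorem conjDeriv_cvW (r B : ℝ) (z v : W 3) :
    conjDeriv r B z (cvW v) = star (fderiv ℝ (aMap r B) z v) := by
  rw [fderiv_aMap, star_add, star_cross, angVelC, star_rotFlow_I, star_rotInt_I, star_cv, star_cv,
    cv_angVelDeriv]
  rfl

theorem star_aMap (r B : ℝ) (z : W 3) :
    star (aMap r B z) = rotFlow (-Complex.I) (angVelC r B z) (cv z.1) := by
  change star (rotFlow Complex.I (cv _) (cv z.1)) = _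
  rw [star_rotFlow_I, star_cv]
  rfl

theorem conjDeriv_param (hr : 0 < r) (hz : z ∈ (sphere r B).carrier) (ξ : Fin 3 → ℂ)
    {b : Fin 3 → ℂ} (hb : b ⬝ᵥ cv z.1 = 0) :
    conjDeriv r B z (ξ ⨯₃ cv z.1, b ⨯₃ cv z.1 + ξ ⨯₃ cv z.2) =
      (ξ + rotInt (-Complex.I) (angVelC r B z) b) ⨯₃ star (aMap r B z) := by
  have hr' : (r : ℂ) ≠ 0 := Complex.ofReal_ne_zero.2 hr.ne'
  change rotInt _ _ _ ⨯₃ _ + rotFlow _ _ (ξ ⨯₃ cv z.1) = _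
  rw [angVelDeriv_tangent ξ b hr' (cv_carrier hz).1 hb, ← cv_angVel, star_aMap]
  exact flow_deriv_tangent (coeff_rel _ _) _ ξ b (cv z.1)

theorem rotInt_neg (σ : ℂ) (j b : Fin 3 → ℂ) :
    rotInt (-σ) j b = -nrot (cs σ (j ⬝ᵥ j)) (-cc σ (j ⬝ᵥ j)) (cd σ (j ⬝ᵥ j)) j b := by
  rw [rotInt, cs_neg, cc_neg, cd_neg, nrot_neg_all]

/-- The right side says that w is annihilated by the complex linear differential of the conjugate of
a, the base point at time -i. On parameters this is (ξ - M b) × conj a = 0, the condition of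
`mem_frame_of_cross`. -/
theorem mem_contP_I_iff (hr : 0 < r) (hz : z ∈ (sphere r B).carrier) {w : WC 3}
    (hw : w ∈ (sphere r B).tangentC z) :
    w ∈ contP r B z Complex.I ↔
      fderiv ℝ (aMap r B) z (reW w) = Complex.I • fderiv ℝ (aMap r B) z (imW w) := by
  have hr' : (r : ℂ) ≠ 0 := Complex.ofReal_ne_zero.2 hr.ne'
  obtain ⟨hx, hxp⟩ := cv_carrier hz
  have h1 : conjDeriv r B z w = star (fderiv ℝ (aMap r B) z (reW w) -
      Complex.I • fderiv ℝ (aMap r B) z (imW w)) := by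
    conv_lhs => rw [← cplx_reW_imW w, map_add, map_smul, conjDeriv_cvW, conjDeriv_cvW]
    rw [star_sub, star_smul]
    simp
  rw [← sub_eq_zero, ← star_eq_zero, ← h1, mem_contP]
  constructor
  · rintro ⟨b, hb, rfl⟩
    rw [frameC, frame_apply, conjDeriv_param hr hz _ hb, rotInt_neg, add_neg_cancel]
    simp
  · intro h0
    obtain ⟨ξ, b, hb, rfl⟩ := tangent_param hr' hx (mem_tangentC_sphere.1 hw).1
      (mem_tangentC_sphere.1 hw).2
    rw [conjDeriv_param hr hz _ hb, rotInt_neg, ← sub_eq_add_neg, star_aMap] at h0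
    refine mem_frame_of_cross (coeff_rel _ _) _ hr' hx hxp (angVelC_cross hr hz) hb ?_
    rw [← h0, rotFlow, cs_neg, cc_neg]

/-- The hermitian form of the magnetic Kähler structure is positive definite. -/
theorem hermitian_pos {j b₁ b₂ : Fin 3 → ℝ} (hb : b₁ ≠ 0 ∨ b₂ ≠ 0) {u : ℝ} (hu : u = j ⬝ᵥ j) :
    0 < hs u * (1 + hc u * u) * (b₁ ⬝ᵥ b₁ + b₂ ⬝ᵥ b₂) -
      (hd u + hs u * hc u) * ((j ⬝ᵥ b₁) ^ 2 + (j ⬝ᵥ b₂) ^ 2) -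
      2 * hs u ^ 2 * (j ⬝ᵥ (b₁ ⨯₃ b₂)) := by
  have hn : 0 < b₁ ⬝ᵥ b₁ + b₂ ⬝ᵥ b₂ := by
    have h1 := dot_self_nonneg_real b₁
    have h2 := dot_self_nonneg_real b₂
    rcases hb with hb | hb
    · have : b₁ ⬝ᵥ b₁ ≠ 0 := fun h => hb (dotProduct_self_eq_zero.1 h)
      positivity
    · have : b₂ ⬝ᵥ b₂ ≠ 0 := fun h => hb (dotProduct_self_eq_zero.1 h)
      positivity
  have hu0 : 0 ≤ u := hu ▸ dot_self_nonneg_real j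
  have hS := one_le_hs hu0
  have hC := hc_pos hu0
  rcases hu0.eq_or_lt with h0 | hpos
  · have hj : j = 0 := dotProduct_self_eq_zero.1 (by rw [← hu, ← h0])
    subst hj
    rw [← h0] at hS ⊢
    simp only [zero_dotProduct]
    nlinarith
  · obtain ⟨L, hL, rfl⟩ : ∃ L : ℝ, 0 < L ∧ u = L ^ 2 :=
      ⟨√u, Real.sqrt_pos.2 hpos, (Real.sq_sqrt hpos.le).symm⟩
    have e1 := mul_hs_sq L
    have e2 := sq_mul_hc_sq L
    have e3 := mul_hd (L ^ 2)
    have e4 : 0 < Real.cosh L - Real.sinh L := by rw [Real.cosh_sub_sinh]; positivity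
    set S := hs (L ^ 2)
    set C := hc (L ^ 2)
    set D := hd (L ^ 2)
    set n := b₁ ⬝ᵥ b₁ + b₂ ⬝ᵥ b₂ with hndef
    set m := (j ⬝ᵥ b₁) ^ 2 + (j ⬝ᵥ b₂) ^ 2 with hm
    set τ := j ⬝ᵥ (b₁ ⨯₃ b₂) with hτ
    have hm0 : 0 ≤ m := by positivity
    -- L² n - m is the squared length of the part of (b₁, b₂) orthogonal to j, scaled by |j|² = L².
    have hP : L ^ 2 * n - m = (j ⨯₃ b₁) ⬝ᵥ (j ⨯₃ b₁) + (j ⨯₃ b₂) ⬝ᵥ (j ⨯₃ b₂) := by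
      rw [hu]
      simp only [n, m, Matrix.vec3_dotProduct, cross_zero, cross_one, cross_two]
      ring
    have hP0 : 0 ≤ L ^ 2 * n - m := by
      rw [hP]
      exact add_nonneg (dot_self_nonneg_real _) (dot_self_nonneg_real _)
    -- The square of L (j × b₁) + j × (j × b₂) controls the only term without a sign, the triple
    -- product τ.
    have hsos : 0 ≤ L ^ 2 * (L ^ 2 * n - m) - 2 * L * (L ^ 2 * τ) := by
      have h := dot_self_nonneg_real (L • (j ⨯₃ b₁) + j ⨯₃ (j ⨯₃ b₂))
      have e : (L • (j ⨯₃ b₁) + j ⨯₃ (j ⨯₃ b₂)) ⬝ᵥ (L • (j ⨯₃ b₁) + j ⨯₃ (j ⨯₃ b₂)) =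
          L ^ 2 * ((j ⨯₃ b₁) ⬝ᵥ (j ⨯₃ b₁)) + (j ⬝ᵥ j) * ((j ⨯₃ b₂) ⬝ᵥ (j ⨯₃ b₂)) -
            2 * L * ((j ⬝ᵥ j) * τ) := by
        simp only [τ, Matrix.vec3_dotProduct, cross_zero, cross_one, cross_two, Pi.add_apply,
          Pi.smul_apply, smul_eq_mul]
        ring
      rw [e, ← hu] at h
      rw [hP]
      linarith
    have hkey : 2 * (L ^ 2 * τ) ≤ L * (L ^ 2 * n - m) := by
      have : 0 ≤ L * (L * (L ^ 2 * n - m) - 2 * (L ^ 2 * τ)) := by linarith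
      linarith [nonneg_of_mul_nonneg_right this hL]
    have hch : S * L = Real.sinh L := by linarith
    -- The bound on τ costs S² L = S sinh L per unit of L² n - m, against S cosh L available; what
    -- remains is positive since sinh < cosh. The term m covers vectors parallel to j.
    have hlow : S * (Real.cosh L - Real.sinh L) * (L ^ 2 * n - m) + m ≤
        L ^ 2 * (S * (1 + C * L ^ 2) * n - (D + S * C) * m - 2 * S ^ 2 * τ) := by
      have h1 : L ^ 2 * (S * (1 + C * L ^ 2) * n - (D + S * C) * m - 2 * S ^ 2 * τ) =
          S * Real.cosh L * (L ^ 2 * n - m) + m - S ^ 2 * (2 * (L ^ 2 * τ)) := by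
        linear_combination (S * L ^ 2 * n - S * m) * e2 - m * e3
      rw [h1]
      have h2 := mul_le_mul_of_nonneg_left hkey (sq_nonneg S)
      have h3 : S ^ 2 * (L * (L ^ 2 * n - m)) = S * Real.sinh L * (L ^ 2 * n - m) := by
        rw [← hch]; ring
      linarith
    have hκ : 0 < S * (Real.cosh L - Real.sinh L) := mul_pos (by linarith) e4
    have hgt : 0 < S * (Real.cosh L - Real.sinh L) * (L ^ 2 * n - m) + m := by
      rcases hm0.eq_or_lt with h | h
      · rw [← h]
        have : 0 < L ^ 2 * n := by positivity
        have := mul_pos hκ this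
        linarith
      · have := mul_nonneg hκ.le hP0
        linarith
    exact pos_of_mul_pos_right (hgt.trans_le hlow) (by positivity)

theorem hermitian_identity {S C D : ℝ} (j b₁ b₂ : Fin 3 → ℝ) (h : S ^ 2 = 2 * C + (j ⬝ᵥ j) * C ^ 2) :
    ((-(S • b₂) + C • (j ⨯₃ b₁) + (D * (j ⬝ᵥ b₂)) • j) ⨯₃
        (S • b₁ + C • (j ⨯₃ b₂) - (D * (j ⬝ᵥ b₁)) • j)) ⬝ᵥ j +
      (-(S • b₂) + C • (j ⨯₃ b₁) + (D * (j ⬝ᵥ b₂)) • j) ⬝ᵥ b₂ -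
      (S • b₁ + C • (j ⨯₃ b₂) - (D * (j ⬝ᵥ b₁)) • j) ⬝ᵥ b₁ =
    -(S * (1 + C * (j ⬝ᵥ j)) * (b₁ ⬝ᵥ b₁ + b₂ ⬝ᵥ b₂) -
      (D + S * C) * ((j ⬝ᵥ b₁) ^ 2 + (j ⬝ᵥ b₂) ^ 2) - 2 * S ^ 2 * (j ⬝ᵥ (b₁ ⨯₃ b₂))) := by
  simp only [Matrix.vec3_dotProduct, cross_zero, cross_one, cross_two, Pi.add_apply,
    Pi.sub_apply, Pi.neg_apply, Pi.smul_apply, smul_eq_mul] at h ⊢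
  linear_combination (-(j 0 * (b₁ 1 * b₂ 2 - b₁ 2 * b₂ 1) + j 1 * (b₁ 2 * b₂ 0 - b₁ 0 * b₂ 2) +
    j 2 * (b₁ 0 * b₂ 1 - b₁ 1 * b₂ 0))) * h

/-- The sign is negative because a (1,0)-vector is v - i J v, whose imaginary part is -J v. The
value is -r² times the quantity of `hermitian_pos`. -/
theorem form_frame_pos (hr : 0 < r) (hz : z ∈ (sphere r B).carrier) {b : Fin 3 → ℂ}
    (hb : b ⬝ᵥ cv z.1 = 0) (hb0 : b ≠ 0) :
    (sphere r B).form z (reW (frameC r B Complex.I z b)) (imW (frameC r B Complex.I z b)) < 0 := by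
  set j := angVel r B z.1 z.2 with hj
  set u := j ⬝ᵥ j with hu
  set b₁ := reV b with hb₁
  set b₂ := imV b with hb₂
  have hb1 : b₁ ⬝ᵥ z.1 = 0 := by rw [hb₁, reV_dot, hb, Complex.zero_re]
  have hb2 : b₂ ⬝ᵥ z.1 = 0 := by rw [hb₂, imV_dot, hb, Complex.zero_im]
  set ξ₁ : Fin 3 → ℝ := -(hs u • b₂) + hc u • (j ⨯₃ b₁) + (hd u * (j ⬝ᵥ b₂)) • j with hξ₁
  set ξ₂ : Fin 3 → ℝ := hs u • b₁ + hc u • (j ⨯₃ b₂) - (hd u * (j ⬝ᵥ b₁)) • j with hξ₂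
  have hbe : b = cv b₁ + Complex.I • cv b₂ := (cv_reV_imV b).symm
  have hM : nrot (cs Complex.I u) (-cc Complex.I u) (cd Complex.I u) (cv j) b =
      cv ξ₁ + Complex.I • cv ξ₂ := by
    rw [cs_I, cc_I, cd_I, hbe, nrot_apply]
    simp only [ξ₁, ξ₂, cv_add, cv_sub, cv_smul, cv_cross, map_add, map_smul, dotProduct_add,
      dotProduct_smul, cv_dot, Complex.ofReal_mul, smul_eq_mul,
      show ∀ v : Fin 3 → ℝ, cv (-v) = -cv v from fun v => by ext i; simp [cv]]
    have hI : Complex.I * Complex.I = -1 := Complex.I_mul_I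
    apply funext
    intro i
    simp only [Pi.add_apply, Pi.sub_apply, Pi.neg_apply, Pi.smul_apply, smul_eq_mul]
    linear_combination ((hs u : ℂ) * cv b₂ i - (hd u : ℂ) * ((j ⬝ᵥ b₂ : ℝ) : ℂ) * cv j i) * hI
  have hframe : frameC r B Complex.I z b =
      cvW (ξ₁ ⨯₃ z.1, b₁ ⨯₃ z.1 + ξ₁ ⨯₃ z.2) +
        Complex.I • cvW (ξ₂ ⨯₃ z.1, b₂ ⨯₃ z.1 + ξ₂ ⨯₃ z.2) := by
    rw [frameC, frame_apply, angVelC, cv_dot, hM, hbe]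
    simp only [cvW, cv_add, cv_cross, map_add, map_smul, LinearMap.add_apply,
      LinearMap.smul_apply]
    ext1
    · rfl
    · simp only [Prod.snd_add, Prod.smul_snd]
      module
  rw [hframe, reW_cplx, imW_cplx]
  have hform := form_param (B := B) (x := z.1) (p := z.2) (ξ := ξ₁) (ξ' := ξ₂) hr.ne' hz.1 hb1 hb2
  change (ξ₁ ⨯₃ z.1) ⬝ᵥ (b₂ ⨯₃ z.1 + ξ₂ ⨯₃ z.2) - (ξ₂ ⨯₃ z.1) ⬝ᵥ (b₁ ⨯₃ z.1 + ξ₁ ⨯₃ z.2) -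
    B / r * (z.1 ⬝ᵥ ((ξ₁ ⨯₃ z.1) ⨯₃ (ξ₂ ⨯₃ z.1))) < 0
  rw [hform, ← hj]
  have hpos := hermitian_pos (j := j) (b₁ := b₁) (b₂ := b₂) (by
    by_contra! h
    apply hb0
    rw [hbe, h.1, h.2, cv_zero, smul_zero, add_zero]) hu
  have hS := hs_sq u
  have e : (ξ₁ ⨯₃ ξ₂) ⬝ᵥ j + ξ₁ ⬝ᵥ b₂ - ξ₂ ⬝ᵥ b₁ =
      -(hs u * (1 + hc u * u) * (b₁ ⬝ᵥ b₁ + b₂ ⬝ᵥ b₂) -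
      (hd u + hs u * hc u) * ((j ⬝ᵥ b₁) ^ 2 + (j ⬝ᵥ b₂) ^ 2) -
      2 * hs u ^ 2 * (j ⬝ᵥ (b₁ ⨯₃ b₂))) := by
    exact hermitian_identity j b₁ b₂ hS
  rw [e, mul_neg]
  exact neg_neg_of_pos (mul_pos (by positivity) hpos)

end SphereComplexStructure

theorem finrank_ker_dot {y : Fin 3 → ℂ} (hy : y ≠ 0) :
    Module.finrank ℝ (LinearMap.ker ((dotProductBilin ℂ ℂ y).restrictScalars ℝ :
      (Fin 3 → ℂ) →ₗ[ℝ] ℂ)) = 4 := by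
  have h0 : (dotProductBilin ℂ ℂ y : Module.Dual ℂ (Fin 3 → ℂ)) ≠ 0 := by
    intro h
    apply hy
    exact dotProduct_eq_zero y fun w => LinearMap.congr_fun h w
  have h1 := Module.Dual.finrank_ker_add_one_of_ne_zero h0
  rw [Module.finrank_fin_fun] at h1
  have h2 : Module.finrank ℝ (LinearMap.ker (dotProductBilin ℂ ℂ y :
    Module.Dual ℂ (Fin 3 → ℂ))) = 4 := by
    rw [finrank_real_of_complex]; omega
  exact h2

/-! ### The complex structure operator and the Kähler conditions -/

section SphereKahler

variable {r B : ℝ} {z : W 3}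

theorem finrank_tangent_sphere (hr : 0 < r) (hz : z ∈ (sphere r B).carrier) :
    Module.finrank ℝ ((sphere r B).tangent z) = 4 := by
  have hr2 : r ^ 2 ≠ 0 := pow_ne_zero 2 hr.ne'
  let f : W 3 →ₗ[ℝ] ℝ × ℝ :=
    { toFun := fun v => (z.1 ⬝ᵥ v.1, v.1 ⬝ᵥ z.2 + z.1 ⬝ᵥ v.2)
      map_add' := fun v w => by
        simp only [Prod.fst_add, Prod.snd_add, dotProduct_add, add_dotProduct, Prod.mk_add_mk]
        ext1
        · simp only
        · simp only
          ring
      map_smul' := fun c v => by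
        simp only [Prod.smul_fst, Prod.smul_snd, dotProduct_smul, smul_dotProduct, smul_eq_mul,
          RingHom.id_apply, Prod.smul_mk]
        ext1
        · simp only
        · simp only
          ring }
  have hker : LinearMap.ker f = (sphere r B).tangent z := by
    ext v
    exact Prod.ext_iff
  have hrange : LinearMap.range f = ⊤ := by
    rw [LinearMap.range_eq_top]
    rintro ⟨s, t⟩
    refine ⟨((s / r ^ 2) • z.1, (t / r ^ 2) • z.1), ?_⟩
    change ((_ : ℝ), (_ : ℝ)) = _
    simp only [dotProduct_smul, smul_dotProduct, hz.1, hz.2, smul_eq_mul, mul_zero, zero_add,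
      div_mul_cancel₀ _ hr2]
  have h := f.finrank_range_add_finrank_ker
  rw [hker, hrange, finrank_top, Module.finrank_prod, Module.finrank_prod,
    Module.finrank_fin_fun, Module.finrank_self] at h
  omega

theorem aMap_dot (hz : z ∈ (sphere r B).carrier) : aMap r B z ⬝ᵥ aMap r B z = (r : ℂ) ^ 2 :=
  (dot_rot (coeff_rel _ _) _ _).trans (cv_carrier hz).1

theorem complex_mem_tangentC {a b : W 3} (ha : a ∈ (sphere r B).tangent z)
    (hb : b ∈ (sphere r B).tangent z) :
    cvW a + Complex.I • cvW b ∈ (sphere r B).tangentC z := by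
  change reW _ ∈ _ ∧ imW _ ∈ _
  rw [reW_cplx, imW_cplx]
  exact ⟨ha, hb⟩

/-- A real tangent vector killed by da lies in P(i) with zero imaginary part, so the form pairs its
real and imaginary parts to 0; by `form_frame_pos` its frame parameter is 0. -/
theorem fderiv_aMap_injective (hr : 0 < r) (hz : z ∈ (sphere r B).carrier) {v : W 3}
    (hv : v ∈ (sphere r B).tangent z) (h0 : fderiv ℝ (aMap r B) z v = 0) : v = 0 := by
  have h1 : cvW v + Complex.I • cvW 0 ∈ contP r B z Complex.I := by
    rw [mem_contP_I_iff hr hz (complex_mem_tangentC hv (Submodule.zero_mem _)), reW_cplx, imW_cplx,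
      h0, map_zero, smul_zero]
  obtain ⟨b, hb, h⟩ := mem_contP.1 h1
  by_cases hb0 : b = 0
  · rw [hb0, map_zero] at h
    have h2 := reW_cplx v 0
    rw [← h] at h2
    rw [← h2]
    ext i <;> simp [reW]
  · have h2 := form_frame_pos hr hz hb hb0
    rw [h, reW_cplx, imW_cplx] at h2
    simp [sphere] at h2

theorem fderiv_aMap_dot (hr : 0 < r) (hz : z ∈ (sphere r B).carrier) {v : W 3}
    (hv : v ∈ (sphere r B).tangent z) : aMap r B z ⬝ᵥ fderiv ℝ (aMap r B) z v = 0 := by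
  have hr' : (r : ℂ) ≠ 0 := Complex.ofReal_ne_zero.2 hr.ne'
  have h1 := complex_mem_tangentC hv (Submodule.zero_mem ((sphere r B).tangent z))
  have h2 : cvW v + Complex.I • cvW 0 = cvW v := by
    have : (cvW 0 : WC 3) = 0 := by simp [cvW, cv_zero]
    rw [this, smul_zero, add_zero]
  rw [h2, mem_tangentC_sphere] at h1
  obtain ⟨ξ, b, hb, h⟩ := tangent_param hr' (cv_carrier hz).1 h1.1 h1.2
  have h3 := conjDeriv_cvW r B z v
  rw [h, conjDeriv_param hr hz _ hb] at h3
  rw [← star_eq_zero, star_dot, ← h3, dot_cross_self]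

theorem injective_aMap_domRestrict (hr : 0 < r) (hz : z ∈ (sphere r B).carrier) :
    Function.Injective ((fderiv ℝ (aMap r B) z : W 3 →ₗ[ℝ] (Fin 3 → ℂ)).domRestrict
      ((sphere r B).tangent z)) := by
  rw [← LinearMap.ker_eq_bot, LinearMap.ker_eq_bot']
  exact fun v h => Subtype.ext (fderiv_aMap_injective hr hz v.2 h)

/-- Both sides have real dimension 4. The right side is closed under multiplication by i, so this
multiplication can be pulled back. -/
theorem map_tangent_sphere (hr : 0 < r) (hz : z ∈ (sphere r B).carrier) :
    ((sphere r B).tangent z).map (fderiv ℝ (aMap r B) z : W 3 →ₗ[ℝ] (Fin 3 → ℂ)) =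
      LinearMap.ker ((dotProductBilin ℂ ℂ (aMap r B z)).restrictScalars ℝ :
        (Fin 3 → ℂ) →ₗ[ℝ] ℂ) := by
  have ha : aMap r B z ≠ 0 := by
    intro h
    have := aMap_dot hz
    rw [h, zero_dotProduct] at this
    exact pow_ne_zero 2 (Complex.ofReal_ne_zero.2 hr.ne') this.symm
  apply Submodule.eq_of_le_of_finrank_eq
  · rintro _ ⟨v, hv, rfl⟩
    exact fderiv_aMap_dot hr hz hv
  · rw [finrank_ker_dot ha, ← LinearMap.range_domRestrict,
      LinearMap.finrank_range_of_inj (injective_aMap_domRestrict hr hz),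
      finrank_tangent_sphere hr hz]

theorem exists_complex_operator (hr : 0 < r) (hz : z ∈ (sphere r B).carrier) :
    ∃ J : W 3 →ₗ[ℝ] W 3, ∀ v ∈ (sphere r B).tangent z, J v ∈ (sphere r B).tangent z ∧
      fderiv ℝ (aMap r B) z (J v) = Complex.I • fderiv ℝ (aMap r B) z v := by
  obtain ⟨h, hh⟩ := LinearMap.exists_leftInverse_of_injective _
    (LinearMap.ker_eq_bot.2 (injective_aMap_domRestrict hr hz))
  refine ⟨(Submodule.subtype _ ∘ₗ h) ∘ₗ
    (LinearMap.lsmul ℂ (Fin 3 → ℂ) Complex.I).restrictScalars ℝ ∘ₗ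
      (fderiv ℝ (aMap r B) z : W 3 →ₗ[ℝ] (Fin 3 → ℂ)), fun v hv => ?_⟩
  have h1 : Complex.I • fderiv ℝ (aMap r B) z v ∈
      ((sphere r B).tangent z).map (fderiv ℝ (aMap r B) z : W 3 →ₗ[ℝ] (Fin 3 → ℂ)) := by
    rw [map_tangent_sphere hr hz]
    change aMap r B z ⬝ᵥ (Complex.I • fderiv ℝ (aMap r B) z v) = (0 : ℂ)
    rw [dotProduct_smul, fderiv_aMap_dot hr hz hv, smul_zero]
  obtain ⟨w, hw, hwv⟩ := h1
  have h2 : h (Complex.I • fderiv ℝ (aMap r B) z v) = ⟨w, hw⟩ := by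
    rw [← hwv]
    exact LinearMap.congr_fun hh ⟨w, hw⟩
  change ((h (Complex.I • fderiv ℝ (aMap r B) z v) : _) : W 3) ∈ _ ∧
    fderiv ℝ (aMap r B) z (h (Complex.I • fderiv ℝ (aMap r B) z v)) = _
  rw [h2]
  exact ⟨hw, hwv⟩

open Classical in
/-- The magnetic complex structure of the sphere. -/
def sphereJ (r B : ℝ) (z : W 3) : W 3 →ₗ[ℝ] W 3 :=
  if h : ∃ J : W 3 →ₗ[ℝ] W 3, ∀ v ∈ (sphere r B).tangent z, J v ∈ (sphere r B).tangent z ∧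
    fderiv ℝ (aMap r B) z (J v) = Complex.I • fderiv ℝ (aMap r B) z v then h.choose else 0

theorem sphereJ_spec (hr : 0 < r) (hz : z ∈ (sphere r B).carrier) {v : W 3}
    (hv : v ∈ (sphere r B).tangent z) : sphereJ r B z v ∈ (sphere r B).tangent z ∧
      fderiv ℝ (aMap r B) z (sphereJ r B z v) = Complex.I • fderiv ℝ (aMap r B) z v := by
  have h := exists_complex_operator hr hz
  rw [sphereJ, dif_pos h]
  exact h.choose_spec v hv

theorem eq_of_fderiv_aMap_eq (hr : 0 < r) (hz : z ∈ (sphere r B).carrier) {v w : W 3}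
    (hv : v ∈ (sphere r B).tangent z) (hw : w ∈ (sphere r B).tangent z)
    (h : fderiv ℝ (aMap r B) z v = fderiv ℝ (aMap r B) z w) : v = w :=
  sub_eq_zero.1 (fderiv_aMap_injective hr hz (Submodule.sub_mem _ hv hw)
    (by rw [map_sub, h, sub_self]))

theorem sphereJ_sphereJ (hr : 0 < r) (hz : z ∈ (sphere r B).carrier) {v : W 3}
    (hv : v ∈ (sphere r B).tangent z) : sphereJ r B z (sphereJ r B z v) = -v := by
  obtain ⟨h1, h2⟩ := sphereJ_spec hr hz hv
  obtain ⟨h3, h4⟩ := sphereJ_spec hr hz h1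
  refine eq_of_fderiv_aMap_eq hr hz h3 (Submodule.neg_mem _ hv) ?_
  rw [h4, h2, smul_smul, Complex.I_mul_I, map_neg, neg_one_smul]

theorem type10_sphereJ (hr : 0 < r) (hz : z ∈ (sphere r B).carrier) :
    (contP r B z Complex.I : Set (WC 3)) = (sphere r B).type10 (sphereJ r B) z := by
  ext w
  suffices h : w ∈ (sphere r B).tangentC z → (w ∈ contP r B z Complex.I ↔
      cplx (sphereJ r B z (reW w)) (sphereJ r B z (imW w)) = Complex.I • w) by
    constructor
    · intro hw
      have := (isLagrangian_contP hr hz Complex.I).1 hw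
      exact ⟨this, (h this).1 hw⟩
    · rintro ⟨hw, h'⟩
      exact (h hw).2 h'
  intro hw
  rw [mem_contP_I_iff hr hz hw]
  obtain ⟨ha, hb⟩ : reW w ∈ _ ∧ imW w ∈ _ := hw
  rw [← cplx_reW_imW w, reW_cplx, imW_cplx]
  set a := reW w
  set b := imW w
  have e : Complex.I • (cvW a + Complex.I • cvW b) = cvW (-b) + Complex.I • cvW a := by
    have : cvW (-b) = -cvW b := by simp only [cvW]; ext i <;> simp [cv]
    rw [smul_add, smul_smul, Complex.I_mul_I, this, neg_one_smul, add_comm]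
  obtain ⟨h1, h2⟩ := sphereJ_spec hr hz hb
  rw [e, ← h2]
  constructor
  · intro h
    have hab := eq_of_fderiv_aMap_eq hr hz ha h1 h
    have hba : sphereJ r B z a = -b := by rw [hab, sphereJ_sphereJ hr hz hb]
    rw [hba, ← hab]
    rfl
  · intro h
    have := congrArg imW (show cvW _ + Complex.I • cvW _ = _ from h)
    rw [imW_cplx, imW_cplx] at this
    rw [this]

theorem holomorphic_vector_mem (hr : 0 < r) (hz : z ∈ (sphere r B).carrier) {v : W 3}
    (hv : v ∈ (sphere r B).tangent z) :
    cvW v + Complex.I • cvW (-sphereJ r B z v) ∈ contP r B z Complex.I := by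
  obtain ⟨h1, h2⟩ := sphereJ_spec hr hz hv
  rw [mem_contP_I_iff hr hz (complex_mem_tangentC hv (Submodule.neg_mem _ h1)), reW_cplx, imW_cplx,
    map_neg, h2, smul_neg, smul_smul, Complex.I_mul_I, neg_one_smul, neg_neg]

/-- The vectors v - i J v and w - i J w lie in the Lagrangian space P(i); the real part of their
vanishing pairing is ω(v, w) - ω(J v, J w). -/
theorem form_sphereJ (hr : 0 < r) (hz : z ∈ (sphere r B).carrier) {v w : W 3}
    (hv : v ∈ (sphere r B).tangent z) (hw : w ∈ (sphere r B).tangent z) :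
    (sphere r B).form z (sphereJ r B z v) (sphereJ r B z w) = (sphere r B).form z v w := by
  have hV := holomorphic_vector_mem hr hz hv
  have hW := holomorphic_vector_mem hr hz hw
  obtain ⟨h1, h2⟩ := isLagrangian_contP hr hz Complex.I
  have h := congrArg Complex.re ((h2 _ (h1 hV)).1 hV _ hW)
  rw [PhaseSpace.formC, reW_cplx, imW_cplx, reW_cplx, imW_cplx] at h
  simp only [Complex.add_re, Complex.ofReal_re, Complex.mul_re, Complex.I_re, Complex.I_im,
    Complex.ofReal_im, zero_mul, mul_zero, sub_zero, add_zero, Complex.zero_re] at h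
  have hneg : (sphere r B).form z (-sphereJ r B z v) (-sphereJ r B z w) =
      (sphere r B).form z (sphereJ r B z v) (sphereJ r B z w) := by
    simp [sphere]
  rw [hneg] at h
  linarith

theorem form_sphereJ_pos (hr : 0 < r) (hz : z ∈ (sphere r B).carrier) {v : W 3}
    (hv : v ∈ (sphere r B).tangent z) (hv0 : v ≠ 0) :
    0 < (sphere r B).form z v (sphereJ r B z v) := by
  obtain ⟨b, hb, h⟩ := mem_contP.1 (holomorphic_vector_mem hr hz hv)
  have hb0 : b ≠ 0 := by
    rintro rfl
    apply hv0
    rw [map_zero] at h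
    have h2 := reW_cplx v (-sphereJ r B z v)
    rw [← h] at h2
    rw [← h2]
    ext i <;> simp [reW]
  have h2 := form_frame_pos hr hz hb hb0
  rw [h, reW_cplx, imW_cplx] at h2
  have hneg : (sphere r B).form z v (-sphereJ r B z v) =
      -(sphere r B).form z v (sphereJ r B z v) := by
    simp only [sphere, Prod.fst_neg, Prod.snd_neg, dotProduct_neg, neg_dotProduct, map_neg]
    ring
  linarith

theorem triple_eq_zero {x u v w : Fin 3 → ℝ} (hx : x ⬝ᵥ x ≠ 0) (hu : x ⬝ᵥ u = 0) (hv : x ⬝ᵥ v = 0)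
    (hw : x ⬝ᵥ w = 0) : u ⬝ᵥ (v ⨯₃ w) = 0 := by
  have h : (u ⬝ᵥ (v ⨯₃ w)) • x = (x ⬝ᵥ u) • (v ⨯₃ w) + (x ⬝ᵥ v) • (w ⨯₃ u) +
      (x ⬝ᵥ w) • (u ⨯₃ v) := by
    apply ext_fin_three <;>
    simp only [cross_zero, cross_one, cross_two, Matrix.vec3_dotProduct, Pi.smul_apply,
      Pi.add_apply, smul_eq_mul] <;> ring
  rw [hu, hv, hw] at h
  simp only [zero_smul, add_zero] at h
  refine (smul_eq_zero.1 h).resolve_right ?_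
  rintro rfl
  simp at hx

theorem fderiv_form_sphere (r B : ℝ) (z u v w : W 3) :
    fderiv ℝ (fun y => (sphere r B).form y v w) z u = -(B / r * (u.1 ⬝ᵥ (v.1 ⨯₃ w.1))) := by
  have hc : ContDiff ℝ ∞ (fun y : W 3 => (sphere r B).form y v w) :=
    contDiff_const.sub (contDiff_const.mul (ContDiff.dot contDiff_fst contDiff_const))
  refine fderiv_apply_eq_of_line (hc.differentiable (by simp) z) ?_
  have h := (((hasDerivAt_id (0 : ℝ)).mul_const (u.1 ⬝ᵥ (v.1 ⨯₃ w.1))).const_mul (B / r)).const_sub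
    ((sphere r B).form z v w)
  rw [one_mul] at h
  refine h.congr_of_eventuallyEq (Filter.Eventually.of_forall fun t => ?_)
  simp only [sphere, Prod.fst_add, Prod.smul_fst, add_dotProduct, smul_dotProduct, smul_eq_mul, id]
  ring

/-- The canonical part has constant coefficients. The magnetic part contributes triple products of
position components, all orthogonal to x and hence linearly dependent. -/
theorem form_sphere_closed (hr : 0 < r) (hz : z ∈ (sphere r B).carrier) {u v w : W 3}
    (hu : u ∈ (sphere r B).tangent z) (hv : v ∈ (sphere r B).tangent z)
    (hw : w ∈ (sphere r B).tangent z) :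
    fderiv ℝ (fun y => (sphere r B).form y v w) z u +
      fderiv ℝ (fun y => (sphere r B).form y w u) z v +
      fderiv ℝ (fun y => (sphere r B).form y u v) z w = 0 := by
  have hx : z.1 ⬝ᵥ z.1 ≠ 0 := by rw [hz.1]; exact pow_ne_zero 2 hr.ne'
  rw [fderiv_form_sphere, fderiv_form_sphere, fderiv_form_sphere, triple_eq_zero hx hu.1 hv.1 hw.1,
    triple_eq_zero hx hv.1 hw.1 hu.1, triple_eq_zero hx hw.1 hu.1 hv.1]
  simp

theorem isKahler_sphereJ (hr : 0 < r)
    (h : (sphere r B).IsComplexStructure (sphereJ r B)) :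
    (sphere r B).IsKahler (sphereJ r B) :=
  ⟨h, fun _ hz _ hu _ hv _ hw => form_sphere_closed hr hz hu hv hw,
    fun _ hz _ hv _ hw => form_sphereJ hr hz hv hw,
    fun _ hz _ hv hv0 => form_sphereJ_pos hr hz hv hv0⟩

end SphereKahler

/-! ### Inverting |Im a|² as a function of u -/

/-- The squared length of the imaginary part of `aMap`, as a function of the squared angular
velocity. -/
def imSq (r b u : ℝ) : ℝ := r ^ 2 * (hs u ^ 2 * (u - b))

theorem contDiff_imSq (r b : ℝ) : ContDiff ℝ ∞ (imSq r b) :=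
  contDiff_const.mul ((contDiff_hs.pow 2).mul (contDiff_id.sub contDiff_const))

theorem exists_deriv_imSq_pos {r b u : ℝ} (hr : 0 < r) (hb : 0 ≤ b) (hu : b ≤ u) :
    ∃ d, 0 < d ∧ HasDerivAt (imSq r b) d u := by
  have h := (((hasDerivAt_hs u).pow 2).mul ((hasDerivAt_id u).sub_const b)).const_mul (r ^ 2)
  refine ⟨_, ?_, h⟩
  have h1 := one_le_hs (hb.trans hu)
  have h2 : 0 ≤ (hc u - hd u) * (u - b) := by
    rcases (hb.trans hu).eq_or_lt with h0 | h0
    · have : u - b = 0 := by linarith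
      rw [this, mul_zero]
    · exact mul_nonneg (sub_nonneg.2 (hd_le_hc h0)) (sub_nonneg.2 hu)
  have h3 : 0 < hs u ^ 2 + hs u * ((hc u - hd u) * (u - b)) :=
    add_pos_of_pos_of_nonneg (by positivity) (mul_nonneg (by linarith) h2)
  refine mul_pos (by positivity) (h3.trans_eq ?_)
  simp
  ring

theorem strictMonoOn_imSq {r b : ℝ} (hr : 0 < r) (hb : 0 ≤ b) :
    StrictMonoOn (imSq r b) (Set.Ici b) := by
  refine strictMonoOn_of_deriv_pos (convex_Ici b) (contDiff_imSq r b).continuous.continuousOn ?_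
  intro u hu
  rw [interior_Ici] at hu
  obtain ⟨d, hd, h⟩ := exists_deriv_imSq_pos hr hb (le_of_lt hu)
  rwa [h.deriv]

theorem image_imSq {r b : ℝ} (hr : 0 < r) (hb : 0 ≤ b) :
    imSq r b '' Set.Ici b = Set.Ici 0 := by
  have h0 : imSq r b b = 0 := by simp [imSq]
  apply Set.Subset.antisymm
  · rintro _ ⟨u, hu, rfl⟩
    rw [Set.mem_Ici, ← h0]
    exact (strictMonoOn_imSq hr hb).monotoneOn Set.self_mem_Ici hu hu
  · intro t ht
    have ht' : (0 : ℝ) ≤ t := ht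
    -- Chosen so that r² (c - b) = t; since `hs` is at least 1, `imSq` has reached t by c.
    set c := b + t / r ^ 2 with hc'
    have hbc : b ≤ c := le_add_of_nonneg_right (by positivity)
    have hc1 := one_le_hs (hb.trans hbc)
    have htc : t ≤ imSq r b c := by
      have e : imSq r b c = hs c ^ 2 * t := by
        rw [imSq, hc']
        field_simp
        ring
      rw [e]
      exact le_mul_of_one_le_left ht' (one_le_pow₀ hc1)
    obtain ⟨u, hu, rfl⟩ := intermediate_value_Icc hbc
      (contDiff_imSq r b).continuous.continuousOn ⟨h0.trans_le ht', htc⟩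
    exact ⟨u, hu.1, rfl⟩

/-- The order isomorphism gives a continuous inverse. `imSq` is smooth on all of ℝ with positive
derivative even at the endpoint b, so a smooth local inverse agrees with it there too; the endpoint,
where p = 0, needs no special treatment. -/
theorem exists_inverse_imSq {r b : ℝ} (hr : 0 < r) (hb : 0 ≤ b) :
    ∃ g : ℝ → ℝ, ContDiffOn ℝ ∞ g (Set.Ici 0) ∧ (∀ t, 0 ≤ t → b ≤ g t ∧ imSq r b (g t) = t) ∧
      ∀ u, b ≤ u → g (imSq r b u) = u := by
  have hmono := strictMonoOn_imSq hr hb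
  let e : Set.Ici b ≃o Set.Ici (0 : ℝ) :=
    (hmono.orderIso (imSq r b) (Set.Ici b)).trans (OrderIso.setCongr _ _ (image_imSq hr hb))
  have he : ∀ u : Set.Ici b, (e u : ℝ) = imSq r b u := fun u => rfl
  let g : ℝ → ℝ := fun t => e.symm (Set.projIci 0 t)
  have hg1 : ∀ t, b ≤ g t := fun t => (e.symm _).2
  have hg2 : ∀ t, 0 ≤ t → imSq r b (g t) = t := by
    intro t ht
    rw [← he, e.apply_symm_apply, Set.projIci_of_mem ht]
  have hcont : Continuous g :=
    continuous_subtype_val.comp (e.symm.continuous.comp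
      ((continuous_const.max continuous_id).subtype_mk _))
  refine ⟨g, fun t ht => ?_, fun t ht => ⟨hg1 t, hg2 t ht⟩, fun u hu => ?_⟩
  · obtain ⟨d, hd, h⟩ := exists_deriv_imSq_pos (u := g t) hr hb (hg1 t)
    have hf := (contDiff_imSq r b).contDiffAt (x := g t)
    have hf' := h.hasFDerivAt_equiv hd.ne'
    have hl := hf.to_localInverse hf' (by simp)
    rw [hg2 t ht] at hl
    have hleft := (hf.hasStrictFDerivAt' hf' (by simp)).eventually_left_inverse
    have hev : ∀ᶠ s in nhdsWithin t (Set.Ici 0), hf.localInverse hf' (by simp) s = g s := by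
      filter_upwards [hcont.continuousAt.continuousWithinAt.eventually hleft, self_mem_nhdsWithin]
        with s hs hs0
      rw [hg2 s hs0] at hs
      exact hs
    exact hl.contDiffWithinAt.congr_of_eventuallyEq (hev.mono fun _ h => h.symm)
      (hev.self_of_nhdsWithin ht).symm
  · have h0 : 0 ≤ imSq r b u := by
      have : imSq r b u ∈ Set.Ici 0 := image_imSq hr hb ▸ Set.mem_image_of_mem _ hu
      exact this
    exact hmono.injOn (hg1 _) hu (hg2 _ h0)

theorem reV_cplx {n : ℕ} (x y : Fin n → ℝ) : reV (cv x + Complex.I • cv y) = x := by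
  ext i; simp [reV, cv]

theorem imV_cplx {n : ℕ} (x y : Fin n → ℝ) : imV (cv x + Complex.I • cv y) = y := by
  ext i; simp [imV, cv]

theorem contDiff_reV {n : ℕ} : ContDiff ℝ ∞ (reV (n := n)) :=
  contDiff_pi.2 fun i => Complex.reCLM.contDiff.comp (contDiff_apply ℝ ℂ i)

theorem contDiff_imV {n : ℕ} : ContDiff ℝ ∞ (imV (n := n)) :=
  contDiff_pi.2 fun i => Complex.imCLM.contDiff.comp (contDiff_apply ℝ ℂ i)

theorem dot_cplx {n : ℕ} (x y : Fin n → ℝ) :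
    (cv x + Complex.I • cv y) ⬝ᵥ (cv x + Complex.I • cv y) =
      ((x ⬝ᵥ x - y ⬝ᵥ y : ℝ) : ℂ) + Complex.I * ((2 * (x ⬝ᵥ y) : ℝ) : ℂ) := by
  simp only [add_dotProduct, dotProduct_add, smul_dotProduct, dotProduct_smul, cv_dot, smul_eq_mul]
  rw [dotProduct_comm y x]
  push_cast
  linear_combination ((y ⬝ᵥ y : ℝ) : ℂ) * Complex.I_mul_I

theorem mem_complexSphere_cplx {r : ℝ} {x y : Fin 3 → ℝ} :
    cv x + Complex.I • cv y ∈ complexSphere r ↔ x ⬝ᵥ x - y ⬝ᵥ y = r ^ 2 ∧ x ⬝ᵥ y = 0 := by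
  change _ = _ ↔ _
  rw [dot_cplx, Complex.ext_iff]
  simp [← Complex.ofReal_pow]

theorem cross_cross_eq {x p : Fin 3 → ℝ} (h : x ⬝ᵥ p = 0) : (x ⨯₃ p) ⨯₃ p = -(p ⬝ᵥ p) • x := by
  have e : (x ⨯₃ p) ⨯₃ p = (x ⬝ᵥ p) • p - (p ⬝ᵥ p) • x := by
    apply ext_fin_three <;>
    simp only [cross_zero, cross_one, cross_two, Matrix.vec3_dotProduct, Pi.smul_apply,
      Pi.sub_apply, smul_eq_mul] <;> ring
  rw [e, h, zero_smul, zero_sub, neg_smul]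

theorem cross_dot_self_of_orthogonal {x p : Fin 3 → ℝ} (h : x ⬝ᵥ p = 0) :
    (x ⨯₃ p) ⬝ᵥ (x ⨯₃ p) = (x ⬝ᵥ x) * (p ⬝ᵥ p) := by
  have e : (x ⨯₃ p) ⬝ᵥ (x ⨯₃ p) = (x ⬝ᵥ x) * (p ⬝ᵥ p) - (x ⬝ᵥ p) ^ 2 := by
    simp only [cross_zero, cross_one, cross_two, Matrix.vec3_dotProduct]
    ring
  rw [e, h]; ring

/-! ### The smooth inverse of a -/

section Inverse

variable {r B : ℝ} {z : W 3}

/-- The factor `|a|² / r²` of the real part of `aMap`, as a function of the squared angular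
velocity. -/
def reFactor (B u : ℝ) : ℝ := 1 + hs u ^ 2 * (u - B ^ 2)

theorem reFactor_pos {u : ℝ} (hu : B ^ 2 ≤ u) : 0 < reFactor B u :=
  add_pos_of_pos_of_nonneg one_pos (mul_nonneg (sq_nonneg _) (sub_nonneg.2 hu))

/-- On p^⊥ the map x ↦ x × p squares to -|p|², so x ↦ A x + k x × p acts like a complex number of
squared modulus A² + k² |p|². That modulus is computed here; `aInv` divides the conjugate by it. -/
theorem reFactor_eq (hr : 0 < r) {u q : ℝ} (hq : q = r ^ 2 * (u - B ^ 2)) :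
    (1 + hc u * (u - B ^ 2)) ^ 2 + (hc u * B / r) ^ 2 * q = reFactor B u := by
  have hr' := hr.ne'
  have e : (hc u * B / r) ^ 2 * q = (hc u * B) ^ 2 * (u - B ^ 2) := by
    rw [hq]; field_simp
  rw [e, reFactor, hs_sq]
  ring

/-- The inverse of `aMap`, for a squared angular velocity `u` and real and imaginary parts `α`
and `β`. -/
def aInv (r B u : ℝ) (α β : Fin 3 → ℝ) : W 3 :=
  ((reFactor B u)⁻¹ • ((1 + hc u * (u - B ^ 2)) • α - (hc u * B / r) • (α ⨯₃ ((hs u)⁻¹ • β))),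
    (hs u)⁻¹ • β)

theorem aMap_eq (hr : 0 < r) (hz : z ∈ (sphere r B).carrier) {u : ℝ}
    (hu : z.2 ⬝ᵥ z.2 = r ^ 2 * (u - B ^ 2)) :
    aMap r B z = cv ((1 + hc u * (u - B ^ 2)) • z.1 + (hc u * B / r) • (z.1 ⨯₃ z.2)) +
      Complex.I • cv (hs u • z.2) := by
  have hr' := hr.ne'
  rw [aMap_formula (u := u) hr hz]
  · congr 2
    rw [angVel, smul_smul, smul_sub, smul_smul, ← add_sub_assoc, add_sub_right_comm, ← sub_smul]
    congr 2
    · field_simp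
      ring
    · field_simp
  · rw [angVel_dot_self hr' hz.1 hz.2, hu]
    field_simp
    ring

theorem aInv_aMap (hr : 0 < r) (hz : z ∈ (sphere r B).carrier) {u : ℝ} (hB : B ^ 2 ≤ u)
    (hu : z.2 ⬝ᵥ z.2 = r ^ 2 * (u - B ^ 2)) :
    aInv r B u (reV (aMap r B z)) (imV (aMap r B z)) = z := by
  have hs0 : hs u ≠ 0 := (one_pos.trans_le (one_le_hs ((sq_nonneg B).trans hB))).ne'
  rw [aMap_eq hr hz hu, reV_cplx, imV_cplx, aInv, inv_smul_smul₀ hs0]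
  refine Prod.ext ?_ rfl
  simp only [map_add, map_smul, LinearMap.add_apply, LinearMap.smul_apply, cross_cross_eq hz.2]
  rw [inv_smul_eq_iff₀ (reFactor_pos hB).ne', ← reFactor_eq hr hu]
  module

theorem aInv_mem (hr : 0 < r) {u : ℝ} (hB : B ^ 2 ≤ u) {α β : Fin 3 → ℝ}
    (hβ : β ⬝ᵥ β = imSq r (B ^ 2) u) (hα : α ⬝ᵥ α - β ⬝ᵥ β = r ^ 2) (hαβ : α ⬝ᵥ β = 0) :
    aInv r B u α β ∈ (sphere r B).carrier ∧ aMap r B (aInv r B u α β) = cv α + Complex.I • cv β := by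
  have hs0 : hs u ≠ 0 := (one_pos.trans_le (one_le_hs ((sq_nonneg B).trans hB))).ne'
  have hD := (reFactor_pos hB).ne'
  set p := (hs u)⁻¹ • β with hp
  have hβp : β = hs u • p := by rw [hp, smul_inv_smul₀ hs0]
  have hpp : p ⬝ᵥ p = r ^ 2 * (u - B ^ 2) := by
    rw [hp, smul_dotProduct, dotProduct_smul, hβ, imSq, smul_eq_mul, smul_eq_mul]
    field_simp
  have hαp : α ⬝ᵥ p = 0 := by rw [hp, dotProduct_smul, hαβ, smul_zero]
  have hαα : α ⬝ᵥ α = r ^ 2 * reFactor B u := by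
    rw [reFactor, eq_add_of_sub_eq hα, hβ, imSq]; ring
  have hF := reFactor_eq hr hpp
  set A := 1 + hc u * (u - B ^ 2)
  set k := hc u * B / r
  have hz : aInv r B u α β ∈ (sphere r B).carrier := by
    constructor
    · have hv : (A • α - k • (α ⨯₃ p)) ⬝ᵥ (A • α - k • (α ⨯₃ p)) = r ^ 2 * reFactor B u ^ 2 := by
        simp only [smul_dotProduct, dotProduct_smul, sub_dotProduct, dotProduct_sub, smul_eq_mul,
          cross_dot_self_of_orthogonal hαp, dot_self_cross, dotProduct_comm (α ⨯₃ p) α, hαα]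
        rw [← hF]
        ring
      change ((reFactor B u)⁻¹ • (A • α - k • (α ⨯₃ p))) ⬝ᵥ
        ((reFactor B u)⁻¹ • (A • α - k • (α ⨯₃ p))) = r ^ 2
      rw [smul_dotProduct, dotProduct_smul, hv, smul_eq_mul, smul_eq_mul]
      field_simp
    · change ((reFactor B u)⁻¹ • (A • α - k • (α ⨯₃ p))) ⬝ᵥ p = 0
      rw [smul_dotProduct, sub_dotProduct, smul_dotProduct, smul_dotProduct, hαp,
        dotProduct_comm, dot_cross_self]
      simp
  refine ⟨hz, ?_⟩
  rw [aMap_eq hr hz hpp]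
  congr 3
  · change A • ((reFactor B u)⁻¹ • (A • α - k • (α ⨯₃ p))) +
      k • (((reFactor B u)⁻¹ • (A • α - k • (α ⨯₃ p))) ⨯₃ p) = α
    simp only [map_sub, map_smul, LinearMap.sub_apply, LinearMap.smul_apply, cross_cross_eq hαp]
    rw [smul_comm A, smul_comm k, ← smul_add, inv_smul_eq_iff₀ hD, ← hF]
    module
  · exact hβp.symm

/-- The inverse reads u off |Im a|², then p and x. As |Im a|² ≥ 0 for every complex vector, the
formula is smooth on the whole of ℂ³, and no tubular neighbourhood of the complex sphere is
required. -/
theorem exists_inverse_aMap (hr : 0 < r) : ∃ g : (Fin 3 → ℂ) → W 3, ContDiff ℝ ∞ g ∧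
    (∀ a ∈ complexSphere r, g a ∈ (sphere r B).carrier ∧ aMap r B (g a) = a) ∧
    ∀ z ∈ (sphere r B).carrier, aMap r B z ∈ complexSphere r ∧ g (aMap r B z) = z := by
  obtain ⟨U, hU, hU1, hU2⟩ := exists_inverse_imSq (r := r) hr (sq_nonneg B)
  have h0 := fun a : Fin 3 → ℂ => dot_self_nonneg_real (imV a)
  refine ⟨fun a => aInv r B (U (imV a ⬝ᵥ imV a)) (reV a) (imV a), ?_, fun a ha => ?_,
    fun z hz => ?_⟩
  · have hu : ContDiff ℝ ∞ (fun a : Fin 3 → ℂ => U (imV a ⬝ᵥ imV a)) := by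
      rw [← contDiffOn_univ] at *
      exact hU.comp (contDiffOn_univ.2 (ContDiff.dot contDiff_imV contDiff_imV)) fun a _ => h0 a
    have hhs := contDiff_hs.comp hu
    have hhc := contDiff_hc.comp hu
    have hp : ContDiff ℝ ∞ (fun a : Fin 3 → ℂ => (hs (U (imV a ⬝ᵥ imV a)))⁻¹ • imV a) :=
      (hhs.inv fun a => (one_pos.trans_le
        (one_le_hs ((sq_nonneg B).trans (hU1 _ (h0 a)).1))).ne').smul contDiff_imV
    have hw := hu.sub (contDiff_const (c := B ^ 2))
    have hcr := ContDiff.cross contDiff_reV hp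
    have hA := ((contDiff_const (c := (1 : ℝ))).add (hhc.mul hw)).smul contDiff_reV
    have hk := ((hhc.mul (contDiff_const (c := B))).div_const r).smul hcr
    have hF := ((contDiff_const (c := (1 : ℝ))).add ((hhs.pow 2).mul hw)).inv fun a =>
      (reFactor_pos (hU1 _ (h0 a)).1).ne'
    exact (hF.smul (hA.sub hk)).prodMk hp
  · rw [← cv_reV_imV a, mem_complexSphere_cplx] at ha
    obtain ⟨h1, h2⟩ := hU1 _ (h0 a)
    have h := aInv_mem hr h1 h2.symm ha.1 ha.2
    rwa [cv_reV_imV] at h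
  · have hr' := hr.ne'
    set u := (z.2 ⬝ᵥ z.2) / r ^ 2 + B ^ 2 with hu
    have hB : B ^ 2 ≤ u :=
      le_add_of_nonneg_left (div_nonneg (dot_self_nonneg_real _) (sq_nonneg r))
    have hpp : z.2 ⬝ᵥ z.2 = r ^ 2 * (u - B ^ 2) := by
      rw [hu]; field_simp; ring
    have him : imV (aMap r B z) ⬝ᵥ imV (aMap r B z) = imSq r (B ^ 2) u := by
      rw [aMap_eq hr hz hpp, imV_cplx, smul_dotProduct, dotProduct_smul, hpp, imSq, smul_eq_mul,
        smul_eq_mul]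
      ring
    exact ⟨aMap_dot hz, by
      simp only [him]
      rw [hU2 u hB, aInv_aMap hr hz hB hpp]⟩

end Inverse

/-! ### Holomorphic charts of the complex sphere -/

/-- The branch of the square root with positive real part, smooth on the slit plane. -/
def csqrt (q : ℂ) : ℂ := Complex.exp (Complex.log q / 2)

theorem csqrt_sq {q : ℂ} (hq : q ∈ Complex.slitPlane) : csqrt q ^ 2 = q := by
  rw [csqrt, ← Complex.exp_nat_mul, Nat.cast_ofNat, mul_div_cancel₀ _ two_ne_zero,
    Complex.exp_log (Complex.slitPlane_ne_zero hq)]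

theorem csqrt_re_pos {q : ℂ} (hq : q ∈ Complex.slitPlane) : 0 < (csqrt q).re := by
  have h1 := (Complex.mem_slitPlane_iff_arg.1 hq).1
  have h2 := Complex.neg_pi_lt_arg q
  have h3 := (Complex.arg_le_pi q).lt_of_ne h1
  have h4 : (Complex.log q / 2).im = Complex.arg q / 2 := by
    rw [← Complex.log_im]
    simp
  rw [csqrt, Complex.exp_re, h4]
  refine mul_pos (Real.exp_pos _) (Real.cos_pos_of_mem_Ioo ⟨?_, ?_⟩) <;> linarith

theorem csqrt_unique {t : ℂ} (ht : 0 < t.re) : t ^ 2 ∈ Complex.slitPlane ∧ csqrt (t ^ 2) = t := by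
  have h : t ^ 2 ∈ Complex.slitPlane := by
    rw [Complex.mem_slitPlane_iff, sq, Complex.mul_re, Complex.mul_im]
    by_cases h0 : t.im = 0
    · left
      rw [h0]
      nlinarith
    · right
      have := mul_ne_zero ht.ne' h0
      intro h
      apply this
      linarith
  refine ⟨h, ?_⟩
  rcases sq_eq_sq_iff_eq_or_eq_neg.1 (csqrt_sq h) with h' | h'
  · exact h'
  · have := csqrt_re_pos h
    rw [h', Complex.neg_re] at this
    linarith

theorem contDiffOn_csqrt : ContDiffOn ℝ ∞ csqrt Complex.slitPlane := fun _ hq =>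
  (((Complex.contDiffAt_log hq).div_const 2).cexp.restrict_scalars ℝ).contDiffWithinAt

/-- Forget the coordinate `l`. -/
def dropCoord (l : Fin 3) : (Fin 3 → ℂ) →L[ℂ] (Fin 2 → ℂ) :=
  ContinuousLinearMap.pi ![ContinuousLinearMap.proj (l + 1), ContinuousLinearMap.proj (l + 2)]

theorem dropCoord_apply (l : Fin 3) (a : Fin 3 → ℂ) : dropCoord l a = ![a (l + 1), a (l + 2)] := by
  ext i; fin_cases i <;> rfl

/-- Recover the coordinate `l` of a point of the complex sphere, near a point where that coordinate
is `c`. -/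
def liftCoord (r : ℝ) (l : Fin 3) (c : ℂ) (w : Fin 2 → ℂ) : Fin 3 → ℂ := fun i =>
  if i = l then c * csqrt (((r : ℂ) ^ 2 - w 0 ^ 2 - w 1 ^ 2) / c ^ 2) else
    if i = l + 1 then w 0 else w 1

theorem sum_coord (l : Fin 3) (a : Fin 3 → ℂ) :
    a ⬝ᵥ a = a l ^ 2 + a (l + 1) ^ 2 + a (l + 2) ^ 2 := by
  rw [Matrix.vec3_dotProduct]
  fin_cases l
  · change _ = a 0 ^ 2 + a 1 ^ 2 + a 2 ^ 2; ring
  · change _ = a 1 ^ 2 + a 2 ^ 2 + a 0 ^ 2; ring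
  · change _ = a 2 ^ 2 + a 0 ^ 2 + a 1 ^ 2; ring

theorem liftCoord_values (r : ℝ) (l : Fin 3) (c : ℂ) (w : Fin 2 → ℂ) :
    liftCoord r l c w l = c * csqrt (((r : ℂ) ^ 2 - w 0 ^ 2 - w 1 ^ 2) / c ^ 2) ∧
      liftCoord r l c w (l + 1) = w 0 ∧ liftCoord r l c w (l + 2) = w 1 := by
  have h1 : l + 1 ≠ l := by decide +revert
  have h2 : l + 2 ≠ l := by decide +revert
  have h3 : l + 2 ≠ l + 1 := by decide +revert
  simp [liftCoord, h1, h2, h3]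

theorem ext_coord (l : Fin 3) {a b : Fin 3 → ℂ} (h0 : a l = b l) (h1 : a (l + 1) = b (l + 1))
    (h2 : a (l + 2) = b (l + 2)) : a = b := by
  funext i
  have : ∀ i l : Fin 3, i = l ∨ i = l + 1 ∨ i = l + 2 := by decide
  rcases this i l with rfl | rfl | rfl <;> assumption

/-- Charts of the complex sphere. -/
theorem exists_chart_complexSphere {r : ℝ} (hr : 0 < r) {a₀ : Fin 3 → ℂ}
    (ha₀ : a₀ ∈ complexSphere r) : ∃ U : Set (Fin 3 → ℂ), IsOpen U ∧ a₀ ∈ U ∧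
      ∃ (φ : (Fin 3 → ℂ) →L[ℂ] (Fin 2 → ℂ)) (ψ : (Fin 2 → ℂ) → Fin 3 → ℂ) (O : Set (Fin 2 → ℂ)),
        IsOpen O ∧ ContDiffOn ℝ ∞ ψ O ∧ (∀ a ∈ complexSphere r, a ∈ U → φ a ∈ O ∧ ψ (φ a) = a) ∧
          ∀ w ∈ O, ψ w ∈ complexSphere r ∧ ψ w ∈ U ∧ φ (ψ w) = w := by
  obtain ⟨l, hl⟩ : ∃ l, a₀ l ≠ 0 := by
    by_contra! h
    have h0 : a₀ = 0 := funext h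
    rw [h0] at ha₀
    have h1 : (0 : Fin 3 → ℂ) ⬝ᵥ 0 = (r : ℂ) ^ 2 := ha₀
    rw [zero_dotProduct] at h1
    exact pow_ne_zero 2 (Complex.ofReal_ne_zero.2 hr.ne') h1.symm
  set c := a₀ l with hc
  have hq : ContDiff ℝ ∞ (fun w : Fin 2 → ℂ => ((r : ℂ) ^ 2 - w 0 ^ 2 - w 1 ^ 2) / c ^ 2) :=
    ((contDiff_const.sub ((contDiff_apply ℝ ℂ 0).pow 2)).sub
      ((contDiff_apply ℝ ℂ 1).pow 2)).div_const _
  -- On this set a_l / c has positive real part, so it is the principal root of its square, which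
  -- the other two coordinates determine.
  refine ⟨{a | 0 < (a l / c).re}, ?_, ?_, dropCoord l, liftCoord r l c,
    {w | ((r : ℂ) ^ 2 - w 0 ^ 2 - w 1 ^ 2) / c ^ 2 ∈ Complex.slitPlane}, ?_, ?_, ?_, ?_⟩
  · have h : Continuous fun a : Fin 3 → ℂ => (a l / c).re := by fun_prop
    exact isOpen_lt continuous_const h
  · change 0 < (a₀ l / c).re
    rw [← hc, div_self hl]
    exact one_pos
  · exact Complex.isOpen_slitPlane.preimage hq.continuous
  · refine contDiffOn_pi.2 fun i => ?_
    unfold liftCoord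
    split_ifs
    · exact contDiffOn_const.mul (contDiffOn_csqrt.comp hq.contDiffOn fun w hw => hw)
    · exact (contDiff_apply ℝ ℂ 0).contDiffOn
    · exact (contDiff_apply ℝ ℂ 1).contDiffOn
  · intro a ha haU
    have h1 : a ⬝ᵥ a = (r : ℂ) ^ 2 := ha
    have h2 : ((r : ℂ) ^ 2 - a (l + 1) ^ 2 - a (l + 2) ^ 2) / c ^ 2 = (a l / c) ^ 2 := by
      rw [← h1, sum_coord l, div_pow]
      ring
    obtain ⟨h3, h4⟩ := csqrt_unique haU
    rw [dropCoord_apply]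
    refine ⟨?_, ?_⟩
    · change ((r : ℂ) ^ 2 - a (l + 1) ^ 2 - a (l + 2) ^ 2) / c ^ 2 ∈ Complex.slitPlane
      rwa [h2]
    · obtain ⟨e0, e1, e2⟩ := liftCoord_values r l c ![a (l + 1), a (l + 2)]
      refine ext_coord l ?_ e1 e2
      rw [e0]
      change c * csqrt (((r : ℂ) ^ 2 - a (l + 1) ^ 2 - a (l + 2) ^ 2) / c ^ 2) = _
      rw [h2, h4, mul_div_cancel₀ _ hl]
  · intro w hw
    obtain ⟨e0, e1, e2⟩ := liftCoord_values r l c w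
    refine ⟨?_, ?_, ?_⟩
    · change _ = _
      rw [sum_coord l, e0, e1, e2, mul_pow, csqrt_sq hw]
      field_simp
      ring
    · change 0 < (liftCoord r l c w l / c).re
      rw [e0, mul_div_cancel_left₀ _ hl]
      exact csqrt_re_pos hw
    · rw [dropCoord_apply, e1, e2]
      ext i; fin_cases i <;> rfl

/-! ### The sphere: biholomorphism and magnetic complex structure -/

section SphereFinal

variable {r B : ℝ}

theorem isDiffeoOn_sphereMap (hr : 0 < r) :
    IsDiffeoOn (sphereMap r B) (sphere r B).carrier (complexSphere r) := by
  obtain ⟨g, hg, h1, h2⟩ := exists_inverse_aMap (B := B) hr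
  refine ⟨(contDiff_aMap r B).contDiffOn.congr fun z hz => sphereMap_eq hr hz, fun z hz => ?_,
    g, hg.contDiffOn, fun a ha => (h1 a ha).1, fun z hz => ?_, fun a ha => ?_⟩
  · rw [sphereMap_eq hr hz]
    exact (h2 z hz).1
  · rw [sphereMap_eq hr hz]
    exact (h2 z hz).2
  · rw [sphereMap_eq hr (h1 a ha).1]
    exact (h1 a ha).2

theorem isBiholomorphism_sphereMap (hr : 0 < r) :
    (sphere r B).IsBiholomorphism (sphereJ r B) (sphereMap r B) (complexSphere r) := by
  refine ⟨isDiffeoOn_sphereMap hr, fun z hz v hv => ?_⟩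
  have hd : DifferentiableAt ℝ (aMap r B) z := (contDiff_aMap r B).differentiable (by simp) z
  obtain ⟨h1, h2⟩ := sphereJ_spec hr hz hv
  rw [fderivWithin_congr (fun y hy => sphereMap_eq hr hy) (sphereMap_eq hr hz),
    fderivWithin_sphere_carrier hr hz hd h1, fderivWithin_sphere_carrier hr hz hd hv, h2]

/-- Charts of the complex sphere are pulled back by a. They are restrictions of complex linear maps,
so they inherit holomorphy from da ∘ J = i da. -/
theorem isComplexStructure_sphereJ (hr : 0 < r) :
    (sphere r B).IsComplexStructure (sphereJ r B) := by
  refine ⟨fun z hz v hv => ⟨(sphereJ_spec hr hz hv).1, sphereJ_sphereJ hr hz hv⟩, fun z hz => ?_⟩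
  obtain ⟨g, hg, h1, h2⟩ := exists_inverse_aMap (B := B) hr
  obtain ⟨U, hU, hzU, φ, ψ, O, hO, hψ, h3, h4⟩ := exists_chart_complexSphere hr (h2 z hz).1
  have hopen : IsOpen (aMap r B ⁻¹' U) := hU.preimage (contDiff_aMap r B).continuous
  have hφ : ContDiff ℝ ∞ (fun y => φ (aMap r B y)) :=
    ((φ.restrictScalars ℝ).contDiff).comp (contDiff_aMap r B)
  refine ⟨aMap r B ⁻¹' U, hopen, hzU, fun y => φ (aMap r B y), O, hO,
    ⟨hφ.contDiffOn, fun y hy => (h3 _ (h2 y hy.1).1 hy.2).1, fun w => g (ψ w),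
      hg.comp_contDiffOn hψ, fun w hw => ?_, fun y hy => ?_, fun w hw => ?_⟩, ?_⟩
  · obtain ⟨hS, hwU, -⟩ := h4 w hw
    refine ⟨(h1 _ hS).1, ?_⟩
    rw [Set.mem_preimage, (h1 _ hS).2]
    exact hwU
  · simp only
    rw [(h3 _ (h2 y hy.1).1 hy.2).2, (h2 y hy.1).2]
  · obtain ⟨hS, -, hw2⟩ := h4 w hw
    simp only
    rw [(h1 _ hS).2, hw2]
  · intro y hy v hv
    have hd : DifferentiableAt ℝ (aMap r B) y := (contDiff_aMap r B).differentiable (by simp) y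
    have hdφ : DifferentiableAt ℝ (fun y => φ (aMap r B y)) y := hφ.differentiable (by simp) y
    obtain ⟨e1, e2⟩ := sphereJ_spec hr hy.1 hv
    have hf : ∀ u, fderiv ℝ (fun y => φ (aMap r B y)) y u = φ (fderiv ℝ (aMap r B) y u) := by
      intro u
      have := ((φ.restrictScalars ℝ).hasFDerivAt.comp y hd.hasFDerivAt).fderiv
      exact DFunLike.congr_fun this u
    rw [fderivWithin_sphere hr hy.1 hdφ (hopen.mem_nhds hy.2) e1,
      fderivWithin_sphere hr hy.1 hdφ (hopen.mem_nhds hy.2) hv, hf, hf, e2, map_smul]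

theorem isMagneticComplexStructure_sphereJ (hr : 0 < r) {Φ : ℝ → W 3 → W 3}
    (hΦ : (sphere r B).IsMagneticFlow Φ) :
    (sphere r B).IsMagneticComplexStructure Φ (sphereJ r B) :=
  -- The continuation is defined at all complex times, so any radius above 1 would do.
  ⟨isComplexStructure_sphereJ hr, 2, one_lt_two, fun z hz =>
    ⟨contP r B z, isContinuation_contP hr hΦ hz 2, type10_sphereJ hr hz⟩⟩

end SphereFinal

/-! ### Linear algebra of the magnetic plane -/

section PlaneAlgebra

variable {K : Type*} [Field K]

theorem ext_fin_two {α : Type*} {v w : Fin 2 → α} (h0 : v 0 = w 0) (h1 : v 1 = w 1) : v = w := by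
  funext i; fin_cases i <;> assumption

/-- Rotation of the plane by a right angle. -/
def quarter : (Fin 2 → K) →ₗ[K] (Fin 2 → K) where
  toFun v := ![-v 1, v 0]
  map_add' v w := by apply ext_fin_two <;> simp [add_comm]
  map_smul' a v := by apply ext_fin_two <;> simp

theorem quarter_zero (v : Fin 2 → K) : quarter v 0 = -v 1 := rfl
theorem quarter_one (v : Fin 2 → K) : quarter v 1 = v 0 := rfl

theorem quarter_quarter (v : Fin 2 → K) : quarter (quarter v) = -v := by
  apply ext_fin_two <;> simp [quarter_zero, quarter_one]

/-- The image of a vertical vector under the flow of the plane, where `s = sin (bσ) / b` and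
`c = (1 - cos (bσ)) / b²`. -/
def planeFrame (κ b s c : K) : (Fin 2 → K) →ₗ[K] (Fin 2 → K) × (Fin 2 → K) :=
  LinearMap.prod (κ⁻¹ • (s • LinearMap.id - (b * c) • quarter))
    ((1 - b ^ 2 * c) • LinearMap.id - (b * s) • quarter)

theorem planeFrame_apply (κ b s c : K) (u : Fin 2 → K) : planeFrame κ b s c u =
    (κ⁻¹ • (s • u - (b * c) • quarter u), (1 - b ^ 2 * c) • u - (b * s) • quarter u) := rfl

/-- The momentum component of the frame is a rotation, with 1 - b² c and b s as cosine and sine; the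
witness is the inverse rotation. -/
theorem exists_planeFrame_snd {b s c : K} (h : s ^ 2 + b ^ 2 * c ^ 2 = 2 * c) (κ : K)
    (v : Fin 2 → K) : ∃ u, (planeFrame κ b s c u).2 = v := by
  refine ⟨(1 - b ^ 2 * c) • v + (b * s) • quarter v, ?_⟩
  rw [planeFrame_apply]
  simp only [map_add, map_smul, quarter_quarter]
  have e : (1 - b ^ 2 * c) * (1 - b ^ 2 * c) + b * s * (b * s) = 1 := by
    linear_combination b ^ 2 * h
  trans ((1 - b ^ 2 * c) * (1 - b ^ 2 * c) + b * s * (b * s)) • v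
  · module
  · rw [e, one_smul]

theorem planeFrame_injective {b s c : K} (h : s ^ 2 + b ^ 2 * c ^ 2 = 2 * c) (κ : K)
    {u : Fin 2 → K} (hu : planeFrame κ b s c u = 0) : u = 0 := by
  have h2 : (1 - b ^ 2 * c) • u - (b * s) • quarter u = 0 := congrArg Prod.snd hu
  have h0 := congrFun h2 0
  have h1 := congrFun h2 1
  simp only [Pi.sub_apply, Pi.smul_apply, smul_eq_mul, quarter_zero, quarter_one,
    Pi.zero_apply] at h0 h1
  apply ext_fin_two
  · change u 0 = 0
    linear_combination (1 - b ^ 2 * c) * h0 - b * s * h1 - b ^ 2 * u 0 * h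
  · change u 1 = 0
    linear_combination b * s * h0 + (1 - b ^ 2 * c) * h1 - b ^ 2 * u 1 * h

/-- The two-form of the plane. -/
def planeForm (B : K) (v w : (Fin 2 → K) × (Fin 2 → K)) : K :=
  (v.1 ⬝ᵥ w.2 - w.1 ⬝ᵥ v.2) - B * (v.1 0 * w.1 1 - v.1 1 * w.1 0)

theorem planeForm_frame_frame {κ b s c : K} (hκ : κ ≠ 0) (h : s ^ 2 + b ^ 2 * c ^ 2 = 2 * c)
    (u u' : Fin 2 → K) :
    planeForm (b * κ) (planeFrame κ b s c u) (planeFrame κ b s c u') = 0 := by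
  simp only [planeForm, planeFrame_apply, Matrix.vec2_dotProduct, Pi.sub_apply, Pi.smul_apply,
    smul_eq_mul, quarter_zero, quarter_one]
  field_simp
  linear_combination b * (u 0 * u' 1 - u 1 * u' 0) * h

theorem planeForm_horizontal {κ b s c : K} (hκ : κ ≠ 0) (y u : Fin 2 → K) :
    planeForm (b * κ) (y, 0) (planeFrame κ b s c u) = y ⬝ᵥ u := by
  simp only [planeForm, planeFrame_apply, Matrix.vec2_dotProduct, Pi.sub_apply, Pi.smul_apply,
    smul_eq_mul, quarter_zero, quarter_one, Pi.zero_apply]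
  field_simp
  ring

/-- For the converse, subtract the frame vector with the same momentum component. The remainder (y,
0) pairs with the frame vector of u to y · u, so y = 0. -/
theorem mem_range_planeFrame {κ b s c : K} (hκ : κ ≠ 0) (h : s ^ 2 + b ^ 2 * c ^ 2 = 2 * c)
    (w : (Fin 2 → K) × (Fin 2 → K)) : w ∈ LinearMap.range (planeFrame κ b s c) ↔
      ∀ v ∈ LinearMap.range (planeFrame κ b s c), planeForm (b * κ) w v = 0 := by
  constructor
  · rintro ⟨u, rfl⟩ _ ⟨u', rfl⟩
    exact planeForm_frame_frame hκ h u u'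
  · intro hw
    obtain ⟨u, hu⟩ := exists_planeFrame_snd h κ w.2
    refine ⟨u, Prod.ext ?_ hu⟩
    rw [eq_comm, ← sub_eq_zero]
    refine dotProduct_eq_zero _ fun u' => ?_
    rw [← planeForm_horizontal (b := b) (s := s) (c := c) hκ]
    have h1 := hw _ ⟨u', rfl⟩
    have h2 := planeForm_frame_frame hκ h u u'
    have h3 : (w.1 - (planeFrame κ b s c u).1, (0 : Fin 2 → K)) = w - planeFrame κ b s c u := by
      rw [← sub_self w.2]
      nth_rewrite 2 [← hu]
      rfl
    have h4 : ∀ a a' d : (Fin 2 → K) × (Fin 2 → K),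
        planeForm (b * κ) (a - a') d = planeForm (b * κ) a d - planeForm (b * κ) a' d := by
      intro a a' d
      simp only [planeForm, Prod.fst_sub, Prod.snd_sub, sub_dotProduct, dotProduct_sub,
        Pi.sub_apply]
      ring
    rw [h3, h4, h1, h2, sub_zero]

/-- The complex linear extension of the conjugate of `planeMap`. -/
def planeConj (κ b s c : K) (w : (Fin 2 → K) × (Fin 2 → K)) : Fin 2 → K :=
  w.1 - κ⁻¹ • (s • w.2 + (b * c) • quarter w.2)

/-- `planeConj` is the base component of the flow at the reversed time. Its kernel and the range of
the frame are both graphs over the momentum component, so one inclusion is enough. -/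
theorem mem_range_planeFrame_iff {κ b s c : K} (h : s ^ 2 + b ^ 2 * c ^ 2 = 2 * c)
    (w : (Fin 2 → K) × (Fin 2 → K)) : w ∈ LinearMap.range (planeFrame κ b s c) ↔
      planeConj κ b s c w = 0 := by
  have key : ∀ u, planeConj κ b s c (planeFrame κ b s c u) = 0 := by
    intro u
    simp only [planeConj, planeFrame_apply, map_sub, map_smul, quarter_quarter]
    apply ext_fin_two <;> simp only [Pi.add_apply, Pi.sub_apply, Pi.smul_apply, Pi.neg_apply,
      smul_eq_mul, Pi.zero_apply]
    · linear_combination κ⁻¹ * b * quarter u 0 * h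
    · linear_combination κ⁻¹ * b * quarter u 1 * h
  constructor
  · rintro ⟨u, rfl⟩
    exact key u
  · intro hw
    obtain ⟨u, hu⟩ := exists_planeFrame_snd h κ w.2
    refine ⟨u, Prod.ext ?_ hu⟩
    have h1 := key u
    rw [planeConj, hu] at h1
    exact (sub_eq_zero.1 h1).trans (sub_eq_zero.1 hw).symm

end PlaneAlgebra

theorem cv_quarter (v : Fin 2 → ℝ) : cv (quarter v) = quarter (cv v) := by
  apply ext_fin_two <;> simp [cv, quarter_zero, quarter_one]

theorem cvW_planeFrame (κ b s c : ℝ) (u : Fin 2 → ℝ) :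
    cvW (planeFrame κ b s c u) = planeFrame (κ : ℂ) b s c (cv u) := by
  simp only [planeFrame_apply, cvW, cv_smul, cv_sub, cv_quarter, Complex.ofReal_sub,
    Complex.ofReal_mul, Complex.ofReal_inv, Complex.ofReal_one, Complex.ofReal_pow]

/-! ### The magnetic flow of the plane -/

section Plane

variable {κ B : ℝ}

/-- The generator of the magnetic flow of the plane. -/
def planeField (κ b : ℝ) : W 2 →L[ℝ] W 2 :=
  LinearMap.toContinuousLinearMap
    (LinearMap.prod (κ⁻¹ • LinearMap.snd ℝ (Fin 2 → ℝ) (Fin 2 → ℝ))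
      ((-b) • quarter ∘ₗ LinearMap.snd ℝ (Fin 2 → ℝ) (Fin 2 → ℝ)))

theorem planeField_apply (κ b : ℝ) (z : W 2) :
    planeField κ b z = (κ⁻¹ • z.2, (-b) • quarter z.2) := rfl

/-- The magnetic flow of the plane. -/
def planeFlow (κ b σ : ℝ) : W 2 →L[ℝ] W 2 :=
  LinearMap.toContinuousLinearMap
    ((LinearMap.fst ℝ (Fin 2 → ℝ) (Fin 2 → ℝ)).prod 0 +
      planeFrame κ b (csR σ (b ^ 2)) (ccR σ (b ^ 2)) ∘ₗ LinearMap.snd ℝ (Fin 2 → ℝ) (Fin 2 → ℝ))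

theorem planeFlow_apply (κ b σ : ℝ) (z : W 2) : planeFlow κ b σ z =
    (z.1, 0) + planeFrame κ b (csR σ (b ^ 2)) (ccR σ (b ^ 2)) z.2 := rfl

theorem fderiv_energy_plane (z y : W 2) :
    fderiv ℝ (plane κ B).energy z y = κ⁻¹ * (z.2 ⬝ᵥ y.2) := by
  have he : (plane κ B).energy = fun z : W 2 => (z.2 0 * z.2 0 + z.2 1 * z.2 1) / (2 * κ) := by
    funext z
    rw [← Matrix.vec2_dotProduct]
    rfl
  have hd : Differentiable ℝ (plane κ B).energy := by
    rw [he]; fun_prop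
  refine fderiv_apply_eq_of_line (hd z) ?_
  have h := (((hasDerivAt_id (0 : ℝ)).mul_const (κ⁻¹ * (z.2 ⬝ᵥ y.2))).add
    ((hasDerivAt_pow 2 (0 : ℝ)).mul_const ((y.2 ⬝ᵥ y.2) / (2 * κ)))).const_add
      ((plane κ B).energy z)
  simp only [one_mul, Nat.reduceSub, pow_one, mul_zero, zero_mul, add_zero] at h
  refine h.congr_of_eventuallyEq (Filter.Eventually.of_forall fun t => ?_)
  simp only [he, id, Pi.add_apply, Matrix.vec2_dotProduct, Prod.snd_add, Prod.smul_snd, Pi.add_apply, Pi.smul_apply,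
    smul_eq_mul]
  field_simp
  ring

theorem isHamiltonianVector_plane (hκ : 0 < κ) {z v : W 2} :
    (plane κ B).IsHamiltonianVector z v ↔ v = planeField κ (B / κ) z := by
  have hform : ∀ y, (plane κ B).form z v y =
      (v.1 ⬝ᵥ y.2 - y.1 ⬝ᵥ v.2) - B * (v.1 0 * y.1 1 - v.1 1 * y.1 0) := fun y => rfl
  constructor
  · rintro ⟨-, h⟩
    have h' := fun y : W 2 => h y trivial
    simp only [hform, fderiv_energy_plane, Matrix.vec2_dotProduct] at h'
    have a0 := h' (0, ![1, 0])
    have a1 := h' (0, ![0, 1])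
    have b0 := h' (![1, 0], 0)
    have b1 := h' (![0, 1], 0)
    simp at a0 a1 b0 b1
    rw [planeField_apply]
    refine Prod.ext (ext_fin_two ?_ ?_) (ext_fin_two ?_ ?_)
    · simpa using a0
    · simpa using a1
    · simp only [Pi.smul_apply, smul_eq_mul, quarter_zero]
      rw [a1] at b0
      linear_combination -b0
    · simp only [Pi.smul_apply, smul_eq_mul, quarter_one]
      rw [a0] at b1
      linear_combination -b1
  · rintro rfl
    refine ⟨trivial, fun y _ => ?_⟩
    rw [hform, fderiv_energy_plane]
    simp only [planeField_apply, Matrix.vec2_dotProduct, Pi.smul_apply, smul_eq_mul, quarter_zero,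
      quarter_one]
    field_simp
    ring

theorem planeFlow_zero (κ b : ℝ) (z : W 2) : planeFlow κ b 0 z = z := by
  have h1 : csR 0 (b ^ 2) = 0 := by simp [csR, cs_zero]
  have h2 : ccR 0 (b ^ 2) = 0 := by simp [ccR, cc_zero]
  rw [planeFlow_apply, h1, h2, planeFrame_apply]
  ext <;> simp

theorem hasDerivAt_planeFlow (κ b : ℝ) (z : W 2) (σ : ℝ) :
    HasDerivAt (fun σ => planeFlow κ b σ z) (planeField κ b (planeFlow κ b σ z)) σ := by
  have hs := hasDerivAt_csR_left σ (b ^ 2)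
  have hc := hasDerivAt_ccR_left σ (b ^ 2)
  have h1 := (((hs.smul_const z.2).sub ((hc.const_mul b).smul_const (quarter z.2))).const_smul
    κ⁻¹).const_add z.1
  have h2 := (((hc.const_mul (b ^ 2)).const_sub 1).smul_const z.2).sub
    ((hs.const_mul b).smul_const (quarter z.2))
  have h := h1.prodMk h2
  have e : (fun σ => planeFlow κ b σ z) = fun σ => (z.1 + κ⁻¹ • (csR σ (b ^ 2) • z.2 -
      (b * ccR σ (b ^ 2)) • quarter z.2), (1 - b ^ 2 * ccR σ (b ^ 2)) • z.2 -
        (b * csR σ (b ^ 2)) • quarter z.2) := by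
    funext σ
    rw [planeFlow_apply, planeFrame_apply, Prod.mk_add_mk, zero_add]
  rw [e]
  refine h.congr_deriv ?_
  rw [planeField_apply, planeFlow_apply, planeFrame_apply, Prod.mk_add_mk, zero_add]
  simp only [map_sub, map_smul, quarter_quarter]
  refine Prod.ext rfl ?_
  simp only
  module

theorem isMagneticFlow_planeFlow (hκ : 0 < κ) :
    (plane κ B).IsMagneticFlow fun σ z => planeFlow κ (B / κ) σ z :=
  fun z _ => ⟨planeFlow_zero _ _ z, fun σ => ⟨trivial, _, (isHamiltonianVector_plane hκ).2 rfl,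
    hasDerivAt_planeFlow _ _ z σ⟩⟩

theorem eq_planeFlow_of_isMagneticFlow (hκ : 0 < κ) {Φ : ℝ → W 2 → W 2}
    (hΦ : (plane κ B).IsMagneticFlow Φ) : Φ = fun σ z => planeFlow κ (B / κ) σ z := by
  have h : ∀ z, (fun σ => Φ σ z) = fun σ => planeFlow κ (B / κ) σ z := by
    intro z
    obtain ⟨h0, h1⟩ := hΦ z trivial
    refine eq_of_linear_ode (planeField κ (B / κ)) (fun σ => ?_)
      (hasDerivAt_planeFlow κ (B / κ) z) (h0.trans (planeFlow_zero _ _ z).symm)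
    obtain ⟨-, v, hv, hd⟩ := h1 σ
    rwa [(isHamiltonianVector_plane hκ).1 hv] at hd
  funext σ z
  exact congrFun (h z) σ

theorem isSmoothFlow_planeFlow (κ B b : ℝ) :
    (plane κ B).IsSmoothFlow fun σ z => planeFlow κ b σ z := by
  have hcs : ContDiff ℝ ∞ fun q : ℝ × W 2 => csR q.1 (b ^ 2) := by
    have h := Complex.reCLM.contDiff.comp (ContDiff.coeff_cs
      (Complex.ofRealCLM.contDiff.comp (contDiff_fst (𝕜 := ℝ) (E := ℝ) (F := W 2) (n := ∞)))
      (contDiff_const (c := ((b ^ 2 : ℝ) : ℂ))))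
    exact h
  have hcc : ContDiff ℝ ∞ fun q : ℝ × W 2 => ccR q.1 (b ^ 2) := by
    have h := Complex.reCLM.contDiff.comp (ContDiff.coeff_cc
      (Complex.ofRealCLM.contDiff.comp (contDiff_fst (𝕜 := ℝ) (E := ℝ) (F := W 2) (n := ∞)))
      (contDiff_const (c := ((b ^ 2 : ℝ) : ℂ))))
    exact h
  have hx : ContDiff ℝ ∞ fun q : ℝ × W 2 => q.2.1 := contDiff_snd.fst
  have hp : ContDiff ℝ ∞ fun q : ℝ × W 2 => q.2.2 := contDiff_snd.snd
  have hq : ContDiff ℝ ∞ fun q : ℝ × W 2 => quarter q.2.2 := by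
    have h := (LinearMap.toContinuousLinearMap (quarter (K := ℝ))).contDiff.comp hp
    exact h
  have h1 := hx.add (((hcs.smul hp).sub
    (((contDiff_const (c := b)).mul hcc).smul hq)).const_smul κ⁻¹)
  have h2 := (((contDiff_const (c := (1 : ℝ))).sub
    ((contDiff_const (c := b ^ 2)).mul hcc)).smul hp).sub
      (((contDiff_const (c := b)).mul hcs).smul hq)
  refine (h1.prodMk h2).contDiffOn.congr fun q _ => ?_
  simp only [planeFlow_apply, planeFrame_apply, Prod.mk_add_mk, zero_add]
  rfl

end Plane

/-! ### The magnetic complex structure of the plane -/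

section PlaneComplexStructure

variable {κ B : ℝ}

/-- The analytic continuation of the push-forward of the vertical space. -/
def planeP (κ b : ℝ) (σ : ℂ) : Submodule ℂ (WC 2) :=
  LinearMap.range (planeFrame (κ : ℂ) b (cs σ (b ^ 2)) (cc σ (b ^ 2)))

theorem plane_coeff_rel (σ b : ℂ) :
    cs σ (b ^ 2) ^ 2 + b ^ 2 * cc σ (b ^ 2) ^ 2 = 2 * cc σ (b ^ 2) := cs_sq_add _ _

/-- The flow is linear, so it is its own derivative, and the vertical space is the same at every
point; the result does not depend on z. -/
theorem pushVertical_plane (κ B b : ℝ) (z : W 2) (σ : ℝ) :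
    planeP κ b σ = (plane κ B).pushVertical (fun σ z => planeFlow κ b σ z) z σ := by
  have hV : ∀ w : W 2, w ∈ ((plane κ B).vertical (planeFlow κ b (-σ) z)).map
      (fderivWithin ℝ (fun z => planeFlow κ b σ z) (plane κ B).carrier (planeFlow κ b (-σ) z) :
        W 2 →ₗ[ℝ] W 2) ↔
      ∃ u, planeFrame κ b (csR σ (b ^ 2)) (ccR σ (b ^ 2)) u = w := by
    intro w
    have h1 : fderivWithin ℝ (fun z => planeFlow κ b σ z) (plane κ B).carrier
        (planeFlow κ b (-σ) z) = planeFlow κ b σ := by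
      change fderivWithin ℝ (planeFlow κ b σ) Set.univ _ = _
      rw [fderivWithin_univ]
      exact (planeFlow κ b σ).fderiv
    rw [h1]
    constructor
    · rintro ⟨v, ⟨-, hv⟩, rfl⟩
      refine ⟨v.2, ?_⟩
      change _ = planeFlow κ b σ v
      have hv' : v.1 = 0 := hv
      rw [planeFlow_apply, hv', Prod.mk_zero_zero, zero_add]
    · rintro ⟨u, rfl⟩
      refine ⟨(0, u), ⟨trivial, rfl⟩, ?_⟩
      change planeFlow κ b σ (0, u) = _
      rw [planeFlow_apply, Prod.mk_zero_zero, zero_add]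
  have hframe : ∀ u : Fin 2 → ℝ, planeFrame (κ : ℂ) b (cs σ (b ^ 2)) (cc σ (b ^ 2)) (cv u) =
      cvW (planeFrame κ b (csR σ (b ^ 2)) (ccR σ (b ^ 2)) u) := by
    intro u
    rw [cvW_planeFrame, ofReal_csR, ofReal_ccR, Complex.ofReal_pow]
  ext w
  change _ ↔ (reW w ∈ _ ∧ imW w ∈ _)
  rw [hV, hV, planeP, LinearMap.mem_range]
  constructor
  · rintro ⟨u, rfl⟩
    rw [← cv_reV_imV u, map_add, map_smul, hframe, hframe, reW_cplx, imW_cplx]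
    exact ⟨⟨_, rfl⟩, ⟨_, rfl⟩⟩
  · rintro ⟨⟨u, hu⟩, ⟨u', hu'⟩⟩
    exact ⟨cv u + Complex.I • cv u', by
      rw [map_add, map_smul, hframe, hframe, hu, hu', cplx_reW_imW]⟩

theorem formC_plane (κ B : ℝ) (z : W 2) (v w : WC 2) :
    (plane κ B).formC z v w = planeForm (B : ℂ) v w := by
  have h : ∀ x y, (plane κ B).form z x y = planeForm B x y := fun _ _ => rfl
  rw [PhaseSpace.formC, h, h, h, h]
  apply Complex.ext <;>
    simp [planeForm, Matrix.vec2_dotProduct, reW, imW] <;> ring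

theorem isLagrangian_planeP (hκ : 0 < κ) (z : W 2) (σ : ℂ) :
    (plane κ B).IsLagrangian z (planeP κ (B / κ) σ) := by
  have hκ' : (κ : ℂ) ≠ 0 := Complex.ofReal_ne_zero.2 hκ.ne'
  refine ⟨fun w _ => ⟨trivial, trivial⟩, fun w _ => ?_⟩
  rw [planeP, mem_range_planeFrame hκ' (plane_coeff_rel _ _)]
  simp only [formC_plane, Complex.ofReal_div, div_mul_cancel₀ _ hκ']

theorem holomorphicPlanes_planeP (κ b : ℝ) (D : Set ℂ) : HolomorphicPlanes (planeP κ b) D := by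
  have h := holomorphicPlanes_map (Q := (⊤ : Submodule ℂ (Fin 2 → ℂ)))
    (by rw [finrank_top, Module.finrank_fin_fun])
    (fun σ => planeFrame (κ : ℂ) b (cs σ (b ^ 2)) (cc σ (b ^ 2)))
    (fun u => by simp only [planeFrame_apply]; fun_prop)
    (fun σ u _ hu => planeFrame_injective (plane_coeff_rel _ _) _ hu) D
  simp only [Submodule.map_top] at h
  exact h

/-- The base point of the flow of the plane at time `i`. -/
def planeMap (κ b : ℝ) : W 2 →ₗ[ℝ] (Fin 2 → ℂ) where
  toFun z := cv (z.1 + (κ⁻¹ * (b * hc (b ^ 2))) • quarter z.2) +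
    Complex.I • cv ((κ⁻¹ * hs (b ^ 2)) • z.2)
  map_add' z w := by
    simp only [Prod.fst_add, Prod.snd_add, map_add, cv_add, cv_smul]
    module
  map_smul' a z := by
    simp only [Prod.smul_fst, Prod.smul_snd, map_smul, cv_add, cv_smul, RingHom.id_apply]
    ext i
    simp only [Pi.add_apply, Pi.smul_apply, smul_eq_mul, Complex.real_smul]
    ring

theorem planeMap_apply (κ b : ℝ) (z : W 2) : planeMap κ b z =
    cv (z.1 + (κ⁻¹ * (b * hc (b ^ 2))) • quarter z.2) +
      Complex.I • cv ((κ⁻¹ * hs (b ^ 2)) • z.2) := rfl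

/-- The imaginary part is a nonzero multiple of p because `hs` is at least 1; once p is known, the
real part determines x. -/
theorem planeMap_bijective (hκ : 0 < κ) (b : ℝ) : Function.Bijective (planeMap κ b) := by
  have hne : κ⁻¹ * hs (b ^ 2) ≠ 0 :=
    (mul_pos (inv_pos.2 hκ) (one_pos.trans_le (one_le_hs (sq_nonneg b)))).ne'
  constructor
  · intro z w h
    have h2 := congrArg imV h
    rw [planeMap_apply, planeMap_apply, imV_cplx, imV_cplx] at h2
    have e2 := smul_right_injective _ hne h2
    have h1 := congrArg reV h
    rw [planeMap_apply, planeMap_apply, reV_cplx, reV_cplx, e2] at h1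
    exact Prod.ext (add_right_cancel h1) e2
  · intro a
    set p := (κ⁻¹ * hs (b ^ 2))⁻¹ • imV a with hp
    refine ⟨(reV a - (κ⁻¹ * (b * hc (b ^ 2))) • quarter p, p), ?_⟩
    rw [planeMap_apply, sub_add_cancel, hp, smul_inv_smul₀ hne, cv_reV_imV]

/-- The base point of the flow of the plane at time `i`, as a linear coordinate system. -/
def planeEquiv (hκ : 0 < κ) (b : ℝ) : W 2 ≃L[ℝ] (Fin 2 → ℂ) :=
  (LinearEquiv.ofBijective (planeMap κ b) (planeMap_bijective hκ b)).toContinuousLinearEquiv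

theorem planeEquiv_apply (hκ : 0 < κ) (b : ℝ) (z : W 2) : planeEquiv hκ b z = planeMap κ b z := rfl

/-- The magnetic complex structure of the plane. -/
def planeJ (hκ : 0 < κ) (b : ℝ) : W 2 →ₗ[ℝ] W 2 :=
  ((planeEquiv hκ b).symm : (Fin 2 → ℂ) →ₗ[ℝ] W 2) ∘ₗ
    (LinearMap.lsmul ℂ (Fin 2 → ℂ) Complex.I).restrictScalars ℝ ∘ₗ
      (planeEquiv hκ b : W 2 →ₗ[ℝ] (Fin 2 → ℂ))

theorem planeEquiv_planeJ (hκ : 0 < κ) (b : ℝ) (v : W 2) :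
    planeEquiv hκ b (planeJ hκ b v) = Complex.I • planeEquiv hκ b v :=
  (planeEquiv hκ b).apply_symm_apply _

theorem planeJ_planeJ (hκ : 0 < κ) (b : ℝ) (v : W 2) : planeJ hκ b (planeJ hκ b v) = -v := by
  apply (planeEquiv hκ b).injective
  rw [planeEquiv_planeJ, planeEquiv_planeJ, smul_smul, Complex.I_mul_I, map_neg, neg_one_smul]

theorem isDiffeoOn_planeEquiv (hκ : 0 < κ) (b : ℝ) :
    IsDiffeoOn (planeEquiv hκ b) Set.univ Set.univ :=
  ⟨(planeEquiv hκ b).contDiff.contDiffOn, Set.mapsTo_univ _ _, (planeEquiv hκ b).symm,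
    (planeEquiv hκ b).symm.contDiff.contDiffOn, Set.mapsTo_univ _ _,
    fun z _ => (planeEquiv hκ b).symm_apply_apply z,
    fun a _ => (planeEquiv hκ b).apply_symm_apply a⟩

theorem isHolomorphicOn_planeEquiv (hκ : 0 < κ) (b : ℝ) :
    (plane κ B).IsHolomorphicOn (fun _ => planeJ hκ b) (planeEquiv hκ b) Set.univ := by
  intro z _ v _
  rw [fderivWithin_univ, (planeEquiv hκ b).fderiv]
  exact planeEquiv_planeJ hκ b v

theorem isComplexStructure_planeJ (hκ : 0 < κ) (b : ℝ) :
    (plane κ B).IsComplexStructure fun _ => planeJ hκ b := by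
  refine ⟨fun _ _ v _ => ⟨trivial, planeJ_planeJ hκ b v⟩, fun z _ =>
    ⟨Set.univ, isOpen_univ, trivial, planeEquiv hκ b, Set.univ, isOpen_univ, ?_⟩⟩
  have e : (plane κ B).carrier ∩ Set.univ = Set.univ := Set.inter_univ _
  rw [e]
  exact ⟨isDiffeoOn_planeEquiv hκ b, isHolomorphicOn_planeEquiv hκ b⟩

theorem isBiholomorphism_planeEquiv (hκ : 0 < κ) (b : ℝ) :
    (plane κ B).IsBiholomorphism (fun _ => planeJ hκ b) (planeEquiv hκ b) Set.univ :=
  ⟨isDiffeoOn_planeEquiv hκ b, isHolomorphicOn_planeEquiv hκ b⟩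

theorem mem_planeP_I (κ b : ℝ) (w : WC 2) : w ∈ planeP κ b Complex.I ↔
    planeMap κ b (reW w) = Complex.I • planeMap κ b (imW w) := by
  have hconj : planeConj (κ : ℂ) b (cs Complex.I (b ^ 2)) (cc Complex.I (b ^ 2)) w =
      star (planeMap κ b (reW w) - Complex.I • planeMap κ b (imW w)) := by
    rw [← Complex.ofReal_pow, cs_I, cc_I, planeConj, planeMap_apply, planeMap_apply,
      ← Complex.ofReal_inv]
    apply ext_fin_two <;> apply Complex.ext <;>
      simp [quarter_zero, quarter_one, cv, reW, imW] <;> ring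
  rw [planeP, mem_range_planeFrame_iff (plane_coeff_rel _ _), hconj, star_eq_zero, sub_eq_zero]

theorem type10_planeJ (hκ : 0 < κ) (b : ℝ) (z : W 2) :
    (planeP κ b Complex.I : Set (WC 2)) = (plane κ B).type10 (fun _ => planeJ hκ b) z := by
  ext w
  change w ∈ planeP κ b Complex.I ↔ (reW w ∈ (⊤ : Submodule ℝ (W 2)) ∧
    imW w ∈ (⊤ : Submodule ℝ (W 2))) ∧ _
  rw [mem_planeP_I, and_iff_right ⟨trivial, trivial⟩, ← planeEquiv_apply hκ, ← planeEquiv_apply hκ,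
    ← planeEquiv_planeJ, (planeEquiv hκ b).injective.eq_iff]
  rw [← cplx_reW_imW w, reW_cplx, imW_cplx]
  set u := reW w
  set v := imW w
  have e : Complex.I • (cvW u + Complex.I • cvW v) = cvW (-v) + Complex.I • cvW u := by
    have : cvW (-v) = -cvW v := by simp only [cvW]; ext i <;> simp [cv]
    rw [smul_add, smul_smul, Complex.I_mul_I, this, neg_one_smul, add_comm]
  rw [e]
  constructor
  · intro h
    rw [h, planeJ_planeJ]
    rfl
  · intro h
    have := congrArg imW (show cvW _ + Complex.I • cvW _ = _ from h)
    rw [imW_cplx, imW_cplx] at this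
    exact this.symm

theorem isMagneticComplexStructure_planeJ (hκ : 0 < κ) :
    (plane κ B).IsMagneticComplexStructure (fun σ z => planeFlow κ (B / κ) σ z)
      (fun _ => planeJ hκ (B / κ)) :=
  ⟨isComplexStructure_planeJ hκ _, 2, one_lt_two, fun z _ => ⟨planeP κ (B / κ),
    ⟨fun σ _ => pushVertical_plane κ B _ z σ, fun σ _ => isLagrangian_planeP hκ z σ,
      holomorphicPlanes_planeP κ _ _⟩, type10_planeJ hκ _ z⟩⟩

end PlaneComplexStructure

end Magnetic

end

/-! ### The theorem -/

theorem mainTheorem7 :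
    (∀ κ B : ℝ, 0 < κ →
      (∃ Φ, (Magnetic.plane κ B).IsMagneticFlow Φ) ∧
      ∀ Φ, (Magnetic.plane κ B).IsMagneticFlow Φ →
        (Magnetic.plane κ B).IsSmoothFlow Φ ∧
        ∃ J, (Magnetic.plane κ B).IsMagneticComplexStructure Φ J ∧
          ∃ F : Magnetic.W 2 → Fin 2 → ℂ,
            (Magnetic.plane κ B).IsBiholomorphism J F Set.univ) ∧
    (∀ r B : ℝ, 0 < r →
      (∃ Φ, (Magnetic.sphere r B).IsMagneticFlow Φ) ∧
      Magnetic.IsMomentMap (Magnetic.sphere r B) (Magnetic.moment r B) ∧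
      ∀ Φ, (Magnetic.sphere r B).IsMagneticFlow Φ →
        (Magnetic.sphere r B).IsSmoothFlow Φ ∧
        (∀ z ∈ (Magnetic.sphere r B).carrier, ∃ a : ℂ → Fin 3 → ℂ, Differentiable ℂ a ∧
          (∀ σ : ℝ, a (σ : ℂ) = fun j => (((Φ σ z).1 j : ℝ) : ℂ)) ∧
          a Complex.I = Magnetic.sphereMap r B z) ∧
        ∃ J, (Magnetic.sphere r B).IsMagneticComplexStructure Φ J ∧
          (Magnetic.sphere r B).IsKahler J ∧
          (Magnetic.sphere r B).IsBiholomorphism J (Magnetic.sphereMap r B)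
            (Magnetic.complexSphere r)) := by
  refine ⟨fun κ B hκ => ⟨⟨_, Magnetic.isMagneticFlow_planeFlow hκ⟩, fun Φ hΦ => ?_⟩,
    fun r B hr => ⟨⟨_, Magnetic.isMagneticFlow_flowR hr⟩, Magnetic.isMomentMap_moment hr,
      fun Φ hΦ => ⟨Magnetic.isSmoothFlow_sphere hr hΦ,
        fun z hz => Magnetic.exists_entire_extension hr hΦ hz, Magnetic.sphereJ r B,
        Magnetic.isMagneticComplexStructure_sphereJ hr hΦ,
        Magnetic.isKahler_sphereJ hr (Magnetic.isComplexStructure_sphereJ hr),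
        Magnetic.isBiholomorphism_sphereMap hr⟩⟩⟩
  rw [Magnetic.eq_planeFlow_of_isMagneticFlow hκ hΦ]
  exact ⟨Magnetic.isSmoothFlow_planeFlow κ B _, _, Magnetic.isMagneticComplexStructure_planeJ hκ,
    _, Magnetic.isBiholomorphism_planeEquiv hκ _⟩
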